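/- Let $d\ge 1$ and let $G$ be a group acting on $\mathbb R^d$ by isometries, properly discontinuously, cocompactly and freely (for instance $\mathbb Z^d$ acting by translations). A fundamental region is a Borel set $F\subset\mathbb R^d$ whose translates $gF$, $g\in G$, are pairwise disjoint and cover $\mathbb R^d$; an admissible set is a union of finitely many, and at least one, translates of a fundamental region. Write $m=\mathcal L$ for Lebesgue measure. Let $\mu^\bullet=\sum_{i\in\mathbb N}X_i\delta_{z_i}$ be a compound Poisson process on $\mathbb R^d$, defined on some probability space: $(z_i)$ enumerates a Poisson point process with intensity measure $\alpha\mathcal L$ for a constant $\alpha$, and $(X_i)$ are iid nonnegative weights, independent of $(z_i)$. Assume that $\mu^\bullet$ has intensity one, i.e. $\mathbb E[\mu^\bullet(A)]=\mathcal L(A)$ for every Borel set $A$. A semicoupling of $\mathcal L$ and $\mu^\bullet$ is a random measure $q^\bullet$ on $\mathbb R^d\times\mathbb R^d$ which almost surely has first marginal $\le\mathcal L$ and second marginal $=\mu^\bullet$. For $\vartheta:[0,\infty)\to[0,\infty)$ put $$\mathfrak c_\infty=\inf_{q^\bullet}\ \sup_{B}\ \frac1{m(B)}\,\mathbb E\Big[\int_{\mathbb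 R^d\times B}\vartheta(|x-y|)\,q^\bullet(dx,dy)\Big]\in[0,\infty],$$ where the infimum runs over all semicouplings $q^\bullet$ of $\mathcal L$ and $\mu^\bullet$ and the supremum over all admissible sets $B$. A scale function is a continuous, strictly increasing $\vartheta:[0,\infty)\to[0,\infty)$ with $\vartheta(0)=0$ and $\lim_{r\to\infty}\vartheta(r)=\infty$. Then: (i) If $p>1$, $\mathbb E[X_1^p]=\infty$, and $\vartheta$ is a scale function with $\vartheta(r)\ge r^{(p-1)d}$ for all $r\ge0$, then $\mathfrak c_\infty=\infty$. (ii) Assume $d\le 2$ and $\mathbb E[X_1^2]<\infty$. If $\vartheta$ is a scale function and $\hat\vartheta:[1,\infty)\to\mathbb R$ is concave with $\hat\vartheta\ge\vartheta$ on $[1,\infty)$ and $\int_1^\infty \hat\vartheta(r)\,r^{-1-d/2}\,dr<\infty$, then $\mathfrak c_\infty<\infty$. (iii) Assume $d\ge3$, that $p_0=\sup\{q:\mathbb E[X_1^q]<\infty\}$ satisfies $2<p_0<\infty$, and $0<p<p_0-1$. Then $\mathfrak c_\infty<\infty$ for $\vartheta(r)=r^p$. (iv) Assume $d\ge3$ and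 $\mathbb E[X_1^q]<\infty$ for all $q>0$. Then for every $p>0$, $\mathfrak c_\infty<\infty$ for $\vartheta(r)=r^p$. -/

import Mathlib

open MeasureTheory ProbabilityTheory Filter Topology
open scoped NNReal ENNReal Pointwise

noncomputable section

/-- The standing assumptions on the group `G` of isometries acting on `M`: the action is properly
discontinuous, cocompact and free. -/
structure IsAdmissibleAction (G M : Type*) [Group G] [MetricSpace M] [MulAction G M] : Prop where
  isometric : ∀ g : G, Isometry (fun x : M => g • x)
  properlyDiscontinuous : ∀ (x : M) (K : Set M), IsCompact K → {g : G | g • x ∈ K}.Finite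
  cocompact : CompactSpace (Quotient (MulAction.orbitRel G M))
  free : ∀ (g : G) (x : M), g • x = x → g = 1

/-- A fundamental region: a measurable set whose translates by `G` partition `M` exactly. -/
structure IsFundamentalRegion (G : Type*) {M : Type*} [Group G] [MulAction G M]
    [MeasurableSpace M] (F : Set M) : Prop where
  measurableSet : MeasurableSet F
  iUnion_smul : ⋃ g : G, g • F = Set.univ
  disjoint_smul : ∀ g : G, g ≠ 1 → Disjoint F (g • F)

/-- Admissible sets: unions of finitely many (at least one) translates of a fundamental region. -/
def IsAdm (G : Type*) {M : Type*} [Group G] [MulAction G M] [MeasurableSpace M]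
    (B : Set M) : Prop :=
  ∃ (F : Set M) (I : Finset G), IsFundamentalRegion G F ∧ I.Nonempty ∧ B = ⋃ g ∈ I, g • F

/-- Scale functions: continuous, strictly increasing functions `ϑ : [0,∞) → [0,∞)` with
`ϑ 0 = 0` and `ϑ r → ∞` as `r → ∞`. -/
structure IsScaleFunction (ϑ : ℝ≥0 → ℝ≥0) : Prop where
  continuous : Continuous ϑ
  strictMono : StrictMono ϑ
  map_zero : ϑ 0 = 0
  tendsto_atTop : Tendsto ϑ atTop atTop

/-- `q` is a semicoupling of the measures `lam` and `mu`: its first marginal is at most `lam` and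
its second marginal equals `mu`. -/
def IsSemicouplingMeasure {M : Type*} [MeasurableSpace M] (lam mu : Measure M)
    (q : Measure (M × M)) : Prop :=
  q.map Prod.fst ≤ lam ∧ q.map Prod.snd = mu

/-- A semicoupling of the random measures `lam` and `mu` (random measures are kernels from the
probability space): a random measure on `M × M` that is almost surely a semicoupling. -/
def IsSemicoupling {Ω M : Type*} [MeasurableSpace Ω] [MeasurableSpace M] (P : Measure Ω)
    (lam mu : Kernel Ω M) (q : Kernel Ω (M × M)) : Prop :=
  ∀ᵐ ω ∂P, IsSemicouplingMeasure (lam ω) (mu ω) (q ω)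

/-- The mean transportation cost
`sup_{B ∈ Adm(M)} m(B)⁻¹ 𝔼[∫_{M × B} ϑ(d(x, y)) q(dx, dy)]`. -/
def meanTransportCost {Ω M : Type*} [MeasurableSpace Ω] [MetricSpace M] [MeasureSpace M]
    (P : Measure Ω) (G : Type*) [Group G] [MulAction G M] (ϑ : ℝ≥0 → ℝ≥0)
    (q : Kernel Ω (M × M)) : ℝ≥0∞ :=
  ⨆ (B : Set M) (_ : IsAdm G B),
    (volume B)⁻¹ *
      ∫⁻ ω, ∫⁻ xy in Set.univ ×ˢ B, (ϑ (nndist xy.1 xy.2) : ℝ≥0∞) ∂(q ω) ∂P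

/-- The cost `𝔠_∞`: the infimum of the mean transportation cost over all semicouplings. -/
def optimalMeanCost {Ω M : Type*} [MeasurableSpace Ω] [MetricSpace M] [MeasureSpace M]
    (P : Measure Ω) (G : Type*) [Group G] [MulAction G M] (ϑ : ℝ≥0 → ℝ≥0)
    (lam mu : Kernel Ω M) : ℝ≥0∞ :=
  ⨅ (q : Kernel Ω (M × M)) (_ : IsSemicoupling P lam mu q), meanTransportCost P G ϑ q

/-- The sequence of random points `z` enumerates (with multiplicity) a Poisson point process on
`M` with intensity measure `α • volume`. -/
structure IsPoissonEnumeration {Ω M : Type*} [MeasurableSpace Ω] [MeasureSpace M]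
    (P : Measure Ω) (α : ℝ≥0) (z : ℕ → Ω → M) : Prop where
  measurable : ∀ i, Measurable (z i)
  /-- the number of points in a Borel set `A` of finite volume is Poisson with mean `α m(A)` -/
  law : ∀ A : Set M, MeasurableSet A → volume A < ∞ →
    P.map (fun ω => (Measure.sum fun i => Measure.dirac (z i ω)) A) =
      (poissonMeasure (α * (volume A).toNNReal)).map (fun n : ℕ => (n : ℝ≥0∞))
  /-- the numbers of points in disjoint Borel sets are independent -/
  indep : ∀ (k : ℕ) (A : Fin k → Set M), (∀ j, MeasurableSet (A j)) →
    Pairwise (fun i j => Disjoint (A i) (A j)) →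
    iIndepFun (fun j ω => (Measure.sum fun i => Measure.dirac (z i ω)) (A j)) P

/-- `mu` is a `γ`-compound Poisson process: `mu = ∑ i, X i • δ_{z i}`, where the `z i` are the
points of a Poisson point process with intensity measure `α • volume` and the weights `X i ≥ 0`
are iid with law `γ` and independent of the points. -/
def IsCompoundPoisson {Ω M : Type*} [MeasurableSpace Ω] [MeasureSpace M]
    (P : Measure Ω) (α : ℝ≥0) (γ : Measure ℝ≥0) (mu : Kernel Ω M) : Prop :=
  ∃ (z : ℕ → Ω → M) (X : ℕ → Ω → ℝ≥0),
    IsPoissonEnumeration P α z ∧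
    (∀ i, Measurable (X i)) ∧
    (∀ i, P.map (X i) = γ) ∧
    iIndepFun X P ∧
    IndepFun (fun ω i => z i ω) (fun ω i => X i ω) P ∧
    ∀ᵐ ω ∂P, mu ω = Measure.sum fun i => X i ω • Measure.dirac (z i ω)

/-- The random measure `mu` has unit intensity: `𝔼[mu(A)] = m(A)` for all Borel sets `A`. -/
def HasUnitIntensity {Ω M : Type*} [MeasurableSpace Ω] [MeasureSpace M]
    (P : Measure Ω) (mu : Kernel Ω M) : Prop :=
  ∀ A : Set M, MeasurableSet A → ∫⁻ ω, mu ω A ∂P = volume A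

/-- The moment `𝔼[X^q] ∈ [0,∞]` of a nonnegative random variable `X` with law `γ`. -/
def weightMoment (γ : Measure ℝ≥0) (q : ℝ) : ℝ≥0∞ :=
  ∫⁻ x, (x : ℝ≥0∞) ^ q ∂γ

end

/-! ### Fundamental regions of finite positive volume -/

section FundamentalRegion

variable {G M : Type*} [Group G] [MetricSpace M] [MulAction G M]

/-! Part (i) is local. An atom of weight `x` at `y` must draw its mass from Lebesgue measure, and
the ball around `y` of volume `x / 2` supplies at most half of it. The other half travels at least a
multiple of x^(1/d), which costs at least a multiple of x^p (`lintegral_cost_ge_of_atom`). The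
weights are independent of the points, so a single atom that lies with positive probability in a
fundamental region of finite positive volume already makes the cost infinite.

The finiteness parts rest on explicit semicouplings built from dyadic boxes. A box of level n has
volume 2^n and sides of order 2^(n/d), and it is the union of two boxes of level n - 1. Let D_n be
its mass minus its volume, a sum of the independent centred deviations of its halves. Hence E[D_n^2]
= V 2^n, and for q > 2 a finite q-th weight moment gives E|D_n|^q ≤ K 2^(nq/2)
(`IsCompoundPoisson.lintegral_boxDeviation_rpow_le`).

A semicoupling need not be invariant, so one fixed grid suffices. The mass of a point is spread with
a density that depends only on the unit cell of the point and on box masses. The cost is bounded in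
terms of the masses of the boxes around the cell. Given these, a Borel subset of the cell carries on
average its share of the mass of the cell (`IsCompoundPoisson.lintegral_mass_mul_boxMasses`, from a
Mecke formula). So the cost over an arbitrary admissible set reduces to a bound on E[mass of a cell
times cost per unit mass], uniform over the cells (`optimalMeanCost_lt_top_of_density`).

For (iii) and (iv), space is deformed level by level: in each box of level n + 1 the two halves are
stretched along one axis to volumes proportional to their masses. In the limit a cell of positive
mass becomes a box whose volume is that mass, images of distinct cells are disjoint
(`IsBoxMass.volume_flowBox`, `IsBoxMass.disjoint_flowBox`), and the mass is spread uniformly over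
the image. Step n moves points by at most about 2^(n/d) |D| / 2^n, with D the deviations at levels n
and n + 1. In L^q this is of order 2^(n(1/d - 1/2)), summable for d ≥ 3. Since the mass of the cell
multiplies the p-th power of the displacement, moments of order q ≥ p + 1 are needed.

For (ii), mass is matched greedily: within each unit cell first, then, at each level, leftover mass
with leftover volume in the same box, in proportion. After the box of level n is treated, the
positive part of D_n is left. So the mass per unit volume still unmatched before level n is of order
2^(-n/2), while the distances at level n are of order 2^(n/d). The cost is at most a multiple of Σ
ϑ(2d 2^(n/d)) 2^(-n/2), which is compared with the integral of the concave majorant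
(`tsum_ofReal_boxDiameter_lt_top`). -/

theorem IsAdmissibleAction.exists_wandering_ball (hG : IsAdmissibleAction G M) [ProperSpace M]
    (x : M) : ∃ r > 0, ∀ (g : G) (y : M), y ∈ Metric.ball x r → g • y ∈ Metric.ball x r → g = 1 := by
  have hfin : ({g : G | g • x ∈ Metric.closedBall x 1} \ {1}).Finite :=
    (hG.properlyDiscontinuous x _ (isCompact_closedBall x 1)).sdiff
  have hS : ((fun g : G => g • x) '' ({g : G | g • x ∈ Metric.closedBall x 1} \ {1}))ᶜ ∈ 𝓝 x := by
    refine (hfin.image _).isClosed.isOpen_compl.mem_nhds ?_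
    rintro ⟨g, ⟨-, hg⟩, hgx⟩
    exact hg (hG.free g x hgx)
  obtain ⟨ε, hε, hball⟩ := Metric.mem_nhds_iff.1 hS
  -- By isometry such a `g` moves `x` by less than two radii, that is by less than `min ε 1`. The 1
  -- puts `g` into the finite set, and `ε` then contradicts the choice of the ball.
  refine ⟨min ε 1 / 2, by positivity, fun g y hy hgy => ?_⟩
  by_contra hg
  have h1 : dist (g • x) x < min ε 1 := by
    calc dist (g • x) x ≤ dist (g • x) (g • y) + dist (g • y) x := dist_triangle _ _ _
      _ = dist x y + dist (g • y) x := by rw [(hG.isometric g).dist_eq]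
      _ < min ε 1 / 2 + min ε 1 / 2 := by
        rw [dist_comm x y]
        exact add_lt_add hy hgy
      _ = min ε 1 := by ring
  have h2 : g • x ∈ Metric.ball x ε := h1.trans_le (min_le_left _ _)
  exact hball h2 ⟨g, ⟨(h1.trans_le (min_le_right _ _)).le, hg⟩, rfl⟩

/-- Greedy choice: each new `U a` loses the points whose orbit already meets `F`. The last clause is
the inductive invariant that makes the saturation of `F` a union of open sets, hence measurable
without countability of `G`. -/
theorem exists_measurable_transversal [ContinuousConstSMul G M] [MeasurableSpace M] [BorelSpace M]
    {ι : Type*} (t : Finset ι) (U : ι → Set M) (hU : ∀ i, IsOpen (U i))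
    (hw : ∀ i, ∀ (g : G) (y : M), y ∈ U i → g • y ∈ U i → g = 1) :
    ∃ F : Set M, MeasurableSet F ∧ F ⊆ ⋃ i ∈ t, U i ∧
      (∀ (g : G) (y : M), y ∈ F → g • y ∈ F → g = 1) ∧
      ∀ y, (∃ i ∈ t, ∃ g : G, g • y ∈ U i) ↔ ∃ g : G, g • y ∈ F := by
  classical
  induction t using Finset.induction_on with
  | empty => exact ⟨∅, MeasurableSet.empty, by simp, by simp, by simp⟩
  | insert a t ha ih =>
    obtain ⟨F, hF, hFt, hFd, hFo⟩ := ih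
    have hsat : MeasurableSet {y : M | ∃ g : G, g • y ∈ F} := by
      have : {y : M | ∃ g : G, g • y ∈ F} = ⋃ i ∈ t, ⋃ g : G, (fun y => g • y) ⁻¹' (U i) := by
        ext y
        simp only [Set.mem_ofPred_eq, ← hFo y, Set.mem_iUnion, Set.mem_preimage, exists_prop]
      rw [this]
      exact (isOpen_biUnion fun i _ => isOpen_iUnion fun g =>
        (hU i).preimage (continuous_const_smul g)).measurableSet
    refine ⟨F ∪ (U a \ {y : M | ∃ g : G, g • y ∈ F}), hF.union ((hU a).measurableSet.diff hsat),
      ?_, ?_, ?_⟩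
    · rw [Finset.set_biUnion_insert]
      exact Set.union_subset (hFt.trans Set.subset_union_right)
        (Set.sdiff_subset.trans Set.subset_union_left)
    · rintro g y (hy | ⟨hy, hy'⟩) (hgy | ⟨hgy, hgy'⟩)
      · exact hFd g y hy hgy
      · exact absurd ⟨g⁻¹, by simpa using hy⟩ hgy'
      · exact absurd ⟨g, hgy⟩ hy'
      · exact hw a g y hy hgy
    · intro y
      constructor
      · rintro ⟨i, hi, g, hg⟩
        by_cases hyF : ∃ g : G, g • y ∈ F
        · obtain ⟨g', hg'⟩ := hyF
          exact ⟨g', Or.inl hg'⟩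
        · rcases Finset.mem_insert.1 hi with rfl | hi
          · refine ⟨g, Or.inr ⟨hg, ?_⟩⟩
            rintro ⟨g', hg'⟩
            exact hyF ⟨g' * g, by rwa [mul_smul]⟩
          · exact absurd ((hFo y).1 ⟨i, hi, g, hg⟩) hyF
      · rintro ⟨g, hg | hg⟩
        · obtain ⟨i, hi, g', hg'⟩ := (hFo y).2 ⟨g, hg⟩
          exact ⟨i, Finset.mem_insert_of_mem hi, g', hg'⟩
        · exact ⟨a, Finset.mem_insert_self _ _, g, hg.1⟩

theorem IsAdmissibleAction.continuousConstSMul (hG : IsAdmissibleAction G M) :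
    ContinuousConstSMul G M := ⟨fun g => (hG.isometric g).continuous⟩

/-- The images of finitely many wandering balls cover the compact quotient, and a transversal inside
their union is bounded. -/
theorem IsAdmissibleAction.exists_bounded_fundamentalRegion (hG : IsAdmissibleAction G M)
    [ProperSpace M] [MeasurableSpace M] [BorelSpace M] :
    ∃ F : Set M, IsFundamentalRegion G F ∧ Bornology.IsBounded F := by
  have := hG.continuousConstSMul
  have := hG.cocompact
  choose r hr hw using hG.exists_wandering_ball (G := G) (M := M)
  let π : M → Quotient (MulAction.orbitRel G M) := Quotient.mk _
  have hopen : IsOpenMap π := isOpenMap_quotient_mk'_mul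
  obtain ⟨t, ht⟩ := (isCompact_univ (X := Quotient (MulAction.orbitRel G M))).elim_finite_subcover
    (fun x : M => π '' Metric.ball x (r x)) (fun x => hopen _ Metric.isOpen_ball) (by
      intro q _
      obtain ⟨x, rfl⟩ := Quotient.exists_rep q
      exact Set.mem_iUnion.2 ⟨x, x, Metric.mem_ball_self (hr x), rfl⟩)
  obtain ⟨F, hF, hFt, hFd, hFo⟩ := exists_measurable_transversal (G := G) t
    (fun x : M => Metric.ball x (r x)) (fun x => Metric.isOpen_ball) hw
  refine ⟨F, ⟨hF, ?_, ?_⟩, ?_⟩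
  · refine Set.eq_univ_of_forall fun y => ?_
    have := ht (Set.mem_univ (π y))
    simp only [Set.mem_iUnion] at this
    obtain ⟨x, hx, w, hw', hwy⟩ := this
    obtain ⟨g, hg⟩ : ∃ g : G, g • y = w := Quotient.exact hwy
    obtain ⟨g', hg'⟩ := (hFo y).1 ⟨x, hx, g, by rwa [hg]⟩
    exact Set.mem_iUnion.2 ⟨g'⁻¹, Set.mem_smul_set_iff_inv_smul_mem.2 (by simpa using hg')⟩
  · intro g hg
    refine Set.disjoint_left.2 fun y hy hgy => hg ?_
    rw [Set.mem_smul_set_iff_inv_smul_mem] at hgy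
    simpa using hFd g⁻¹ y hy hgy
  · exact ((Bornology.isBounded_biUnion_finset t).2 fun x _ => Metric.isBounded_ball).subset hFt

theorem IsAdmissibleAction.countable (hG : IsAdmissibleAction G M) [ProperSpace M] (x : M) :
    Countable G := by
  have h : (⋃ n : ℕ, {g : G | g • x ∈ Metric.closedBall x n}) = Set.univ := by
    refine Set.eq_univ_of_forall fun g => ?_
    obtain ⟨n, hn⟩ := exists_nat_ge (dist (g • x) x)
    exact Set.mem_iUnion.2 ⟨n, hn⟩
  rw [← Set.countable_univ_iff, ← h]
  exact Set.countable_iUnion fun n =>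
    (hG.properlyDiscontinuous x _ (isCompact_closedBall x n)).countable

end FundamentalRegion

/-- Isometries preserve Hausdorff measure, here equal to Lebesgue measure. A null region would
therefore have countably many null translates covering the space. -/
theorem IsAdmissibleAction.exists_finite_pos_fundamentalRegion {d : ℕ} {G : Type*} [Group G]
    [MulAction G (EuclideanSpace ℝ (Fin d))]
    (hG : IsAdmissibleAction G (EuclideanSpace ℝ (Fin d))) :
    ∃ F : Set (EuclideanSpace ℝ (Fin d)), IsFundamentalRegion G F ∧ volume F ≠ 0 ∧ volume F ≠ ∞ := by
  obtain ⟨F, hF, hb⟩ := hG.exists_bounded_fundamentalRegion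
  refine ⟨F, hF, fun h0 => ?_, hb.measure_lt_top.ne⟩
  have := hG.countable 0
  have h : volume (Set.univ : Set (EuclideanSpace ℝ (Fin d))) = 0 := by
    rw [← hF.iUnion_smul, measure_iUnion_null_iff]
    intro g
    have := (hG.isometric g).euclideanHausdorffMeasure_image (d := d) F
    rw [EuclideanSpace.euclideanHausdorffMeasure_eq_volume, h0] at this
    exact this
  exact isOpen_univ.measure_ne_zero volume Set.univ_nonempty h

theorem IsFundamentalRegion.isAdm {G M : Type*} [Group G] [MulAction G M] [MeasurableSpace M]
    {F : Set M} (hF : IsFundamentalRegion G F) : IsAdm G F :=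
  ⟨F, {1}, hF, by simp, by simp⟩

theorem IsAdm.measurableSet {G M : Type*} [Group G] [MetricSpace M] [MulAction G M]
    [MeasurableSpace M] [BorelSpace M] (hG : IsAdmissibleAction G M) {B : Set M}
    (hB : IsAdm G B) : MeasurableSet B := by
  have := hG.continuousConstSMul
  obtain ⟨F, I, hF, -, rfl⟩ := hB
  exact Finset.measurableSet_biUnion _ fun g _ => hF.measurableSet.const_smul g

/-! ### Part (i): infinite cost from a heavy atom -/

section InfiniteCost

variable {d : ℕ}

theorem lintegral_cost_ge_of_atom [NeZero d] {p : ℝ} (hp : 1 < p) {ϑ : ℝ≥0 → ℝ≥0}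
    (hmono : StrictMono ϑ) (hϑ : ∀ r : ℝ≥0, r ^ ((p - 1) * (d : ℝ)) ≤ ϑ r) :
    ∃ c : ℝ≥0, 0 < c ∧ ∀ (q : Measure (EuclideanSpace ℝ (Fin d) × EuclideanSpace ℝ (Fin d)))
      (y : EuclideanSpace ℝ (Fin d)) (x : ℝ≥0), q.map Prod.fst ≤ volume →
      (x : ℝ≥0∞) ≤ q (Set.univ ×ˢ {y}) →
      (c : ℝ≥0∞) * (x : ℝ≥0∞) ^ p ≤
        ∫⁻ xy in Set.univ ×ˢ {y}, (ϑ (nndist xy.1 xy.2) : ℝ≥0∞) ∂q := by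
  set v : ℝ≥0∞ := volume (Metric.ball (0 : EuclideanSpace ℝ (Fin d)) 1) with hv
  have hv0 : v ≠ 0 := (Metric.measure_ball_pos _ _ one_pos).ne'
  have hvt : v ≠ ∞ := measure_ball_lt_top.ne
  lift v to ℝ≥0 using hvt with w hw
  have hw0 : 0 < w := pos_iff_ne_zero.2 (by simpa using hv0)
  have hd : (d : ℝ) ≠ 0 := Nat.cast_ne_zero.2 (NeZero.ne d)
  refine ⟨(1 / (2 * w)) ^ (p - 1) / 2, by positivity, fun q y x hq hx => ?_⟩
  rcases eq_or_ne x 0 with rfl | hx0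
  · simp [ENNReal.zero_rpow_of_pos (zero_lt_one.trans hp)]
  -- With `w` the volume of the unit ball, this is the radius at which the ball around `y` has
  -- volume `x / 2`.
  set r : ℝ≥0 := (x / (2 * w)) ^ (1 / (d : ℝ)) with hr
  have hr0 : 0 < r := NNReal.rpow_pos (by positivity)
  have hrd : r ^ d = x / (2 * w) := by
    rw [hr, ← NNReal.rpow_natCast, ← NNReal.rpow_mul, one_div, inv_mul_cancel₀ hd, NNReal.rpow_one]
  have hball : volume (Metric.ball y r) = (x / 2 : ℝ≥0) := by
    rw [Measure.addHaar_ball_of_pos _ _ (NNReal.coe_pos.2 hr0), ← hv, finrank_euclideanSpace_fin,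
      ENNReal.ofReal_pow r.coe_nonneg, ENNReal.ofReal_coe_nnreal, ← ENNReal.coe_pow, ← ENNReal.coe_mul, hrd]
    congr 1
    field_simp
  have h1 : q (Metric.ball y r ×ˢ {y}) ≤ (x / 2 : ℝ≥0) := by
    rw [← hball]
    refine le_trans ?_ (hq _)
    rw [Measure.map_apply measurable_fst Metric.isOpen_ball.measurableSet]
    exact measure_mono fun z hz => hz.1
  have h2 : (x / 2 : ℝ≥0) ≤ q ((Metric.ball y r)ᶜ ×ˢ {y}) := by
    have h3 : (x : ℝ≥0∞) ≤ (x / 2 : ℝ≥0) + q ((Metric.ball y r)ᶜ ×ˢ {y}) := by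
      refine hx.trans (le_trans ?_ (add_le_add_left h1 _))
      refine (measure_mono ?_).trans (measure_union_le _ _)
      rw [← Set.union_prod, Set.union_compl_self]
    have h4 : (x : ℝ≥0∞) = (x / 2 : ℝ≥0) + (x / 2 : ℝ≥0) := by
      rw [← ENNReal.coe_add, add_halves]
    rw [h4] at h3
    exact (ENNReal.add_le_add_iff_left ENNReal.coe_ne_top).1 h3
  calc (((1 / (2 * w)) ^ (p - 1) / 2 : ℝ≥0) : ℝ≥0∞) * (x : ℝ≥0∞) ^ p
      = ((r ^ ((p - 1) * (d : ℝ)) : ℝ≥0) : ℝ≥0∞) * (x / 2 : ℝ≥0) := by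
        rw [← ENNReal.coe_rpow_of_nonneg _ (by linarith), ← ENNReal.coe_mul, ← ENNReal.coe_mul]
        congr 1
        rw [mul_comm (p - 1), NNReal.rpow_mul, NNReal.rpow_natCast, hrd, div_eq_mul_one_div x,
          NNReal.mul_rpow]
        have : x ^ p = x ^ (p - 1) * x := by
          rw [← NNReal.rpow_add_one hx0, sub_add_cancel]
        rw [this]
        ring
    _ ≤ (ϑ r : ℝ≥0∞) * q ((Metric.ball y r)ᶜ ×ˢ {y}) :=
        mul_le_mul' (ENNReal.coe_le_coe.2 (hϑ r)) h2
    _ = ∫⁻ _ in (Metric.ball y r)ᶜ ×ˢ {y}, (ϑ r : ℝ≥0∞) ∂q := by simp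
    _ ≤ ∫⁻ xy in (Metric.ball y r)ᶜ ×ˢ {y}, (ϑ (nndist xy.1 xy.2) : ℝ≥0∞) ∂q := by
        refine setLIntegral_mono' (Metric.isOpen_ball.measurableSet.compl.prod
          (measurableSet_singleton y)) fun z hz => ?_
        obtain ⟨hz1, hz2⟩ := hz
        rw [Set.mem_singleton_iff] at hz2
        refine ENNReal.coe_le_coe.2 (hmono.monotone ?_)
        rw [hz2]
        simpa [NNReal.coe_le_coe, ← coe_nndist] using hz1
    _ ≤ _ := lintegral_mono_set (Set.prod_mono (Set.subset_univ _) subset_rfl)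

theorem optimalMeanCost_eq_top_of_moment_eq_top [NeZero d] {Ω : Type*} [MeasurableSpace Ω]
    (P : Measure Ω) [IsProbabilityMeasure P] {G : Type*} [Group G]
    [MulAction G (EuclideanSpace ℝ (Fin d))]
    (hG : IsAdmissibleAction G (EuclideanSpace ℝ (Fin d))) {α : ℝ≥0} {γ : Measure ℝ≥0}
    {mu : Kernel Ω (EuclideanSpace ℝ (Fin d))} (hmu : IsCompoundPoisson P α γ mu)
    (hint : HasUnitIntensity P mu) {ϑ : ℝ≥0 → ℝ≥0} {p : ℝ} (hscale : IsScaleFunction ϑ)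
    (hp : 1 < p) (hmom : weightMoment γ p = ∞) (hϑ : ∀ r : ℝ≥0, r ^ ((p - 1) * (d : ℝ)) ≤ ϑ r) :
    optimalMeanCost P G ϑ (Kernel.const Ω volume) mu = ∞ := by
  obtain ⟨F, hF, hF0, hFt⟩ := hG.exists_finite_pos_fundamentalRegion
  obtain ⟨z, X, hz, hX, hXγ, -, hzX, hrep⟩ := hmu
  obtain ⟨c, hc, hcost⟩ := lintegral_cost_ge_of_atom (d := d) hp hscale.strictMono hϑ
  have hFm := hF.measurableSet
  -- If no point ever hit `F`, the mass of `F` would vanish almost surely, against unit intensity.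
  obtain ⟨i, hi⟩ : ∃ i, P {ω | z i ω ∈ F} ≠ 0 := by
    by_contra! h
    apply hF0
    rw [← hint F hFm, lintegral_eq_zero_iff (mu.measurable_coe hFm)]
    have h' : ∀ᵐ ω ∂P, ∀ i, z i ω ∉ F := ae_all_iff.2 fun i => by
      rw [ae_iff]; simpa using h i
    filter_upwards [hrep, h'] with ω h1 h2
    simp [h1, Measure.sum_apply _ hFm, h2, hFm]
  refine iInf₂_eq_top.2 fun q hq => ?_
  refine top_unique (le_iSup₂_of_le F hF.isAdm ?_)
  suffices h : ∫⁻ ω, ∫⁻ xy in Set.univ ×ˢ F, (ϑ (nndist xy.1 xy.2) : ℝ≥0∞) ∂(q ω) ∂P = ∞ by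
    rw [h, ENNReal.mul_top (ENNReal.inv_ne_zero.2 hFt)]
  -- Only the cost of serving the location of the `i`-th point is kept. Other points there can only
  -- add mass, so the atom weighs at least `X i ω`.
  have hle : ∫⁻ ω, (c : ℝ≥0∞) * (F.indicator (fun _ => (1 : ℝ≥0∞)) (z i ω) * (X i ω : ℝ≥0∞) ^ p) ∂P ≤
      ∫⁻ ω, ∫⁻ xy in Set.univ ×ˢ F, (ϑ (nndist xy.1 xy.2) : ℝ≥0∞) ∂(q ω) ∂P := by
    refine lintegral_mono_ae ?_
    filter_upwards [hrep, hq] with ω h1 h2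
    by_cases hmem : z i ω ∈ F
    · rw [Set.indicator_of_mem hmem, one_mul]
      refine (hcost (q ω) (z i ω) (X i ω) (by simpa using h2.1) ?_).trans
        (lintegral_mono_set (Set.prod_mono subset_rfl (Set.singleton_subset_iff.2 hmem)))
      have h3 : q ω (Set.univ ×ˢ {z i ω}) = mu ω {z i ω} := by
        rw [← h2.2, Measure.map_apply measurable_snd (measurableSet_singleton _), Set.univ_prod]
      rw [h3, h1, Measure.sum_apply _ (measurableSet_singleton _)]
      refine le_trans ?_ (ENNReal.le_tsum i)
      rw [Measure.coe_nnreal_smul_apply, Measure.dirac_apply_of_mem (Set.mem_singleton _), mul_one]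
    · rw [Set.indicator_of_notMem hmem, zero_mul, mul_zero]
      exact zero_le
  refine top_unique (le_trans (top_le_iff.2 ?_) hle)
  have hind : Measurable (fun ω => F.indicator (fun _ => (1 : ℝ≥0∞)) (z i ω)) :=
    (measurable_const.indicator hFm).comp (hz.measurable i)
  have hXm : Measurable (fun ω => (X i ω : ℝ≥0∞) ^ p) := (hX i).coe_nnreal_ennreal.pow_const p
  rw [lintegral_const_mul _ (by exact hind.mul hXm)]
  have hindep : IndepFun (fun ω => F.indicator (fun _ => (1 : ℝ≥0∞)) (z i ω))
      (fun ω => (X i ω : ℝ≥0∞) ^ p) P :=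
    hzX.comp (φ := fun s : ℕ → EuclideanSpace ℝ (Fin d) => F.indicator (fun _ => (1 : ℝ≥0∞)) (s i))
      (ψ := fun x : ℕ → ℝ≥0 => (x i : ℝ≥0∞) ^ p)
      ((measurable_const.indicator hFm).comp (measurable_pi_apply i))
      (by fun_prop)
  rw [lintegral_mul_eq_lintegral_mul_lintegral_of_indepFun'' hind.aemeasurable hXm.aemeasurable
    hindep]
  have hXi : ∫⁻ ω, (X i ω : ℝ≥0∞) ^ p ∂P = ∞ := by
    rw [← hmom, weightMoment, ← hXγ i, lintegral_map (by fun_prop) (hX i)]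
  have hzi : ∫⁻ ω, F.indicator (fun _ => (1 : ℝ≥0∞)) (z i ω) ∂P ≠ 0 := by
    have : (fun ω => F.indicator (fun _ => (1 : ℝ≥0∞)) (z i ω)) =
        ((z i) ⁻¹' F).indicator 1 := by ext ω; rfl
    rw [this, lintegral_indicator_one (hz.measurable i hFm)]
    exact hi
  rw [hXi, ENNReal.mul_top hzi, ENNReal.mul_top (by simpa using hc.ne')]

end InfiniteCost

/-! ### Sums of independent weights -/

section IndependentSums

variable {Ω : Type*} [MeasurableSpace Ω] {P : Measure Ω}

/-- Fubini for an independent pair living on one space: `ω'` is an independent copy. This is how the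
points are frozen while the weights are integrated out. -/
theorem ProbabilityTheory.IndepFun.lintegral_comp_prodMk {S T : Type*} [MeasurableSpace S]
    [MeasurableSpace T] [IsProbabilityMeasure P] {f : Ω → S} {g : Ω → T} (hfg : IndepFun f g P)
    (hf : Measurable f) (hg : Measurable g) {H : S × T → ℝ≥0∞} (hH : Measurable H) :
    ∫⁻ ω, H (f ω, g ω) ∂P = ∫⁻ ω, ∫⁻ ω', H (f ω, g ω') ∂P ∂P := by
  have h1 : ∫⁻ ω, H (f ω, g ω) ∂P = ∫⁻ y, H y ∂(P.map fun ω => (f ω, g ω)) :=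
    (lintegral_map hH (hf.prodMk hg)).symm
  have := Measure.isProbabilityMeasure_map hg.aemeasurable (μ := P)
  rw [h1, hfg.map_prod_eq_prod_map_map hf.aemeasurable hg.aemeasurable,
    lintegral_prod _ hH.aemeasurable, lintegral_map hH.lintegral_prod_right' hf]
  refine lintegral_congr fun ω => ?_
  exact lintegral_map (hH.comp measurable_prodMk_left) hg

/-- The law of the sum of `n` independent variables with law `γ`. -/
noncomputable def convPow (γ : Measure ℝ≥0) : ℕ → Measure ℝ≥0
  | 0 => Measure.dirac 0
  | n + 1 => convPow γ n ∗ γ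

instance convPow.instIsProbabilityMeasure (γ : Measure ℝ≥0) [IsProbabilityMeasure γ] (n : ℕ) :
    IsProbabilityMeasure (convPow γ n) := by
  induction n with
  | zero => exact Measure.dirac.isProbabilityMeasure
  | succ n ih => exact Measure.probabilitymeasure_of_probabilitymeasures_conv _ _

variable {γ : Measure ℝ≥0} {X : ℕ → Ω → ℝ≥0}

theorem map_finsetSum_eq_convPow (hX : ∀ i, Measurable (X i)) (hγ : ∀ i, P.map (X i) = γ)
    (hind : iIndepFun X P) (I : Finset ℕ) :
    P.map (fun ω => ∑ i ∈ I, X i ω) = convPow γ I.card := by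
  have := hind.isProbabilityMeasure
  induction I using Finset.induction_on with
  | empty => simp [convPow, Measure.map_const]
  | insert a I ha ih =>
    have h1 := hind.indepFun_finsetSum_of_notMem hX ha
    have h2 : (fun ω => ∑ i ∈ insert a I, X i ω) = (∑ i ∈ I, X i) + X a := by
      ext ω
      simp [Finset.sum_insert ha, add_comm]
    have hm : Measurable (∑ j ∈ I, X j) := by
      convert I.measurable_sum (fun i _ => hX i) using 1
      ext ω
      simp
    rw [h2, h1.map_add_eq_map_conv_map hm (hX a), hγ,
      Finset.card_insert_of_notMem ha, convPow, ← ih]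
    congr 2
    ext ω
    simp

theorem lintegral_comp_finsetSum (hX : ∀ i, Measurable (X i)) (hγ : ∀ i, P.map (X i) = γ)
    (hind : iIndepFun X P) (I : Finset ℕ) {g : ℝ≥0 → ℝ≥0∞} (hg : Measurable g) :
    ∫⁻ ω, g (∑ i ∈ I, X i ω) ∂P = ∫⁻ s, g s ∂(convPow γ I.card) := by
  rw [← map_finsetSum_eq_convPow hX hγ hind I, lintegral_map hg (by fun_prop)]

theorem lintegral_prod_comp_finsetSum (hX : ∀ i, Measurable (X i)) (hγ : ∀ i, P.map (X i) = γ)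
    (hind : iIndepFun X P) {ι : Type*} (S : Finset ι) (I : ι → Finset ℕ)
    (hI : (S : Set ι).PairwiseDisjoint I) (g : ι → ℝ≥0 → ℝ≥0∞) (hg : ∀ j, Measurable (g j)) :
    ∫⁻ ω, ∏ j ∈ S, g j (∑ i ∈ I j, X i ω) ∂P =
      ∏ j ∈ S, ∫⁻ s, g j s ∂(convPow γ (I j).card) := by
  classical
  have := hind.isProbabilityMeasure
  induction S using Finset.induction_on with
  | empty => simp
  | insert a S ha ih =>
    simp only [Finset.prod_insert ha]
    rw [← ih (hI.subset (by simp)), ← lintegral_comp_finsetSum hX hγ hind (I a) (hg a)]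
    have hdisj : Disjoint (I a) (S.biUnion I) := by
      rw [Finset.disjoint_biUnion_right]
      intro j hj
      exact hI (by simp) (by simp [hj]) (fun h => ha (h ▸ hj))
    have h1 := hind.indepFun_finset (I a) (S.biUnion I) hdisj hX
    have h2 : IndepFun (fun ω => g a (∑ i ∈ I a, X i ω))
        (fun ω => ∏ j ∈ S, g j (∑ i ∈ I j, X i ω)) P := by
      have h3 := h1.comp (φ := fun x : ↥(I a) → ℝ≥0 => g a (∑ i, x i))
        (ψ := fun x : ↥(S.biUnion I) → ℝ≥0 =>
          ∏ j ∈ S.attach, g j (∑ i ∈ (I j).attach, x ⟨i, Finset.mem_biUnion.2 ⟨j, j.2, i.2⟩⟩))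
        (by fun_prop) (by fun_prop)
      convert h3 using 1
      · ext ω
        simp only [Function.comp_apply]
        rw [← Finset.sum_coe_sort (I a) (fun i => X i ω)]
      · ext ω
        simp only [Function.comp_apply]
        rw [← Finset.prod_attach S (fun j => g j (∑ i ∈ I j, X i ω))]
        refine Finset.prod_congr rfl fun j _ => ?_
        rw [← Finset.sum_attach (I j) (fun i => X i ω)]
    exact lintegral_mul_eq_lintegral_mul_lintegral_of_indepFun'' (by fun_prop) (by fun_prop) h2

/-- The distinguished summand is split off from the other `I.card - 1` ones, of which it is
independent. -/
theorem lintegral_mul_comp_finsetSum (hX : ∀ i, Measurable (X i)) (hγ : ∀ i, P.map (X i) = γ)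
    (hind : iIndepFun X P) [SFinite γ] (I : Finset ℕ) {i : ℕ} (hi : i ∈ I) {h : ℝ≥0 → ℝ≥0∞}
    (hh : Measurable h) :
    ∫⁻ ω, X i ω * h (∑ j ∈ I, X j ω) ∂P =
      ∫⁻ s, ∫⁻ x, x * h (s + x) ∂γ ∂(convPow γ (I.card - 1)) := by
  classical
  have := hind.isProbabilityMeasure
  have h1 : IndepFun (fun ω => ∑ j ∈ I.erase i, X j ω) (X i) P := by
    convert hind.indepFun_finsetSum_of_notMem hX (Finset.notMem_erase i I) using 1
    ext ω
    simp
  have h2 := h1.lintegral_comp_prodMk (by fun_prop) (hX i)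
    (H := fun p => (p.2 : ℝ≥0∞) * h (p.1 + p.2)) (by fun_prop)
  have h3 : ∀ ω, ∑ j ∈ I, X j ω = ∑ j ∈ I.erase i, X j ω + X i ω := fun ω =>
    (Finset.sum_erase_add I (fun j => X j ω) hi).symm
  simp only at h2
  simp only [h3, h2]
  rw [← Finset.card_erase_of_mem hi, ← map_finsetSum_eq_convPow hX hγ hind,
    lintegral_map (Measurable.lintegral_prod_right' (f := fun p : ℝ≥0 × ℝ≥0 =>
      (p.2 : ℝ≥0∞) * h (p.1 + p.2)) (by fun_prop)) (by fun_prop)]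
  refine lintegral_congr fun ω => ?_
  rw [← hγ i, lintegral_map (by fun_prop) (hX i)]

end IndependentSums

/-! ### Masses and counts of a fixed weighted point configuration -/

section WeightedPoints

variable {M : Type*}

/-- The mass that the weights `x i` at the points `s i` give to `A`. -/
noncomputable def weightedMass (A : Set M) (s : ℕ → M) (x : ℕ → ℝ≥0) : ℝ≥0∞ :=
  ∑' i, A.indicator (fun _ => (x i : ℝ≥0∞)) (s i)

theorem weightedMass_eq_sum {A : Set M} {s : ℕ → M} (hfin : {i | s i ∈ A}.Finite) (x : ℕ → ℝ≥0) :
    weightedMass A s x = ((∑ i ∈ hfin.toFinset, x i : ℝ≥0) : ℝ≥0∞) := by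
  rw [weightedMass, tsum_eq_sum (s := hfin.toFinset), ENNReal.ofNNReal_finsetSum]
  · refine Finset.sum_congr rfl fun i hi => ?_
    rw [Set.indicator_of_mem]
    simpa using hi
  · intro i hi
    rw [Set.indicator_of_notMem]
    simpa using hi

variable [MeasurableSpace M]

theorem sum_smul_dirac_apply {A : Set M} (hA : MeasurableSet A) (s : ℕ → M) (x : ℕ → ℝ≥0) :
    (Measure.sum fun i => x i • Measure.dirac (s i)) A = weightedMass A s x := by
  classical
  rw [Measure.sum_apply _ hA, weightedMass]
  refine tsum_congr fun i => ?_
  rw [Measure.coe_nnreal_smul_apply, Measure.dirac_apply' _ hA]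
  by_cases h : s i ∈ A <;> simp [h]

theorem measurable_weightedMass {A : Set M} (hA : MeasurableSet A) :
    Measurable fun p : (ℕ → M) × (ℕ → ℝ≥0) => weightedMass A p.1 p.2 := by
  classical
  refine Measurable.tsum fun i => ?_
  have : (fun p : (ℕ → M) × (ℕ → ℝ≥0) => A.indicator (fun _ => (p.2 i : ℝ≥0∞)) (p.1 i)) =
      fun p => A.indicator (fun _ => (1 : ℝ≥0∞)) (p.1 i) * (p.2 i : ℝ≥0∞) := by
    ext p
    by_cases h : p.1 i ∈ A <;> simp [h]
  rw [this]
  exact ((measurable_const.indicator hA).comp ((measurable_pi_apply i).comp measurable_fst)).mul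
    (by fun_prop)

/-- The number of indices `i` with `s i ∈ A` (zero if there are infinitely many). -/
noncomputable def pointCount (A : Set M) (s : ℕ → M) : ℕ := {i | s i ∈ A}.ncard

theorem sum_dirac_apply_eq_encard {A : Set M} (hA : MeasurableSet A) (s : ℕ → M) :
    (Measure.sum fun i => Measure.dirac (s i)) A = ({i | s i ∈ A}.encard : ℝ≥0∞) := by
  rw [Measure.sum_apply _ hA, ← ENNReal.tsum_set_one, tsum_subtype {i | s i ∈ A} (fun _ => 1)]
  refine tsum_congr fun i => ?_
  rw [Measure.dirac_apply' _ hA]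
  rfl

/-- Makes the count a measurable function of the value of the counting measure, so that its law and
independence can be transferred. For infinitely many points the default values of `ncard` and
`toReal` are both 0. -/
theorem pointCount_eq_floor {A : Set M} (hA : MeasurableSet A) (s : ℕ → M) :
    pointCount A s = ⌊((Measure.sum fun i => Measure.dirac (s i)) A).toReal⌋₊ := by
  rw [sum_dirac_apply_eq_encard hA, pointCount]
  rcases Set.finite_or_infinite {i | s i ∈ A} with h | h
  · rw [← h.cast_ncard_eq]
    simp
  · simp [h.ncard, h.encard_eq]

end WeightedPoints

/-! ### Laws of the Poisson counts -/

section PoissonCounts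

variable {Ω M : Type*} [MeasurableSpace Ω] [MeasureSpace M] {P : Measure Ω} {α : ℝ≥0}
  {z : ℕ → Ω → M}

theorem measurable_pointCount {A : Set M} (hA : MeasurableSet A) :
    Measurable (pointCount A : (ℕ → M) → ℕ) := by
  have : (pointCount A : (ℕ → M) → ℕ) = fun s => ⌊(weightedMass A s 1).toReal⌋₊ := by
    ext s
    rw [pointCount_eq_floor hA, weightedMass, Measure.sum_apply _ hA]
    congr 3
    ext i
    rw [Measure.dirac_apply' _ hA]
    by_cases h : s i ∈ A <;> simp [h]
  rw [this]
  exact Nat.measurable_floor.comp (ENNReal.measurable_toReal.comp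
    ((measurable_weightedMass hA).comp (measurable_id.prodMk measurable_const)))

theorem IsPoissonEnumeration.measurable_pi (hz : IsPoissonEnumeration P α z) :
    Measurable fun ω i => z i ω := measurable_pi_lambda _ hz.measurable

theorem IsPoissonEnumeration.measurable_count (hz : IsPoissonEnumeration P α z) {A : Set M}
    (hA : MeasurableSet A) :
    Measurable fun ω => (Measure.sum fun i => Measure.dirac (z i ω)) A := by
  simp only [Measure.sum_apply _ hA]
  exact Measurable.tsum fun i => (Measure.measurable_coe hA).comp
    (Measure.measurable_dirac.comp (hz.measurable i))

theorem IsPoissonEnumeration.ae_finite (hz : IsPoissonEnumeration P α z) {A : Set M}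
    (hA : MeasurableSet A) (hvol : volume A < ∞) : ∀ᵐ ω ∂P, {i | z i ω ∈ A}.Finite := by
  have h1 : ∀ᵐ t ∂(P.map (fun ω => (Measure.sum fun i => Measure.dirac (z i ω)) A)), t ≠ ∞ := by
    rw [hz.law A hA hvol]
    exact (ae_map_iff measurable_from_nat.aemeasurable (p := (· ≠ ∞))
      (measurableSet_singleton _).compl).2 (ae_of_all _ fun n => ENNReal.natCast_ne_top n)
  filter_upwards [ae_of_ae_map (hz.measurable_count hA).aemeasurable h1] with ω hω
  rw [sum_dirac_apply_eq_encard hA] at hω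
  by_contra h
  rw [Set.not_finite] at h
  simp [h.encard_eq] at hω

theorem IsPoissonEnumeration.map_pointCount (hz : IsPoissonEnumeration P α z) {A : Set M}
    (hA : MeasurableSet A) (hvol : volume A < ∞) :
    P.map (fun ω => pointCount A fun i => z i ω) =
      poissonMeasure (α * (volume A).toNNReal) := by
  simp only [pointCount_eq_floor hA]
  have hfl : Measurable fun t : ℝ≥0∞ => ⌊t.toReal⌋₊ :=
    Nat.measurable_floor.comp ENNReal.measurable_toReal
  rw [← Function.comp_def (fun t : ℝ≥0∞ => ⌊t.toReal⌋₊),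
    ← Measure.map_map hfl (hz.measurable_count hA), hz.law A hA hvol,
    Measure.map_map hfl (by fun_prop)]
  convert Measure.map_id
  ext n
  simp

theorem IsPoissonEnumeration.iIndepFun_pointCount (hz : IsPoissonEnumeration P α z) {k : ℕ}
    {A : Fin k → Set M} (hA : ∀ j, MeasurableSet (A j))
    (hdisj : Pairwise fun i j => Disjoint (A i) (A j)) :
    iIndepFun (fun j ω => pointCount (A j) fun i => z i ω) P := by
  simp only [pointCount_eq_floor (hA _)]
  exact (hz.indep k A hA hdisj).comp (fun _ t => ⌊t.toReal⌋₊)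
    fun _ => Nat.measurable_floor.comp ENNReal.measurable_toReal

/-- Size-biasing of the Poisson law: n r^n / n! = r · r^(n-1) / (n-1)!. The truncated `n - 1` at `n
= 0` is killed by the factor `n`. -/
theorem lintegral_poissonMeasure_mul (r : ℝ≥0) (h : ℕ → ℝ≥0∞) :
    ∫⁻ n, (n : ℝ≥0∞) * h (n - 1) ∂(poissonMeasure r) = r * ∫⁻ n, h n ∂(poissonMeasure r) := by
  have hsum : ∀ g : ℕ → ℝ≥0∞, ∫⁻ n, g n ∂(poissonMeasure r) =
      ∑' n, ENNReal.ofReal (Real.exp (-r) * r ^ n / n.factorial) * g n := by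
    intro g
    rw [poissonMeasure, lintegral_sum_measure]
    refine tsum_congr fun n => ?_
    rw [lintegral_smul_measure, lintegral_dirac, smul_eq_mul]
  rw [hsum, hsum, tsum_eq_zero_add' ENNReal.summable, ← ENNReal.tsum_mul_left]
  simp only [Nat.cast_zero, zero_mul, mul_zero, zero_add, Nat.add_sub_cancel]
  refine tsum_congr fun n => ?_
  rw [← mul_assoc, ← mul_assoc]
  congr 1
  rw [← ENNReal.ofReal_natCast, ← ENNReal.ofReal_coe_nnreal (p := r),
    ← ENNReal.ofReal_mul (by positivity), ← ENNReal.ofReal_mul (by positivity)]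
  congr 1
  rw [Nat.factorial_succ]
  push_cast
  field_simp
  ring

end PoissonCounts

/-! ### Independence and the Mecke formula for the compound Poisson process -/

section CompoundPoisson

variable {Ω M : Type*} [MeasurableSpace Ω] [MeasureSpace M] {P : Measure Ω}
  [IsProbabilityMeasure P] {α : ℝ≥0} {γ : Measure ℝ≥0} {mu : Kernel Ω M}

/-- Given the points, the masses are sums of weights over disjoint index sets, hence independent
with laws depending only on the counts; the counts are independent Poisson variables. The formula
yields both independence over disjoint sets and the fact that the law of a mass depends only on the
volume. -/
theorem IsCompoundPoisson.lintegral_prod_comp (hmu : IsCompoundPoisson P α γ mu) {k : ℕ}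
    {A : Fin k → Set M} (hA : ∀ j, MeasurableSet (A j)) (hvol : ∀ j, volume (A j) < ∞)
    (hdisj : Pairwise fun i j => Disjoint (A i) (A j)) (S : Finset (Fin k))
    {g : Fin k → ℝ≥0∞ → ℝ≥0∞} (hg : ∀ j, Measurable (g j)) :
    ∫⁻ ω, ∏ j ∈ S, g j (mu ω (A j)) ∂P =
      ∏ j ∈ S, ∫⁻ n, ∫⁻ s, g j (s : ℝ≥0) ∂(convPow γ n)
        ∂(poissonMeasure (α * (volume (A j)).toNNReal)) := by
  obtain ⟨z, X, hz, hX, hXγ, hXind, hzX, hrep⟩ := hmu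
  have h1 : ∫⁻ ω, ∏ j ∈ S, g j (mu ω (A j)) ∂P =
      ∫⁻ ω, ∏ j ∈ S, g j (weightedMass (A j) (fun i => z i ω) fun i => X i ω) ∂P := by
    refine lintegral_congr_ae ?_
    filter_upwards [hrep] with ω hω
    simp only [hω, sum_smul_dirac_apply (hA _)]
  have h2 := hzX.lintegral_comp_prodMk hz.measurable_pi (measurable_pi_lambda _ hX)
    (H := fun p => ∏ j ∈ S, g j (weightedMass (A j) p.1 p.2))
    (Finset.measurable_prod _ fun j _ => (hg j).comp (measurable_weightedMass (hA j)))
  have h3 : ∀ᵐ ω ∂P, ∀ j, {i | z i ω ∈ A j}.Finite :=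
    ae_all_iff.2 fun j => hz.ae_finite (hA j) (hvol j)
  simp only at h2
  rw [h1, h2]
  have h4 : ∫⁻ ω, ∫⁻ ω', ∏ j ∈ S, g j (weightedMass (A j) (fun i => z i ω) fun i => X i ω') ∂P ∂P =
      ∫⁻ ω, ∏ j ∈ S, ∫⁻ s, g j (s : ℝ≥0) ∂(convPow γ (pointCount (A j) fun i => z i ω)) ∂P := by
    refine lintegral_congr_ae ?_
    filter_upwards [h3] with ω hω
    simp only [weightedMass_eq_sum (hω _)]
    rw [lintegral_prod_comp_finsetSum hX hXγ hXind S (fun j => (hω j).toFinset) ?_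
      (fun j s => g j s) (fun j => (hg j).comp (by fun_prop))]
    · refine Finset.prod_congr rfl fun j _ => ?_
      rw [pointCount, Set.ncard_eq_toFinset_card _ (hω j)]
    · intro i _ j _ hij
      refine Finset.disjoint_left.2 fun l hl hl' => ?_
      simp only [Set.Finite.mem_toFinset] at hl hl'
      exact Set.disjoint_left.1 (hdisj hij) hl hl'
  rw [h4]
  have h5 := (hz.iIndepFun_pointCount hA hdisj).comp
    (fun j n => ∫⁻ s, g j (s : ℝ≥0) ∂(convPow γ n)) fun j => measurable_from_nat
  have hcount : ∀ j, Measurable fun ω => pointCount (A j) fun i => z i ω := fun j =>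
    (measurable_pointCount (hA j)).comp hz.measurable_pi
  have h6 := lintegral_prod_eq_prod_lintegral_of_indepFun S _ h5
    fun j => measurable_from_nat.comp (hcount j)
  simp only [Function.comp_apply] at h6
  rw [h6]
  refine Finset.prod_congr rfl fun j _ => ?_
  rw [← hz.map_pointCount (hA j) (hvol j), lintegral_map measurable_from_nat (hcount j)]

theorem IsCompoundPoisson.lintegral_comp (hmu : IsCompoundPoisson P α γ mu) {A : Set M}
    (hA : MeasurableSet A) (hvol : volume A < ∞) {g : ℝ≥0∞ → ℝ≥0∞} (hg : Measurable g) :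
    ∫⁻ ω, g (mu ω A) ∂P = ∫⁻ n, ∫⁻ s, g (s : ℝ≥0) ∂(convPow γ n)
        ∂(poissonMeasure (α * (volume A).toNNReal)) := by
  simpa using hmu.lintegral_prod_comp (k := 1) (A := fun _ => A) (fun _ => hA) (fun _ => hvol)
    (fun i j hij => absurd (Subsingleton.elim i j) hij) Finset.univ (g := fun _ => g) fun _ => hg

theorem IsCompoundPoisson.lintegral_comp_eq (hmu : IsCompoundPoisson P α γ mu) {A A' : Set M}
    (hA : MeasurableSet A) (hA' : MeasurableSet A') (hvol : volume A < ∞)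
    (hvol' : volume A' = volume A) {g : ℝ≥0∞ → ℝ≥0∞} (hg : Measurable g) :
    ∫⁻ ω, g (mu ω A') ∂P = ∫⁻ ω, g (mu ω A) ∂P := by
  rw [hmu.lintegral_comp hA hvol hg, hmu.lintegral_comp hA' (hvol' ▸ hvol) hg, hvol']

theorem IsCompoundPoisson.map_eq (hmu : IsCompoundPoisson P α γ mu) {A A' : Set M}
    (hA : MeasurableSet A) (hA' : MeasurableSet A') (hvol : volume A < ∞)
    (hvol' : volume A' = volume A) : P.map (fun ω => mu ω A') = P.map (fun ω => mu ω A) := by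
  refine Measure.ext_of_lintegral _ fun g hg => ?_
  rw [lintegral_map hg (mu.measurable_coe hA), lintegral_map hg (mu.measurable_coe hA')]
  exact hmu.lintegral_comp_eq hA hA' hvol hvol' hg

theorem IsCompoundPoisson.iIndepFun_fin (hmu : IsCompoundPoisson P α γ mu) {k : ℕ}
    {A : Fin k → Set M} (hA : ∀ j, MeasurableSet (A j)) (hvol : ∀ j, volume (A j) < ∞)
    (hdisj : Pairwise fun i j => Disjoint (A i) (A j)) :
    iIndepFun (fun j ω => mu ω (A j)) P := by
  rw [iIndepFun_iff_measure_inter_preimage_eq_mul]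
  intro S sets hsets
  classical
  -- The given sets are measurable only for `j ∈ S`, while the product formula wants a measurable
  -- function for every index.
  set B : Fin k → Set ℝ≥0∞ := fun j => if j ∈ S then sets j else ∅ with hB
  have hBm : ∀ j, MeasurableSet (B j) := fun j => by
    by_cases h : j ∈ S
    · simpa [hB, h] using hsets j h
    · simp [hB, h]
  have hBS : ∀ j ∈ S, sets j = B j := fun j hj => by simp [hB, hj]
  have h0 : ∀ j, Measurable ((B j).indicator (fun _ => (1 : ℝ≥0∞))) := fun j =>
    measurable_const.indicator (hBm j)
  have h1 := hmu.lintegral_prod_comp hA hvol hdisj S h0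
  have h2 : ∀ j, P ((fun ω => mu ω (A j)) ⁻¹' B j) =
      ∫⁻ n, ∫⁻ s, (B j).indicator (fun _ => (1 : ℝ≥0∞)) (s : ℝ≥0) ∂(convPow γ n)
        ∂(poissonMeasure (α * (volume (A j)).toNNReal)) := by
    intro j
    rw [← hmu.lintegral_comp (hA j) (hvol j) (h0 j),
      ← lintegral_indicator_one (mu.measurable_coe (hA j) (hBm j))]
    rfl
  have h3 : (⋂ j ∈ S, (fun ω => mu ω (A j)) ⁻¹' sets j) =
      ⋂ j ∈ S, (fun ω => mu ω (A j)) ⁻¹' B j :=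
    Set.iInter₂_congr fun j hj => by rw [hBS j hj]
  rw [h3, Finset.prod_congr rfl fun j hj => by rw [hBS j hj, h2 j], ← h1,
    ← lintegral_indicator_one (S.measurableSet_biInter fun j _ =>
      mu.measurable_coe (hA j) (hBm j))]
  refine lintegral_congr fun ω => ?_
  by_cases h : ∀ j ∈ S, mu ω (A j) ∈ B j
  · rw [Set.indicator_of_mem (by simpa using h), Finset.prod_eq_one fun j hj => ?_]
    · rfl
    · rw [Set.indicator_of_mem (h j hj)]
  · rw [Set.indicator_of_notMem (by simpa using h)]
    push Not at h
    obtain ⟨j, hj, hjB⟩ := h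
    rw [Finset.prod_eq_zero hj (Set.indicator_of_notMem hjB _)]

theorem IsCompoundPoisson.iIndepFun (hmu : IsCompoundPoisson P α γ mu) {ι : Type*}
    {A : ι → Set M} (hA : ∀ j, MeasurableSet (A j)) (hvol : ∀ j, volume (A j) < ∞)
    (hdisj : Pairwise fun i j => Disjoint (A i) (A j)) :
    ProbabilityTheory.iIndepFun (fun j ω => mu ω (A j)) P := by
  rw [iIndepFun_iff_finset]
  intro s
  rw [← iIndepFun_precomp_of_bijective s.equivFin.symm.bijective]
  exact hmu.iIndepFun_fin (A := fun l => A (s.equivFin.symm l)) (fun l => hA _) (fun l => hvol _)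
    fun i j hij => hdisj fun h => hij (s.equivFin.symm.injective (Subtype.ext h))

/-- Mecke formula: a point of `C` contributes its weight `x`, and the number of other points in `U`
is again Poisson with the full parameter. So `C` enters only through its volume. It follows by
splitting `U` into `C` and `U \ C`, whose counts are independent, and size-biasing the count of `C`.
-/
theorem IsCompoundPoisson.lintegral_mass_mul_comp [IsProbabilityMeasure γ]
    (hmu : IsCompoundPoisson P α γ mu)
    {C U : Set M} (hC : MeasurableSet C) (hU : MeasurableSet U) (hCU : C ⊆ U)
    (hvol : volume U < ∞) {h : ℝ≥0∞ → ℝ≥0∞} (hh : Measurable h) :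
    ∫⁻ ω, mu ω C * h (mu ω U) ∂P = α * volume C *
      ∫⁻ n, ∫⁻ s, ∫⁻ x, x * h ((s + x : ℝ≥0)) ∂γ ∂(convPow γ n)
        ∂(poissonMeasure (α * (volume U).toNNReal)) := by
  obtain ⟨z, X, hz, hX, hXγ, hXind, hzX, hrep⟩ := hmu
  set ψ : ℕ → ℝ≥0∞ := fun n => ∫⁻ s, ∫⁻ x, x * h ((s + x : ℝ≥0)) ∂γ ∂(convPow γ n) with hψ
  have hD : MeasurableSet (U \ C) := hU.diff hC
  have hCvol : volume C < ∞ := (measure_mono hCU).trans_lt hvol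
  have hDvol : volume (U \ C) < ∞ := (measure_mono Set.sdiff_subset).trans_lt hvol
  have h1 : ∫⁻ ω, mu ω C * h (mu ω U) ∂P =
      ∫⁻ ω, weightedMass C (fun i => z i ω) (fun i => X i ω) *
        h (weightedMass U (fun i => z i ω) fun i => X i ω) ∂P := by
    refine lintegral_congr_ae ?_
    filter_upwards [hrep] with ω hω
    simp only [hω, sum_smul_dirac_apply hC, sum_smul_dirac_apply hU]
  have h2 := hzX.lintegral_comp_prodMk hz.measurable_pi (measurable_pi_lambda _ hX)
    (H := fun p => weightedMass C p.1 p.2 * h (weightedMass U p.1 p.2))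
    ((measurable_weightedMass hC).mul (hh.comp (measurable_weightedMass hU)))
  simp only at h2
  rw [h1, h2]
  have hcount : ∀ {A}, MeasurableSet A → Measurable fun ω => pointCount A fun i => z i ω :=
    fun hA => (measurable_pointCount hA).comp hz.measurable_pi
  have h3 : ∀ᵐ ω ∂P, (pointCount U fun i => z i ω) =
      (pointCount C fun i => z i ω) + pointCount (U \ C) fun i => z i ω := by
    filter_upwards [hz.ae_finite hC hCvol, hz.ae_finite hD hDvol] with ω h1 h2
    rw [pointCount, pointCount, pointCount, ← Set.ncard_union_eq _ h1 h2]
    · congr 1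
      ext i
      by_cases hi : z i ω ∈ C <;> simp [hi]
      exact hCU hi
    · exact Set.disjoint_left.2 fun i hi hi' => hi'.2 hi
  have h4 : ∫⁻ ω, ∫⁻ ω', weightedMass C (fun i => z i ω) (fun i => X i ω') *
        h (weightedMass U (fun i => z i ω) fun i => X i ω') ∂P ∂P =
      ∫⁻ ω, (fun p : ℕ × ℕ => (p.1 : ℝ≥0∞) * ψ (p.1 + p.2 - 1)) (pointCount C fun i => z i ω,
        pointCount (U \ C) fun i => z i ω) ∂P := by
    refine lintegral_congr_ae ?_
    filter_upwards [hz.ae_finite hC hCvol, hz.ae_finite hU hvol, h3] with ω h5 h6 h7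
    have h7' : ∀ ω', weightedMass C (fun i => z i ω) (fun i => X i ω') *
        h (weightedMass U (fun i => z i ω) fun i => X i ω') =
        ∑ i ∈ h5.toFinset, (X i ω' : ℝ≥0∞) * h ((∑ j ∈ h6.toFinset, X j ω' : ℝ≥0)) := by
      intro ω'
      rw [weightedMass_eq_sum h5, weightedMass_eq_sum h6, ENNReal.ofNNReal_finsetSum,
        Finset.sum_mul]
    simp only [h7']
    rw [lintegral_finsetSum _ fun i _ => by fun_prop]
    have h8 : ∀ i ∈ h5.toFinset, ∫⁻ ω', X i ω' * h ((∑ j ∈ h6.toFinset, X j ω' : ℝ≥0)) ∂P =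
        ψ ((pointCount C fun i => z i ω) + (pointCount (U \ C) fun i => z i ω) - 1) := by
      intro i hi
      have hi' : i ∈ h6.toFinset := by
        simp only [Set.Finite.mem_toFinset] at hi ⊢
        exact hCU hi
      have := lintegral_mul_comp_finsetSum hX hXγ hXind h6.toFinset hi'
        (h := fun s => h (s : ℝ≥0∞)) (hh.comp (by fun_prop))
      rw [this, ← h7, pointCount, Set.ncard_eq_toFinset_card _ h6]
    rw [Finset.sum_congr rfl h8, Finset.sum_const, nsmul_eq_mul, pointCount,
      Set.ncard_eq_toFinset_card _ h5]
  have h9 : IndepFun (fun ω => pointCount (U \ C) fun i => z i ω)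
      (fun ω => pointCount C fun i => z i ω) P := by
    have := hz.iIndepFun_pointCount (k := 2) (A := ![U \ C, C]) (by
      intro j; fin_cases j <;> simp [hC, hD]) (by
      intro i j hij
      fin_cases i <;> fin_cases j <;> simp_all [Set.disjoint_sdiff_left, Set.disjoint_sdiff_right])
    exact this.indepFun (i := 0) (j := 1) (by simp)
  rw [h4]
  have h10 := h9.lintegral_comp_prodMk (hcount hD) (hcount hC)
    (H := fun p : ℕ × ℕ => (p.2 : ℝ≥0∞) * ψ (p.2 + p.1 - 1)) (measurable_from_prod_countable_left
      fun _ => measurable_from_nat)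
  have h11 := h9.lintegral_comp_prodMk (hcount hD) (hcount hC)
    (H := fun p : ℕ × ℕ => ψ (p.2 + p.1)) (measurable_from_prod_countable_left
      fun _ => measurable_from_nat)
  simp only at h10 h11 ⊢
  rw [h10]
  have h12 : ∀ ω, ∫⁻ ω', ((pointCount C fun i => z i ω' : ℕ) : ℝ≥0∞) *
      ψ ((pointCount C fun i => z i ω') + (pointCount (U \ C) fun i => z i ω) - 1) ∂P =
      α * volume C * ∫⁻ ω', ψ ((pointCount C fun i => z i ω') +
        (pointCount (U \ C) fun i => z i ω)) ∂P := by
    intro ω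
    set m := pointCount (U \ C) fun i => z i ω
    have h13 := lintegral_poissonMeasure_mul (α * (volume C).toNNReal) fun n => ψ (n + m)
    rw [← hz.map_pointCount hC hCvol, lintegral_map measurable_from_nat (hcount hC),
      lintegral_map measurable_from_nat (hcount hC), ENNReal.coe_mul,
      ENNReal.coe_toNNReal hCvol.ne] at h13
    rw [← h13]
    refine lintegral_congr fun ω' => ?_
    rcases Nat.eq_zero_or_pos (pointCount C fun i => z i ω') with h0 | h0
    · simp [h0]
    · congr 2
      omega
  simp only [h12]
  rw [lintegral_const_mul' _ _ (ENNReal.mul_ne_top ENNReal.coe_ne_top hCvol.ne), ← h11]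
  congr 1
  rw [← hz.map_pointCount hU hvol, lintegral_map measurable_from_nat (hcount hU)]
  refine lintegral_congr_ae ?_
  filter_upwards [h3] with ω hω
  rw [hω]

theorem IsCompoundPoisson.lintegral_mass_mul_comp_eq [IsProbabilityMeasure γ]
    (hmu : IsCompoundPoisson P α γ mu)
    {C U : Set M} (hC : MeasurableSet C) (hU : MeasurableSet U) (hCU : C ⊆ U)
    (hvol : volume U = 1) {h : ℝ≥0∞ → ℝ≥0∞} (hh : Measurable h) :
    ∫⁻ ω, mu ω C * h (mu ω U) ∂P = volume C * ∫⁻ ω, mu ω U * h (mu ω U) ∂P := by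
  rw [hmu.lintegral_mass_mul_comp hC hU hCU (by simp [hvol]) hh,
    hmu.lintegral_mass_mul_comp hU hU subset_rfl (by simp [hvol]) hh, hvol]
  ring

end CompoundPoisson

/-! ### Dyadic boxes of volume `2 ^ n`, doubled along one axis at a time -/

section DyadicBoxes

variable {d : ℕ}

theorem EuclideanSpace.dist_le_sum_abs (x y : EuclideanSpace ℝ (Fin d)) :
    dist x y ≤ ∑ i, |x i - y i| := by
  rw [EuclideanSpace.dist_eq]
  refine Real.sqrt_le_iff.2 ⟨by positivity, ?_⟩
  simp only [Real.dist_eq]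
  exact Finset.sum_sq_le_sq_sum_of_nonneg fun i _ => abs_nonneg _

/-- The unit cell of a point. -/
noncomputable def unitCell (x : EuclideanSpace ℝ (Fin d)) : Fin d → ℤ := fun i => ⌊x i⌋

theorem measurable_unitCell : Measurable (unitCell : EuclideanSpace ℝ (Fin d) → Fin d → ℤ) :=
  measurable_pi_lambda _ fun i => Int.measurable_floor.comp (by fun_prop)

variable [NeZero d]

/-- The coordinate that is doubled when passing from level `n` to level `n + 1`. -/
def splitAxis (d : ℕ) [NeZero d] (n : ℕ) : Fin d := Fin.ofNat d n

/-- A box of level `n` has side length `2 ^ boxDepth n i` in direction `i`. -/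
def boxDepth (n : ℕ) (i : Fin d) : ℕ := Nat.count (fun m => splitAxis d m = i) n

theorem boxDepth_zero (i : Fin d) : boxDepth 0 i = 0 := Nat.count_zero _

theorem boxDepth_succ (n : ℕ) (i : Fin d) :
    boxDepth (n + 1) i = boxDepth n i + if splitAxis d n = i then 1 else 0 := Nat.count_succ _ _

theorem boxDepth_succ_splitAxis (n : ℕ) :
    boxDepth (n + 1) (splitAxis d n) = boxDepth n (splitAxis d n) + 1 := by
  simp [boxDepth_succ]

theorem boxDepth_succ_of_ne {n : ℕ} {i : Fin d} (hi : i ≠ splitAxis d n) :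
    boxDepth (n + 1) i = boxDepth n i := by
  simp [boxDepth_succ, hi.symm]

theorem sum_boxDepth (n : ℕ) : ∑ i : Fin d, boxDepth n i = n := by
  induction n with
  | zero => simp [boxDepth_zero]
  | succ n ih => simp [boxDepth_succ, Finset.sum_add_distrib, ih]

/-- The axes are doubled cyclically, which keeps every side of order 2^(n/d). -/
theorem boxDepth_le (n : ℕ) (i : Fin d) : boxDepth n i ≤ n / d + 1 := by
  have h1 : (fun m => splitAxis d m = i) = fun m => m ≡ i [MOD d] := by
    ext m
    rw [splitAxis, Fin.ext_iff, Fin.val_ofNat, Nat.ModEq, Nat.mod_eq_of_lt i.2]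
  have h2 : boxDepth n i = Nat.count (fun m => m ≡ i [MOD d]) n := by
    simp only [boxDepth]
    congr 1
  rw [h2, Nat.count_modEq_card _ (Nat.pos_of_neZero d)]
  split_ifs <;> omega

theorem two_pow_boxDepth_le (n : ℕ) (i : Fin d) :
    (2 : ℝ) ^ boxDepth n i ≤ 2 * 2 ^ ((n : ℝ) / d) := by
  calc (2 : ℝ) ^ boxDepth n i ≤ 2 ^ (n / d + 1) :=
        pow_le_pow_right₀ (by norm_num) (boxDepth_le n i)
    _ = 2 * (2 : ℝ) ^ ((n / d : ℕ) : ℝ) := by rw [Real.rpow_natCast, pow_succ]; ring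
    _ ≤ 2 * 2 ^ ((n : ℝ) / d) := by
        gcongr
        · norm_num
        · exact Nat.cast_div_le

/-- The index of the box of level `n` that contains the unit cell `k`. -/
def boxIndex (n : ℕ) (k : Fin d → ℤ) (i : Fin d) : ℤ := k i / 2 ^ boxDepth n i

/-- The box of level `n` that contains the unit cell `k`. -/
def dyadicBox (n : ℕ) (k : Fin d → ℤ) : Set (EuclideanSpace ℝ (Fin d)) :=
  {x | boxIndex n (unitCell x) = boxIndex n k}

theorem mem_dyadicBox_unitCell (n : ℕ) (x : EuclideanSpace ℝ (Fin d)) :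
    x ∈ dyadicBox n (unitCell x) := rfl

theorem boxIndex_succ_splitAxis (n : ℕ) (k : Fin d → ℤ) :
    boxIndex (n + 1) k (splitAxis d n) = boxIndex n k (splitAxis d n) / 2 := by
  rw [boxIndex, boxDepth_succ_splitAxis, pow_succ, boxIndex, Int.ediv_ediv_of_nonneg (by positivity)]

theorem boxIndex_succ_of_ne {n : ℕ} {i : Fin d} (hi : i ≠ splitAxis d n) (k : Fin d → ℤ) :
    boxIndex (n + 1) k i = boxIndex n k i := by
  rw [boxIndex, boxDepth_succ_of_ne hi, boxIndex]

theorem boxIndex_zero (k : Fin d → ℤ) : boxIndex 0 k = k := by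
  ext i
  simp [boxIndex, boxDepth_zero]

/-- A unit cell in the other half of the box of level `n + 1` that contains `k`. -/
def siblingCell (n : ℕ) (k : Fin d → ℤ) : Fin d → ℤ :=
  Function.update k (splitAxis d n) (if boxIndex n k (splitAxis d n) % 2 = 0 then
    k (splitAxis d n) + 2 ^ boxDepth n (splitAxis d n) else
    k (splitAxis d n) - 2 ^ boxDepth n (splitAxis d n))

theorem boxIndex_siblingCell_of_ne {n : ℕ} {i : Fin d} (hi : i ≠ splitAxis d n) (k : Fin d → ℤ) :
    boxIndex n (siblingCell n k) i = boxIndex n k i := by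
  simp [boxIndex, siblingCell, hi]

theorem boxIndex_siblingCell (n : ℕ) (k : Fin d → ℤ) :
    boxIndex n (siblingCell n k) (splitAxis d n) = if boxIndex n k (splitAxis d n) % 2 = 0 then
      boxIndex n k (splitAxis d n) + 1 else boxIndex n k (splitAxis d n) - 1 := by
  have h : (2 : ℤ) ^ boxDepth n (splitAxis d n) ≠ 0 := by positivity
  rw [boxIndex, siblingCell, Function.update_self]
  split_ifs
  · rw [Int.add_ediv_of_dvd_right (dvd_refl _), Int.ediv_self h, boxIndex]
  · rw [Int.sub_ediv_of_dvd _ (dvd_refl _), Int.ediv_self h, boxIndex]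

/-- Along the split axis, the indices with a given half are an even number and its successor; the
sibling realises the other one. -/
theorem boxIndex_succ_eq_iff {n : ℕ} {k k' : Fin d → ℤ} :
    boxIndex (n + 1) k' = boxIndex (n + 1) k ↔
      boxIndex n k' = boxIndex n k ∨ boxIndex n k' = boxIndex n (siblingCell n k) := by
  simp only [funext_iff]
  constructor
  · intro h
    have h1 := h (splitAxis d n)
    rw [boxIndex_succ_splitAxis, boxIndex_succ_splitAxis] at h1
    have h2 : ∀ i, i ≠ splitAxis d n → boxIndex n k' i = boxIndex n k i := fun i hi => by
      rw [← boxIndex_succ_of_ne hi, ← boxIndex_succ_of_ne hi, h]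
    by_cases h3 : boxIndex n k' (splitAxis d n) = boxIndex n k (splitAxis d n)
    · left
      intro i
      by_cases hi : i = splitAxis d n
      · rw [hi, h3]
      · exact h2 i hi
    · right
      intro i
      by_cases hi : i = splitAxis d n
      · rw [hi, boxIndex_siblingCell]
        split_ifs <;> omega
      · rw [boxIndex_siblingCell_of_ne hi, h2 i hi]
  · rintro (h | h) i
    · by_cases hi : i = splitAxis d n
      · rw [hi, boxIndex_succ_splitAxis, boxIndex_succ_splitAxis, h]
      · rw [boxIndex_succ_of_ne hi, boxIndex_succ_of_ne hi, h]
    · by_cases hi : i = splitAxis d n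
      · rw [hi, boxIndex_succ_splitAxis, boxIndex_succ_splitAxis, h, boxIndex_siblingCell]
        split_ifs <;> omega
      · rw [boxIndex_succ_of_ne hi, boxIndex_succ_of_ne hi, h, boxIndex_siblingCell_of_ne hi]

theorem dyadicBox_succ (n : ℕ) (k : Fin d → ℤ) :
    dyadicBox (n + 1) k = dyadicBox n k ∪ dyadicBox n (siblingCell n k) := by
  ext x
  exact boxIndex_succ_eq_iff

theorem boxIndex_siblingCell_ne (n : ℕ) (k : Fin d → ℤ) :
    boxIndex n (siblingCell n k) ≠ boxIndex n k := by
  intro h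
  have := congrFun h (splitAxis d n)
  rw [boxIndex_siblingCell] at this
  split_ifs at this <;> omega

theorem disjoint_dyadicBox_sibling (n : ℕ) (k : Fin d → ℤ) :
    Disjoint (dyadicBox n k) (dyadicBox n (siblingCell n k)) := by
  refine Set.disjoint_left.2 fun x hx hx' => boxIndex_siblingCell_ne n k ?_
  exact hx'.symm.trans hx

theorem dyadicBox_subset_succ (n : ℕ) (k : Fin d → ℤ) : dyadicBox n k ⊆ dyadicBox (n + 1) k := by
  rw [dyadicBox_succ]
  exact Set.subset_union_left

theorem dyadicBox_mono (k : Fin d → ℤ) : Monotone fun n => dyadicBox n k :=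
  monotone_nat_of_le_succ fun n => dyadicBox_subset_succ n k

theorem mem_dyadicBox_iff {n : ℕ} {k : Fin d → ℤ} {x : EuclideanSpace ℝ (Fin d)} :
    x ∈ dyadicBox n k ↔ ∀ i, x i ∈ Set.Ico ((boxIndex n k i : ℝ) * 2 ^ boxDepth n i)
      (((boxIndex n k i : ℝ) + 1) * 2 ^ boxDepth n i) := by
  simp only [dyadicBox, Set.mem_ofPred_eq, funext_iff]
  refine forall_congr' fun i => ?_
  have h2 : (0 : ℤ) < 2 ^ boxDepth n i := by positivity
  rw [boxIndex, Int.ediv_eq_iff_of_pos h2, unitCell, Set.mem_Ico]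
  have h3 : (boxIndex n k i : ℝ) * 2 ^ boxDepth n i = ((boxIndex n k i * 2 ^ boxDepth n i : ℤ) : ℝ) := by
    push_cast; ring
  have h4 : ((boxIndex n k i : ℝ) + 1) * 2 ^ boxDepth n i =
      (((boxIndex n k i + 1) * 2 ^ boxDepth n i : ℤ) : ℝ) := by
    push_cast; ring
  rw [h3, h4, ← Int.le_floor, ← Int.floor_lt]
  constructor
  · rintro ⟨h5, h6⟩
    constructor <;> linarith
  · rintro ⟨h5, h6⟩
    constructor <;> linarith

theorem dyadicBox_eq_preimage (n : ℕ) (k : Fin d → ℤ) :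
    dyadicBox n k = (WithLp.ofLp : EuclideanSpace ℝ (Fin d) → Fin d → ℝ) ⁻¹'
      Set.pi Set.univ fun i => Set.Ico ((boxIndex n k i : ℝ) * 2 ^ boxDepth n i)
        (((boxIndex n k i : ℝ) + 1) * 2 ^ boxDepth n i) := by
  ext x
  rw [mem_dyadicBox_iff]
  simp

theorem measurableSet_dyadicBox (n : ℕ) (k : Fin d → ℤ) : MeasurableSet (dyadicBox n k) := by
  rw [dyadicBox_eq_preimage]
  exact (MeasurableSet.univ_pi fun i => measurableSet_Ico).preimage (by fun_prop)

theorem volume_dyadicBox (n : ℕ) (k : Fin d → ℤ) : volume (dyadicBox n k) = 2 ^ n := by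
  rw [dyadicBox_eq_preimage, (PiLp.volume_preserving_ofLp (Fin d)).measure_preimage
    (MeasurableSet.univ_pi fun i => measurableSet_Ico).nullMeasurableSet, Real.volume_pi_Ico]
  have : ∀ i : Fin d, ENNReal.ofReal (((boxIndex n k i : ℝ) + 1) * 2 ^ boxDepth n i -
      (boxIndex n k i : ℝ) * 2 ^ boxDepth n i) = 2 ^ boxDepth n i := by
    intro i
    rw [← sub_mul, add_sub_cancel_left, one_mul, ENNReal.ofReal_pow (by norm_num)]
    simp
  simp only [this]
  rw [Finset.prod_pow_eq_pow_sum, sum_boxDepth]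

theorem dist_le_of_mem_dyadicBox {n : ℕ} {k : Fin d → ℤ} {x y : EuclideanSpace ℝ (Fin d)}
    (hx : x ∈ dyadicBox n k) (hy : y ∈ dyadicBox n k) :
    dist x y ≤ 2 * d * 2 ^ ((n : ℝ) / d) := by
  refine (EuclideanSpace.dist_le_sum_abs x y).trans ?_
  have : ∀ i ∈ Finset.univ, |x i - y i| ≤ 2 * 2 ^ ((n : ℝ) / d) := fun i _ => by
    refine le_trans ?_ (two_pow_boxDepth_le n i)
    have h1 := mem_dyadicBox_iff.1 hx i
    have h2 := mem_dyadicBox_iff.1 hy i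
    rw [Set.mem_Ico, add_mul, one_mul] at h1 h2
    rw [abs_le]
    constructor <;> linarith [h1.1, h1.2, h2.1, h2.2]
  refine (Finset.sum_le_card_nsmul _ _ _ this).trans (le_of_eq ?_)
  simp
  ring

end DyadicBoxes

/-! ### Joint law of the masses of the boxes around a cell -/

section BoxMasses

theorem ProbabilityTheory.iIndepFun.indepFun_restrict {Ω ι : Type*} {mΩ : MeasurableSpace Ω}
    {P : Measure Ω} {β : ι → Type*} {m : ∀ i, MeasurableSpace (β i)} {f : ∀ i, Ω → β i}
    (h : iIndepFun f P) (hf : ∀ i, Measurable (f i)) {S T : Set ι} (hST : Disjoint S T) :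
    IndepFun (fun ω (i : S) => f i ω) (fun ω (i : T) => f i ω) P := by
  have h1 : ∀ S : Set ι, MeasurableSpace.comap (fun ω (i : S) => f i ω) inferInstance ≤
      ⨆ i ∈ S, MeasurableSpace.comap (f i) (m i) := by
    intro S
    rw [← measurable_iff_comap_le]
    refine @measurable_pi_lambda _ _ _ (_) _ _ fun i => ?_
    rw [measurable_iff_comap_le]
    exact le_iSup₂ (f := fun j (_ : j ∈ S) => MeasurableSpace.comap (f j) (m j)) (i : ι) i.2
  rw [IndepFun_iff_Indep]
  exact indep_of_indep_of_le_right (indep_of_indep_of_le_left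
    (indep_iSup_of_disjoint (fun i => (hf i).comap_le) h.iIndep hST) (h1 S)) (h1 T)

variable {d : ℕ} [NeZero d]

theorem measure_dyadicBox_succ (μ : Measure (EuclideanSpace ℝ (Fin d))) (n : ℕ) (k : Fin d → ℤ) :
    μ (dyadicBox (n + 1) k) = μ (dyadicBox n k) + μ (dyadicBox n (siblingCell n k)) := by
  rw [dyadicBox_succ, measure_union (disjoint_dyadicBox_sibling n k) (measurableSet_dyadicBox _ _)]

theorem measure_dyadicBox_eq_sum (μ : Measure (EuclideanSpace ℝ (Fin d))) (n : ℕ)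
    (k : Fin d → ℤ) : μ (dyadicBox n k) =
      μ (dyadicBox 0 k) + ∑ j ∈ Finset.range n, μ (dyadicBox j (siblingCell j k)) := by
  induction n with
  | zero => simp
  | succ n ih => rw [measure_dyadicBox_succ, ih, Finset.sum_range_succ, add_assoc]

theorem sibling_subset_of_lt {m n : ℕ} (h : m < n) (k : Fin d → ℤ) :
    dyadicBox m (siblingCell m k) ⊆ dyadicBox n k :=
  (Set.subset_union_right.trans (dyadicBox_succ m k).ge).trans (dyadicBox_mono k h)

theorem disjoint_siblings {m n : ℕ} (h : m ≠ n) (k : Fin d → ℤ) :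
    Disjoint (dyadicBox m (siblingCell m k)) (dyadicBox n (siblingCell n k)) := by
  rcases lt_or_gt_of_ne h with h | h
  · exact (disjoint_dyadicBox_sibling n k).mono_left (sibling_subset_of_lt h k)
  · exact ((disjoint_dyadicBox_sibling m k).mono_left (sibling_subset_of_lt h k)).symm

variable {Ω : Type*} [MeasurableSpace Ω] {P : Measure Ω}
  [IsProbabilityMeasure P] {α : ℝ≥0} {γ : Measure ℝ≥0}
  {mu : Kernel Ω (EuclideanSpace ℝ (Fin d))}

/-- `C`, the rest of the cell, and the siblings of all levels are pairwise disjoint. -/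
theorem IsCompoundPoisson.indepFun_inner_siblings (hmu : IsCompoundPoisson P α γ mu)
    {C : Set (EuclideanSpace ℝ (Fin d))} (hC : MeasurableSet C) {k : Fin d → ℤ}
    (hCk : C ⊆ dyadicBox 0 k) :
    IndepFun (fun ω n => mu ω (dyadicBox n (siblingCell n k)))
      (fun ω => (mu ω C, mu ω (dyadicBox 0 k))) P := by
  let A : Bool ⊕ ℕ → Set (EuclideanSpace ℝ (Fin d)) :=
    Sum.elim (fun b => if b then C else dyadicBox 0 k \ C)
      fun n => dyadicBox n (siblingCell n k)
  have hA : ∀ j, MeasurableSet (A j) := by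
    rintro (b | n)
    · cases b
      · exact (measurableSet_dyadicBox 0 k).diff hC
      · exact hC
    · exact measurableSet_dyadicBox _ _
  have hsub : ∀ b, A (Sum.inl b) ⊆ dyadicBox 0 k := by
    intro b
    cases b
    · exact Set.sdiff_subset
    · exact hCk
  have hvol : ∀ j, volume (A j) < ∞ := by
    rintro (b | n)
    · exact (measure_mono (hsub b)).trans_lt (by simp [volume_dyadicBox])
    · exact (volume_dyadicBox _ _).trans_lt (ENNReal.pow_lt_top ENNReal.ofNat_lt_top)
  have hdis : ∀ b n, Disjoint (A (Sum.inl b)) (A (Sum.inr n)) := fun b n =>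
    (disjoint_dyadicBox_sibling n k).mono_left ((hsub b).trans (dyadicBox_mono k (Nat.zero_le n)))
  have hdisj : Pairwise fun i j => Disjoint (A i) (A j) := by
    rintro (b | n) (b' | n') hne
    · cases b <;> cases b'
      · exact absurd rfl hne
      · exact Set.disjoint_sdiff_left
      · exact Set.disjoint_sdiff_right
      · exact absurd rfl hne
    · exact hdis b n'
    · exact (hdis b' n).symm
    · exact disjoint_siblings (fun h => hne (by rw [h])) k
  have h1 := (hmu.iIndepFun hA hvol hdisj).indepFun_restrict (fun j => mu.measurable_coe (hA j))
    (S := Set.range Sum.inr) (T := Set.range Sum.inl) (by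
      rw [Set.disjoint_left]
      rintro _ ⟨n, rfl⟩ ⟨b, hb⟩
      cases hb)
  have h2 := h1.comp (φ := fun x n => x ⟨Sum.inr n, n, rfl⟩)
    (ψ := fun x => (x ⟨Sum.inl true, true, rfl⟩,
      x ⟨Sum.inl true, true, rfl⟩ + x ⟨Sum.inl false, false, rfl⟩)) (by fun_prop) (by fun_prop)
  convert h2 using 1
  · funext ω
    rfl
  funext ω
  have := measure_inter_add_sdiff (μ := mu ω) (dyadicBox 0 k) hC
  rw [Set.inter_eq_right.2 hCk] at this
  change (mu ω C, mu ω (dyadicBox 0 k)) = (mu ω C, mu ω C + mu ω (dyadicBox 0 k \ C))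
  rw [this]

/-- Given the masses of the boxes around a unit cell, the mass of a subset of the cell is on average
its share of the mass of the cell. -/
theorem IsCompoundPoisson.lintegral_mass_mul_boxMasses [IsProbabilityMeasure γ]
    (hmu : IsCompoundPoisson P α γ mu)
    {C : Set (EuclideanSpace ℝ (Fin d))} (hC : MeasurableSet C) {k : Fin d → ℤ}
    (hCk : C ⊆ dyadicBox 0 k) {F : (ℕ → ℝ≥0∞) → ℝ≥0∞} (hF : Measurable F) :
    ∫⁻ ω, mu ω C * F (fun n => mu ω (dyadicBox n k)) ∂P =
      volume C * ∫⁻ ω, mu ω (dyadicBox 0 k) * F (fun n => mu ω (dyadicBox n k)) ∂P := by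
  set U := dyadicBox 0 k with hU
  have hUm : MeasurableSet U := measurableSet_dyadicBox 0 k
  -- Each surrounding box is the cell plus the siblings of lower levels. Independence freezes the
  -- sibling masses, and the Mecke formula is then applied inside the cell.
  let F' : ℝ≥0∞ × (ℕ → ℝ≥0∞) → ℝ≥0∞ := fun p => F fun n => p.1 + ∑ j ∈ Finset.range n, p.2 j
  have hF' : Measurable F' := hF.comp (by fun_prop)
  have h1 : ∀ ω, F (fun n => mu ω (dyadicBox n k)) =
      F' (mu ω U, fun n => mu ω (dyadicBox n (siblingCell n k))) := by
    intro ω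
    simp only [F', hU]
    congr 1
    ext n
    exact measure_dyadicBox_eq_sum _ _ _
  have hsib : Measurable fun ω n => mu ω (dyadicBox n (siblingCell n k)) :=
    measurable_pi_lambda _ fun n => mu.measurable_coe (measurableSet_dyadicBox _ _)
  have h2 : ∀ {D : Set (EuclideanSpace ℝ (Fin d))}, MeasurableSet D → D ⊆ U →
      ∫⁻ ω, mu ω D * F' (mu ω U, fun n => mu ω (dyadicBox n (siblingCell n k))) ∂P =
      ∫⁻ ω, ∫⁻ ω', mu ω' D * F' (mu ω' U, fun n => mu ω (dyadicBox n (siblingCell n k))) ∂P ∂P := by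
    intro D hD hDU
    exact (hmu.indepFun_inner_siblings hD hDU).lintegral_comp_prodMk hsib
      ((mu.measurable_coe hD).prodMk (mu.measurable_coe hUm))
      (H := fun p => p.2.1 * F' (p.2.2, p.1)) (by fun_prop)
  simp only [h1]
  rw [h2 hC hCk, h2 hUm subset_rfl, ← lintegral_const_mul' _ _
    ((measure_mono hCk).trans_lt (by simp [hU, volume_dyadicBox])).ne]
  refine lintegral_congr fun ω => ?_
  exact hmu.lintegral_mass_mul_comp_eq hC hUm hCk (by simp [hU, volume_dyadicBox])
    (h := fun t => F' (t, fun n => mu ω (dyadicBox n (siblingCell n k)))) (by fun_prop)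

/-- The unit cell `k` (for `none`), and the siblings of the boxes around it. -/
def cellOrSibling (k : Fin d → ℤ) (o : Option ℕ) : Set (EuclideanSpace ℝ (Fin d)) :=
  o.elim (dyadicBox 0 k) fun n => dyadicBox n (siblingCell n k)

theorem measurableSet_cellOrSibling (k : Fin d → ℤ) (o : Option ℕ) :
    MeasurableSet (cellOrSibling k o) := by
  cases o <;> exact measurableSet_dyadicBox _ _

theorem volume_cellOrSibling (k : Fin d → ℤ) (o : Option ℕ) :
    volume (cellOrSibling k o) = 2 ^ o.getD 0 := by
  cases o <;> exact volume_dyadicBox _ _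

theorem volume_cellOrSibling_lt_top (k : Fin d → ℤ) (o : Option ℕ) :
    volume (cellOrSibling k o) < ∞ := by
  rw [volume_cellOrSibling]
  exact ENNReal.pow_lt_top ENNReal.ofNat_lt_top

theorem IsCompoundPoisson.iIndepFun_cellOrSibling (hmu : IsCompoundPoisson P α γ mu)
    (k : Fin d → ℤ) : ProbabilityTheory.iIndepFun (fun o ω => mu ω (cellOrSibling k o)) P := by
  have hdis : ∀ n, Disjoint (cellOrSibling k none) (cellOrSibling k (some n)) := fun n =>
    (disjoint_dyadicBox_sibling n k).mono_left (dyadicBox_mono k (Nat.zero_le n))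
  refine hmu.iIndepFun (measurableSet_cellOrSibling k) (volume_cellOrSibling_lt_top k) ?_
  rintro (_ | n) (_ | n') hne
  · exact absurd rfl hne
  · exact hdis n'
  · exact (hdis n).symm
  · exact disjoint_siblings (fun h => hne (by rw [h])) k

theorem measure_dyadicBox_eq_sum_cellOrSibling (μ : Measure (EuclideanSpace ℝ (Fin d))) (n : ℕ)
    (k : Fin d → ℤ) : μ (dyadicBox n k) =
      μ (cellOrSibling k none) + ∑ j ∈ Finset.range n, μ (cellOrSibling k (some j)) :=
  measure_dyadicBox_eq_sum μ n k

/-- The law of the masses of the boxes around a unit cell does not depend on the cell. -/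
theorem IsCompoundPoisson.lintegral_boxMasses_eq (hmu : IsCompoundPoisson P α γ mu)
    (k k' : Fin d → ℤ) {H : (ℕ → ℝ≥0∞) → ℝ≥0∞} (hH : Measurable H) :
    ∫⁻ ω, H (fun n => mu ω (dyadicBox n k)) ∂P = ∫⁻ ω, H (fun n => mu ω (dyadicBox n k')) ∂P := by
  let H' : (Option ℕ → ℝ≥0∞) → ℝ≥0∞ := fun x =>
    H fun n => x none + ∑ j ∈ Finset.range n, x (some j)
  have hH' : Measurable H' := hH.comp (by fun_prop)
  have hm : ∀ k o, Measurable fun ω => mu ω (cellOrSibling k o) := fun k o =>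
    mu.measurable_coe (measurableSet_cellOrSibling k o)
  -- The masses of the cell and of its siblings are independent, so their joint law is a product
  -- whose factors depend only on the volumes.
  have h1 : ∀ k, ∫⁻ ω, H (fun n => mu ω (dyadicBox n k)) ∂P =
      ∫⁻ x, H' x ∂(Measure.infinitePi fun o => P.map fun ω => mu ω (cellOrSibling k o)) := by
    intro k
    rw [← (hmu.iIndepFun_cellOrSibling k).map_fun_eq_infinitePi_map (hm k),
      lintegral_map hH' (measurable_pi_lambda _ (hm k))]
    simp only [measure_dyadicBox_eq_sum_cellOrSibling, H']
  rw [h1, h1]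
  congr 2
  ext1 o
  exact hmu.map_eq (measurableSet_cellOrSibling k' o) (measurableSet_cellOrSibling k o)
    (volume_cellOrSibling_lt_top k' o) (by rw [volume_cellOrSibling, volume_cellOrSibling])

theorem IsCompoundPoisson.indepFun_sibling (hmu : IsCompoundPoisson P α γ mu) (n : ℕ)
    (k : Fin d → ℤ) : IndepFun (fun ω => mu ω (dyadicBox n k))
      (fun ω => mu ω (dyadicBox n (siblingCell n k))) P := by
  let A : Bool → Set (EuclideanSpace ℝ (Fin d)) :=
    fun b => if b then dyadicBox n k else dyadicBox n (siblingCell n k)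
  have h1 := hmu.iIndepFun (A := A)
    (fun b => by cases b <;> exact measurableSet_dyadicBox _ _)
    (fun b => by
      cases b <;>
        exact (volume_dyadicBox _ _).trans_lt (ENNReal.pow_lt_top ENNReal.ofNat_lt_top))
    (by
      rintro (_ | _) (_ | _) hne
      · exact absurd rfl hne
      · exact (disjoint_dyadicBox_sibling n k).symm
      · exact disjoint_dyadicBox_sibling n k
      · exact absurd rfl hne)
  exact h1.indepFun (i := true) (j := false) (by simp)

end BoxMasses

/-! ### Moments of the deviation of a box mass from its volume -/

section Moments

/-- The growth in `n` is crude but only geometric, and a Poisson number of summands has finite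
exponential moments. -/
theorem lintegral_rpow_convPow_le {γ : Measure ℝ≥0} [IsProbabilityMeasure γ] {q : ℝ} (hq : 1 ≤ q)
    (n : ℕ) : ∫⁻ s, (s : ℝ≥0∞) ^ q ∂(convPow γ n) ≤ weightMoment γ q * ((2 : ℝ≥0∞) ^ q) ^ n := by
  induction n with
  | zero => simp [convPow, zero_lt_one.trans_le hq]
  | succ n ih =>
    have h2 : (1 : ℝ≥0∞) ≤ 2 ^ q := ENNReal.one_le_rpow one_le_two (zero_lt_one.trans_le hq)
    have h3 : (2 : ℝ≥0∞) ^ (q - 1) * 2 = 2 ^ q := by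
      nth_rewrite 2 [← ENNReal.rpow_one 2]
      rw [← ENNReal.rpow_add _ _ (by simp) (by simp), sub_add_cancel]
    rw [convPow, Measure.lintegral_conv (by fun_prop)]
    calc ∫⁻ x, ∫⁻ y, ((x + y : ℝ≥0) : ℝ≥0∞) ^ q ∂γ ∂(convPow γ n)
        ≤ ∫⁻ x, ∫⁻ y, (2 : ℝ≥0∞) ^ (q - 1) * ((x : ℝ≥0∞) ^ q + (y : ℝ≥0∞) ^ q) ∂γ
            ∂(convPow γ n) := by
          refine lintegral_mono fun x => lintegral_mono fun y => ?_
          rw [ENNReal.coe_add]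
          exact ENNReal.rpow_add_le_mul_rpow_add_rpow _ _ hq
      _ = (2 : ℝ≥0∞) ^ (q - 1) * (∫⁻ s, (s : ℝ≥0∞) ^ q ∂(convPow γ n) + weightMoment γ q) := by
          have : ∀ x : ℝ≥0, ∫⁻ y, (2 : ℝ≥0∞) ^ (q - 1) * ((x : ℝ≥0∞) ^ q + (y : ℝ≥0∞) ^ q) ∂γ =
              (2 : ℝ≥0∞) ^ (q - 1) * ((x : ℝ≥0∞) ^ q + weightMoment γ q) := by
            intro x
            rw [lintegral_const_mul _ (by fun_prop), lintegral_add_left measurable_const]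
            simp [weightMoment]
          simp only [this]
          rw [lintegral_const_mul _ (by fun_prop), lintegral_add_right _ (by fun_prop)]
          simp
      _ ≤ (2 : ℝ≥0∞) ^ (q - 1) * (weightMoment γ q * ((2 : ℝ≥0∞) ^ q) ^ n +
            weightMoment γ q * ((2 : ℝ≥0∞) ^ q) ^ n) := by
          gcongr
          exact le_mul_of_one_le_right' (one_le_pow₀ h2)
      _ = weightMoment γ q * ((2 : ℝ≥0∞) ^ q) ^ (n + 1) := by
          rw [← two_mul, ← mul_assoc, h3, pow_succ]
          ring

theorem lintegral_pow_poissonMeasure_lt_top (r K : ℝ≥0) :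
    ∫⁻ n, (K : ℝ≥0∞) ^ n ∂(poissonMeasure r) < ∞ := by
  rw [poissonMeasure, lintegral_sum_measure]
  have : ∀ n : ℕ, ∫⁻ m, (K : ℝ≥0∞) ^ m
      ∂(ENNReal.ofReal (Real.exp (-r) * r ^ n / n.factorial) • Measure.dirac n) =
      ENNReal.ofReal (Real.exp (-r) * ((r * K : ℝ) ^ n / n.factorial)) := by
    intro n
    rw [lintegral_smul_measure, lintegral_dirac, smul_eq_mul, ← ENNReal.ofReal_coe_nnreal (p := K),
      ← ENNReal.ofReal_pow K.coe_nonneg, ← ENNReal.ofReal_mul (by positivity)]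
    congr 1
    rw [mul_pow]
    ring
  simp only [this]
  exact ((Real.summable_pow_div_factorial (r * K : ℝ)).mul_left (Real.exp (-r))).tsum_ofReal_lt_top

theorem IsCompoundPoisson.lintegral_rpow_lt_top {Ω M : Type*} [MeasurableSpace Ω] [MeasureSpace M]
    {P : Measure Ω} [IsProbabilityMeasure P] {α : ℝ≥0} {γ : Measure ℝ≥0} [IsProbabilityMeasure γ]
    {mu : Kernel Ω M} (hmu : IsCompoundPoisson P α γ mu) {A : Set M} (hA : MeasurableSet A)
    (hvol : volume A < ∞) {q : ℝ} (hq : 1 ≤ q) (hmom : weightMoment γ q < ∞) :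
    ∫⁻ ω, mu ω A ^ q ∂P < ∞ := by
  rw [hmu.lintegral_comp hA hvol (g := fun t => t ^ q) (by fun_prop)]
  refine (lintegral_mono fun n => lintegral_rpow_convPow_le hq n).trans_lt ?_
  rw [lintegral_const_mul' _ _ hmom.ne]
  refine ENNReal.mul_lt_top hmom ?_
  have := lintegral_pow_poissonMeasure_lt_top (α * (volume A).toNNReal) ((2 : ℝ≥0) ^ q)
  rwa [ENNReal.coe_rpow_of_nonneg _ (zero_le_one.trans hq)] at this

theorem weightMoment_lt_top_of_le {γ : Measure ℝ≥0} [IsProbabilityMeasure γ] {p q : ℝ} (hp : 0 ≤ p)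
    (hpq : p ≤ q) (hq : weightMoment γ q < ∞) : weightMoment γ p < ∞ := by
  refine lt_of_le_of_lt (lintegral_mono (g := fun x : ℝ≥0 => 1 + (x : ℝ≥0∞) ^ q) fun x => ?_) ?_
  · rcases le_total (x : ℝ≥0∞) 1 with h | h
    · exact (ENNReal.rpow_le_one h hp).trans le_self_add
    · exact (ENNReal.rpow_le_rpow_of_exponent_le h hpq).trans le_add_self
  · rw [lintegral_add_left measurable_const]
    simpa [weightMoment] using hq

/-- The point is the coefficient 1 of the pure powers: passing to a box twice as large then doubles
the q-th moment up to cross terms, and 2 < √2^q for q > 2. The proof is Bernoulli's inequality for a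
/ (a + b) = 1 - b / (a + b), with `b ≤ a`. -/
theorem NNReal.add_rpow_le_add_add {q : ℝ} (hq : 1 ≤ q) (a b : ℝ≥0) :
    (a + b) ^ q ≤ a ^ q + b ^ q +
      (q.toNNReal * 2 ^ (q - 1)) * (a ^ (q - 1) * b + b ^ (q - 1) * a) := by
  wlog hab : b ≤ a generalizing a b
  · have := this b a (le_of_not_ge hab)
    rw [add_comm b a] at this
    refine this.trans (le_of_eq ?_)
    ring
  rcases eq_or_ne a 0 with rfl | ha
  · have : b = 0 := le_antisymm hab zero_le
    simp [this, (zero_lt_one.trans_le hq).ne']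
  have hab0 : 0 < a + b := by positivity
  have h1 : (a + b) ^ q ≤ a ^ q + q.toNNReal * (b * (a + b) ^ (q - 1)) := by
    rw [← NNReal.coe_le_coe]
    push_cast
    rw [Real.coe_toNNReal _ (zero_le_one.trans hq)]
    have hA : (0 : ℝ) < a + b := by exact_mod_cast hab0
    have hA' : (a : ℝ) + b ≠ 0 := hA.ne'
    have h2 := one_add_mul_self_le_rpow_one_add (s := -((b : ℝ) / (a + b))) (by
      rw [neg_le_neg_iff, div_le_one hA]
      linarith [a.coe_nonneg]) hq
    have h3 : 1 + -((b : ℝ) / (a + b)) = a / (a + b) := by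
      field_simp
      ring
    rw [h3, Real.div_rpow a.coe_nonneg hA.le, le_div_iff₀ (Real.rpow_pos_of_pos hA q)] at h2
    have h4 : ((a : ℝ) + b) ^ q = (a + b) ^ (q - 1) * (a + b) := by
      rw [← Real.rpow_add_one hA', sub_add_cancel]
    have h5 : (1 + q * -((b : ℝ) / (a + b))) * (a + b) ^ q =
        (a + b) ^ q - q * (b * (a + b) ^ (q - 1)) := by
      rw [h4]
      field_simp
      ring
    linarith
  have h6 : (a + b) ^ (q - 1) ≤ 2 ^ (q - 1) * a ^ (q - 1) := by
    rw [← NNReal.mul_rpow]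
    refine NNReal.rpow_le_rpow ?_ (by linarith)
    rw [two_mul]
    gcongr
  calc (a + b) ^ q ≤ a ^ q + q.toNNReal * (b * (2 ^ (q - 1) * a ^ (q - 1))) := by
        refine h1.trans ?_
        gcongr
    _ = a ^ q + 0 + (q.toNNReal * 2 ^ (q - 1)) * (a ^ (q - 1) * b + 0) := by ring
    _ ≤ _ := by gcongr <;> exact zero_le

/-- A form of Young's inequality: compare `t` with `ε * a`. -/
theorem NNReal.rpow_mul_le_add {q : ℝ} (hq : 1 < q) {ε : ℝ≥0} (hε : 0 < ε) (a t : ℝ≥0) :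
    a ^ (q - 1) * t ≤ ε * a ^ q + ε⁻¹ ^ (q - 1) * t ^ q := by
  have key : ∀ x : ℝ≥0, x ^ (q - 1) * x = x ^ q := fun x => by
    rcases eq_or_ne x 0 with rfl | hx
    · simp [(zero_lt_one.trans hq).ne']
    · rw [← NNReal.rpow_add_one hx, sub_add_cancel]
  rcases le_total t (ε * a) with h | h
  · calc a ^ (q - 1) * t ≤ a ^ (q - 1) * (ε * a) := by gcongr
      _ = ε * a ^ q := by rw [← key a]; ring
      _ ≤ _ := le_self_add
  · have h1 : a ≤ ε⁻¹ * t := by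
      rw [inv_mul_eq_div, le_div_iff₀ hε, mul_comm]
      exact h
    calc a ^ (q - 1) * t ≤ (ε⁻¹ * t) ^ (q - 1) * t := by
          gcongr
      _ = ε⁻¹ ^ (q - 1) * t ^ q := by rw [NNReal.mul_rpow, mul_assoc, key]
      _ ≤ _ := le_add_self

/-- Since `θ < R`, the forcing term dictates the growth: any `K ≥ M 0` with `θ * K + B ≤ K * R`
propagates. -/
theorem ENNReal.exists_le_mul_pow_of_le {M : ℕ → ℝ≥0∞} {θ R B : ℝ≥0} (hθ : θ < R) (h0 : M 0 < ∞)
    (hM : ∀ n, M (n + 1) ≤ θ * M n + B * (R : ℝ≥0∞) ^ n) :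
    ∃ K : ℝ≥0, ∀ n, M n ≤ K * (R : ℝ≥0∞) ^ n := by
  have hR : 0 < R - θ := tsub_pos_of_lt hθ
  refine ⟨(M 0).toNNReal + B / (R - θ), fun n => ?_⟩
  induction n with
  | zero => simp [ENNReal.coe_toNNReal h0.ne]
  | succ n ih =>
    set K := (M 0).toNNReal + B / (R - θ) with hK
    have h1 : θ * K + B ≤ K * R := by
      have h2 : B ≤ (R - θ) * K := by
        rw [hK, mul_add, mul_div_cancel₀ _ hR.ne']
        exact le_add_self
      calc θ * K + B ≤ θ * K + (R - θ) * K := by gcongr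
        _ = K * R := by rw [← add_mul, add_tsub_cancel_of_le hθ.le, mul_comm]
    calc M (n + 1) ≤ θ * M n + B * (R : ℝ≥0∞) ^ n := hM n
      _ ≤ θ * (K * (R : ℝ≥0∞) ^ n) + B * (R : ℝ≥0∞) ^ n := by gcongr
      _ = ((θ * K + B : ℝ≥0) : ℝ≥0∞) * (R : ℝ≥0∞) ^ n := by push_cast; ring
      _ ≤ ((K * R : ℝ≥0) : ℝ≥0∞) * (R : ℝ≥0∞) ^ n := by gcongr
      _ = K * (R : ℝ≥0∞) ^ (n + 1) := by push_cast; ring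

variable {d : ℕ} [NeZero d] {Ω : Type*} [MeasurableSpace Ω] {P : Measure Ω}
  {α : ℝ≥0} {γ : Measure ℝ≥0} {mu : Kernel Ω (EuclideanSpace ℝ (Fin d))}

theorem HasUnitIntensity.ae_dyadicBox_lt_top (hint : HasUnitIntensity P mu) :
    ∀ᵐ ω ∂P, ∀ n (k : Fin d → ℤ), mu ω (dyadicBox n k) < ∞ := by
  refine ae_all_iff.2 fun n => ae_all_iff.2 fun k => ?_
  refine ae_lt_top (mu.measurable_coe (measurableSet_dyadicBox n k)) ?_
  rw [hint _ (measurableSet_dyadicBox n k), volume_dyadicBox]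
  exact ENNReal.pow_ne_top ENNReal.ofNat_ne_top

/-- The deviation of the mass of a box from its volume. -/
noncomputable def boxDeviation (mu : Kernel Ω (EuclideanSpace ℝ (Fin d))) (n : ℕ) (k : Fin d → ℤ)
    (ω : Ω) : ℝ := (mu ω (dyadicBox n k)).toReal - 2 ^ n

theorem measurable_boxDeviation (n : ℕ) (k : Fin d → ℤ) : Measurable (boxDeviation mu n k) :=
  ((mu.measurable_coe (measurableSet_dyadicBox n k)).ennreal_toReal).sub_const _

theorem HasUnitIntensity.boxDeviation_succ (hint : HasUnitIntensity P mu) :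
    ∀ᵐ ω ∂P, ∀ n (k : Fin d → ℤ), boxDeviation mu (n + 1) k ω =
      boxDeviation mu n k ω + boxDeviation mu n (siblingCell n k) ω := by
  filter_upwards [hint.ae_dyadicBox_lt_top] with ω hω n k
  rw [boxDeviation, measure_dyadicBox_succ, ENNReal.toReal_add (hω _ _).ne (hω _ _).ne,
    boxDeviation, boxDeviation]
  ring

variable [IsProbabilityMeasure P]

theorem IsCompoundPoisson.indepFun_boxDeviation (hmu : IsCompoundPoisson P α γ mu) (n : ℕ)
    (k : Fin d → ℤ) : IndepFun (boxDeviation mu n k) (boxDeviation mu n (siblingCell n k)) P := by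
  exact (hmu.indepFun_sibling n k).comp (φ := fun t : ℝ≥0∞ => t.toReal - 2 ^ n)
    (ψ := fun t : ℝ≥0∞ => t.toReal - 2 ^ n) (by fun_prop) (by fun_prop)

theorem IsCompoundPoisson.lintegral_boxDeviation_eq (hmu : IsCompoundPoisson P α γ mu) (n : ℕ)
    (k k' : Fin d → ℤ) {g : ℝ → ℝ≥0∞} (hg : Measurable g) :
    ∫⁻ ω, g (boxDeviation mu n k ω) ∂P = ∫⁻ ω, g (boxDeviation mu n k' ω) ∂P :=
  hmu.lintegral_comp_eq (measurableSet_dyadicBox n k') (measurableSet_dyadicBox n k)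
    (by rw [volume_dyadicBox]; exact ENNReal.pow_lt_top ENNReal.ofNat_lt_top)
    (by rw [volume_dyadicBox, volume_dyadicBox]) (g := fun t => g (t.toReal - 2 ^ n)) (by fun_prop)

variable [IsProbabilityMeasure γ]

theorem IsCompoundPoisson.lintegral_boxDeviation_rpow_lt_top (hmu : IsCompoundPoisson P α γ mu)
    {q : ℝ} (hq : 1 ≤ q) (hmom : weightMoment γ q < ∞) (n : ℕ) (k : Fin d → ℤ) :
    ∫⁻ ω, ‖boxDeviation mu n k ω‖ₑ ^ q ∂P < ∞ := by
  have h1 := hmu.lintegral_rpow_lt_top (measurableSet_dyadicBox n k)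
    (by rw [volume_dyadicBox]; exact ENNReal.pow_lt_top ENNReal.ofNat_lt_top) hq hmom
  refine (lintegral_mono fun ω => ?_ : _ ≤ ∫⁻ ω, (2 : ℝ≥0∞) ^ (q - 1) *
    (mu ω (dyadicBox n k) ^ q + (2 ^ n) ^ q) ∂P).trans_lt ?_
  · have h2 : ‖boxDeviation mu n k ω‖ₑ ≤ mu ω (dyadicBox n k) + 2 ^ n := by
      refine (enorm_sub_le (a := (mu ω (dyadicBox n k)).toReal) (b := (2 : ℝ) ^ n)).trans ?_
      refine add_le_add ?_ ?_
      · rw [Real.enorm_of_nonneg ENNReal.toReal_nonneg]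
        exact ENNReal.ofReal_toReal_le
      · rw [Real.enorm_of_nonneg (by positivity), ENNReal.ofReal_pow (by norm_num)]
        simp
    exact (ENNReal.rpow_le_rpow h2 (zero_le_one.trans hq)).trans
      (ENNReal.rpow_add_le_mul_rpow_add_rpow _ _ hq)
  · have h2 : (2 : ℝ≥0∞) ^ (q - 1) ≠ ∞ := ENNReal.rpow_ne_top_of_nonneg (by linarith) (by simp)
    rw [lintegral_const_mul' _ _ h2, lintegral_add_right _ measurable_const]
    refine ENNReal.mul_lt_top h2.lt_top (ENNReal.add_lt_top.2 ⟨h1, ?_⟩)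
    simp only [lintegral_const, measure_univ, mul_one]
    exact ENNReal.rpow_lt_top_of_nonneg (zero_le_one.trans hq)
      (ENNReal.pow_ne_top ENNReal.ofNat_ne_top)

theorem IsCompoundPoisson.memLp_boxDeviation (hmu : IsCompoundPoisson P α γ mu)
    (hmom : weightMoment γ 2 < ∞) (n : ℕ) (k : Fin d → ℤ) : MemLp (boxDeviation mu n k) 2 P := by
  refine ⟨(measurable_boxDeviation n k).aestronglyMeasurable, ?_⟩
  rw [eLpNorm_lt_top_iff_lintegral_rpow_enorm_lt_top (by simp) (by simp)]
  exact hmu.lintegral_boxDeviation_rpow_lt_top (by simp) (by simpa using hmom) n k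

theorem HasUnitIntensity.integral_boxDeviation (hint : HasUnitIntensity P mu) (n : ℕ)
    (k : Fin d → ℤ) : ∫ ω, boxDeviation mu n k ω ∂P = 0 := by
  have hB := measurableSet_dyadicBox n k
  have hm := mu.measurable_coe hB
  have h1 : ∫ ω, (mu ω (dyadicBox n k)).toReal ∂P = 2 ^ n := by
    rw [integral_toReal hm.aemeasurable (hint.ae_dyadicBox_lt_top.mono fun ω h => h n k), hint _ hB,
      volume_dyadicBox]
    simp
  have h2 : Integrable (fun ω => (mu ω (dyadicBox n k)).toReal) P := by
    refine integrable_toReal_of_lintegral_ne_top hm.aemeasurable ?_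
    rw [hint _ hB, volume_dyadicBox]
    exact ENNReal.pow_ne_top ENNReal.ofNat_ne_top
  simp only [boxDeviation]
  rw [integral_sub h2 (integrable_const _), h1]
  simp

/-- The deviations are centred, and variances add over the two independent halves, which have equal
laws. -/
theorem IsCompoundPoisson.lintegral_boxDeviation_sq (hmu : IsCompoundPoisson P α γ mu)
    (hint : HasUnitIntensity P mu) (hmom : weightMoment γ 2 < ∞) :
    ∃ V : ℝ≥0, ∀ n (k : Fin d → ℤ), ∫⁻ ω, ‖boxDeviation mu n k ω‖ₑ ^ 2 ∂P = V * 2 ^ n := by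
  have hev : ∀ n (k : Fin d → ℤ), ∫⁻ ω, ‖boxDeviation mu n k ω‖ₑ ^ 2 ∂P =
      ENNReal.ofReal (variance (boxDeviation mu n k) P) := by
    intro n k
    rw [(hmu.memLp_boxDeviation hmom n k).ofReal_variance_eq, evariance,
      hint.integral_boxDeviation n k]
    simp
  refine ⟨(variance (boxDeviation mu 0 0) P).toNNReal, fun n => ?_⟩
  induction n with
  | zero =>
    intro k
    rw [hmu.lintegral_boxDeviation_eq 0 k 0 (g := fun t => ‖t‖ₑ ^ 2) (by fun_prop), hev]
    simp [ENNReal.ofReal]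
  | succ n ih =>
    intro k
    have h1 : variance (boxDeviation mu (n + 1) k) P = variance (boxDeviation mu n k) P +
        variance (boxDeviation mu n (siblingCell n k)) P := by
      rw [← (hmu.indepFun_boxDeviation n k).variance_add (hmu.memLp_boxDeviation hmom n k)
        (hmu.memLp_boxDeviation hmom n _)]
      refine variance_congr ?_
      filter_upwards [hint.boxDeviation_succ] with ω hω
      exact hω n k
    rw [hev, h1, ENNReal.ofReal_add (variance_nonneg _ _) (variance_nonneg _ _), ← hev, ← hev, ih,
      ih, pow_succ]
    ring

theorem IsCompoundPoisson.lintegral_boxDeviation_le (hmu : IsCompoundPoisson P α γ mu)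
    (hint : HasUnitIntensity P mu) (hmom : weightMoment γ 2 < ∞) :
    ∃ c : ℝ≥0, ∀ n (k : Fin d → ℤ),
      ∫⁻ ω, ‖boxDeviation mu n k ω‖ₑ ∂P ≤ c * (NNReal.sqrt 2 : ℝ≥0∞) ^ n := by
  obtain ⟨V, hV⟩ := hmu.lintegral_boxDeviation_sq hint hmom
  refine ⟨V + 1, fun n k => ?_⟩
  set s : ℝ≥0 := NNReal.sqrt 2 ^ n with hs
  have hs0 : 0 < s := pow_pos (NNReal.sqrt_pos.2 two_pos) n
  have hs2 : s * s = 2 ^ n := by rw [hs, ← mul_pow, NNReal.mul_self_sqrt]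
  -- Stands in for Cauchy–Schwarz: `s` is the order of the standard deviation, so both terms have
  -- mean of order `s`.
  have key : ∀ a : ℝ≥0, a ≤ s⁻¹ * a ^ 2 + s := fun a => by
    rcases le_total a s with h | h
    · exact h.trans le_add_self
    · refine le_trans ?_ le_self_add
      rw [pow_two, ← mul_assoc]
      refine le_mul_of_one_le_left' ?_
      rwa [inv_mul_eq_div, one_le_div hs0]
  calc ∫⁻ ω, ‖boxDeviation mu n k ω‖ₑ ∂P
      ≤ ∫⁻ ω, ((s⁻¹ : ℝ≥0) * ‖boxDeviation mu n k ω‖ₑ ^ 2 + s) ∂P := by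
        refine lintegral_mono fun ω => ?_
        rw [enorm_eq_nnnorm]
        simpa only [ENNReal.coe_add, ENNReal.coe_mul, ENNReal.coe_pow] using
          ENNReal.coe_le_coe.2 (key ‖boxDeviation mu n k ω‖₊)
    _ = (s⁻¹ : ℝ≥0) * (V * 2 ^ n) + s := by
        rw [lintegral_add_right _ measurable_const, lintegral_const_mul' _ _ ENNReal.coe_ne_top, hV]
        simp
    _ = ((V + 1 : ℝ≥0) : ℝ≥0∞) * s := by
        have : s⁻¹ * (V * 2 ^ n) + s = (V + 1) * s := by
          rw [← hs2]
          field_simp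
        exact_mod_cast this
    _ = _ := by rw [hs]; push_cast; ring

/-- By independence the cross terms factor into a (q-1)-th moment and a first moment of order √2^n.
Young's inequality turns this into M(n+1) ≤ (2 + 2Cε) M(n) + B R^n with R = √2^q > 2, where the
forcing term dominates. -/
theorem IsCompoundPoisson.lintegral_boxDeviation_rpow_le (hmu : IsCompoundPoisson P α γ mu)
    (hint : HasUnitIntensity P mu) {q : ℝ} (hq : 2 < q) (hmom : weightMoment γ q < ∞) :
    ∃ K : ℝ≥0, ∀ n (k : Fin d → ℤ), ∫⁻ ω, ‖boxDeviation mu n k ω‖ₑ ^ q ∂P ≤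
      K * ((NNReal.sqrt 2 ^ q : ℝ≥0) : ℝ≥0∞) ^ n := by
  have hq0 : 0 ≤ q := by linarith
  have hq1 : 1 ≤ q := by linarith
  obtain ⟨c, hc⟩ := hmu.lintegral_boxDeviation_le hint
    (weightMoment_lt_top_of_le (by norm_num) hq.le hmom)
  set R : ℝ≥0 := NNReal.sqrt 2 ^ q with hR
  have hR2 : 2 < R := by
    have h1 : (1 : ℝ≥0) < NNReal.sqrt 2 := by
      rw [← NNReal.sqrt_one]
      exact NNReal.sqrt_lt_sqrt.2 one_lt_two
    calc (2 : ℝ≥0) = NNReal.sqrt 2 ^ (2 : ℝ) := by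
          rw [NNReal.rpow_two, NNReal.sq_sqrt]
      _ < R := NNReal.rpow_lt_rpow_of_exponent_lt h1 hq
  set C : ℝ≥0 := q.toNNReal * 2 ^ (q - 1) with hC
  have hC0 : 0 < C := by
    have : 0 < q.toNNReal := by simpa using by linarith
    positivity
  -- Makes `2 * C * ε` half of `R - 2`, so the recursion factor stays below `R`.
  set ε : ℝ≥0 := (R - 2) / (4 * C) with hε
  have hRs : 0 < R - 2 := tsub_pos_of_lt hR2
  have hε0 : 0 < ε := by positivity
  set B : ℝ≥0 := 2 * C * (ε⁻¹ ^ (q - 1) * c ^ q) with hB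
  have hθ : 2 + 2 * C * ε < R := by
    have h1 : 2 * C * ε = (R - 2) / 2 := by
      rw [hε]
      field_simp
      norm_num
    calc 2 + 2 * C * ε = 2 + (R - 2) / 2 := by rw [h1]
      _ < 2 + (R - 2) := by
          gcongr
          exact half_lt_self hRs
      _ = R := add_tsub_cancel_of_le hR2.le
  have hen : ∀ (x : ℝ), ‖x‖ₑ ^ q = ((‖x‖₊ ^ q : ℝ≥0) : ℝ≥0∞) := fun x => by
    rw [enorm_eq_nnnorm, ENNReal.coe_rpow_of_nonneg _ hq0]
  have hmeas := fun n (k : Fin d → ℤ) => measurable_boxDeviation (mu := mu) n k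
  have hrec : ∀ n, ∫⁻ ω, ‖boxDeviation mu (n + 1) (0 : Fin d → ℤ) ω‖ₑ ^ q ∂P ≤
      ((2 + 2 * C * ε : ℝ≥0) : ℝ≥0∞) * ∫⁻ ω, ‖boxDeviation mu n (0 : Fin d → ℤ) ω‖ₑ ^ q ∂P +
        B * (R : ℝ≥0∞) ^ n := by
    intro n
    set k : Fin d → ℤ := 0
    set M := ∫⁻ ω, ‖boxDeviation mu n k ω‖ₑ ^ q ∂P with hM
    have hall : ∀ k', ∫⁻ ω, ‖boxDeviation mu n k' ω‖ₑ ^ q ∂P = M := fun k' =>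
      hmu.lintegral_boxDeviation_eq n k' k (g := fun t => ‖t‖ₑ ^ q) (by fun_prop)
    have hcross : ∀ k₁ k₂, IndepFun (boxDeviation mu n k₁) (boxDeviation mu n k₂) P →
        ∫⁻ ω, ((‖boxDeviation mu n k₁ ω‖₊ ^ (q - 1) * ‖boxDeviation mu n k₂ ω‖₊ : ℝ≥0) : ℝ≥0∞) ∂P ≤
          ε * M + ((ε⁻¹ ^ (q - 1) * c ^ q : ℝ≥0) : ℝ≥0∞) * (R : ℝ≥0∞) ^ n := by
      intro k₁ k₂ hind
      have h1 : IndepFun (fun ω => ((‖boxDeviation mu n k₁ ω‖₊ ^ (q - 1) : ℝ≥0) : ℝ≥0∞))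
          (fun ω => ((‖boxDeviation mu n k₂ ω‖₊ : ℝ≥0) : ℝ≥0∞)) P :=
        hind.comp (φ := fun t : ℝ => ((‖t‖₊ ^ (q - 1) : ℝ≥0) : ℝ≥0∞))
          (ψ := fun t : ℝ => ((‖t‖₊ : ℝ≥0) : ℝ≥0∞)) (by fun_prop) (by fun_prop)
      simp only [ENNReal.coe_mul]
      have := hmeas n k₁
      have := hmeas n k₂
      rw [lintegral_mul_eq_lintegral_mul_lintegral_of_indepFun'' (by fun_prop) (by fun_prop) h1]
      set t : ℝ≥0 := c * NNReal.sqrt 2 ^ n with ht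
      have htq : t ^ q = c ^ q * R ^ n := by
        rw [ht, NNReal.mul_rpow, hR, ← NNReal.rpow_natCast, ← NNReal.rpow_natCast,
          ← NNReal.rpow_mul, ← NNReal.rpow_mul, mul_comm q]
      calc (∫⁻ ω, ((‖boxDeviation mu n k₁ ω‖₊ ^ (q - 1) : ℝ≥0) : ℝ≥0∞) ∂P) *
            ∫⁻ ω, ((‖boxDeviation mu n k₂ ω‖₊ : ℝ≥0) : ℝ≥0∞) ∂P
          ≤ (∫⁻ ω, ((‖boxDeviation mu n k₁ ω‖₊ ^ (q - 1) : ℝ≥0) : ℝ≥0∞) ∂P) * t := by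
            gcongr
            rw [ht]
            push_cast
            exact hc n k₂
        _ = ∫⁻ ω, ((‖boxDeviation mu n k₁ ω‖₊ ^ (q - 1) * t : ℝ≥0) : ℝ≥0∞) ∂P := by
            rw [← lintegral_mul_const' _ _ ENNReal.coe_ne_top]
            simp
        _ ≤ ∫⁻ ω, (ε * ‖boxDeviation mu n k₁ ω‖ₑ ^ q +
              ((ε⁻¹ ^ (q - 1) * t ^ q : ℝ≥0) : ℝ≥0∞)) ∂P := by
            refine lintegral_mono fun ω => ?_
            rw [hen]
            simpa only [ENNReal.coe_add, ENNReal.coe_mul] using ENNReal.coe_le_coe.2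
              (NNReal.rpow_mul_le_add (one_lt_two.trans hq) hε0 ‖boxDeviation mu n k₁ ω‖₊ t)
        _ = ε * M + ((ε⁻¹ ^ (q - 1) * t ^ q : ℝ≥0) : ℝ≥0∞) := by
            rw [lintegral_add_right _ measurable_const,
              lintegral_const_mul' _ _ ENNReal.coe_ne_top, hall]
            simp
        _ = _ := by
            rw [htq]
            push_cast
            ring
    set k' := siblingCell n k
    have hind := hmu.indepFun_boxDeviation n k
    calc ∫⁻ ω, ‖boxDeviation mu (n + 1) k ω‖ₑ ^ q ∂P
        ≤ ∫⁻ ω, (‖boxDeviation mu n k ω‖ₑ ^ q + ‖boxDeviation mu n k' ω‖ₑ ^ q + C *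
            (((‖boxDeviation mu n k ω‖₊ ^ (q - 1) * ‖boxDeviation mu n k' ω‖₊ : ℝ≥0) : ℝ≥0∞) +
            ((‖boxDeviation mu n k' ω‖₊ ^ (q - 1) * ‖boxDeviation mu n k ω‖₊ : ℝ≥0) : ℝ≥0∞))) ∂P := by
          refine lintegral_mono_ae ?_
          filter_upwards [hint.boxDeviation_succ] with ω hω
          rw [hω n k, hen, hen, hen]
          have h1 : ‖boxDeviation mu n k ω + boxDeviation mu n k' ω‖₊ ^ q ≤
              (‖boxDeviation mu n k ω‖₊ + ‖boxDeviation mu n k' ω‖₊) ^ q :=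
            NNReal.rpow_le_rpow (nnnorm_add_le _ _) hq0
          exact_mod_cast h1.trans (NNReal.add_rpow_le_add_add hq1 _ _)
      _ = M + M + C *
            (∫⁻ ω, ((‖boxDeviation mu n k ω‖₊ ^ (q - 1) * ‖boxDeviation mu n k' ω‖₊ : ℝ≥0) : ℝ≥0∞) ∂P +
            ∫⁻ ω, ((‖boxDeviation mu n k' ω‖₊ ^ (q - 1) * ‖boxDeviation mu n k ω‖₊ : ℝ≥0) : ℝ≥0∞) ∂P) := by
          have := hmeas n k
          have := hmeas n k'
          rw [lintegral_add_left (by fun_prop), lintegral_add_left (by fun_prop), hall k', ← hM,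
            lintegral_const_mul' _ _ ENNReal.coe_ne_top, lintegral_add_left (by fun_prop)]
      _ ≤ M + M + C * ((ε * M + ((ε⁻¹ ^ (q - 1) * c ^ q : ℝ≥0) : ℝ≥0∞) * (R : ℝ≥0∞) ^ n) +
            (ε * M + ((ε⁻¹ ^ (q - 1) * c ^ q : ℝ≥0) : ℝ≥0∞) * (R : ℝ≥0∞) ^ n)) := by
          gcongr
          · exact hcross k k' hind
          · exact hcross k' k hind.symm
      _ = _ := by
          rw [hB]
          push_cast
          ring
  obtain ⟨K, hK⟩ := ENNReal.exists_le_mul_pow_of_le hθ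
    (hmu.lintegral_boxDeviation_rpow_lt_top hq1 hmom 0 0) hrec
  refine ⟨K, fun n k => ?_⟩
  rw [hmu.lintegral_boxDeviation_eq n k 0 (g := fun t => ‖t‖ₑ ^ q) (by fun_prop)]
  exact hK n

end Moments

/-! ### From cellwise densities to semicouplings of finite cost -/

section AllocationKernel

variable {d : ℕ} {Ω : Type*} [MeasurableSpace Ω]

/-- The random measure that spreads the weight `X i` of the point `z i` according to the density
`f k ω`, where `k` is the unit cell of the point. -/
noncomputable def allocationKernel (z : ℕ → Ω → EuclideanSpace ℝ (Fin d)) (X : ℕ → Ω → ℝ≥0)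
    (hz : ∀ i, Measurable (z i)) (hX : ∀ i, Measurable (X i))
    (f : (Fin d → ℤ) → Ω → EuclideanSpace ℝ (Fin d) → ℝ≥0∞)
    (hf : ∀ k, Measurable (Function.uncurry (f k))) :
    Kernel Ω (EuclideanSpace ℝ (Fin d) × EuclideanSpace ℝ (Fin d)) where
  toFun ω := Measure.sum fun i =>
    X i ω • (volume.withDensity (f (unitCell (z i ω)) ω)).map fun x => (x, z i ω)
  measurable' := by
    refine Measure.measurable_of_measurable_coe _ fun S hS => ?_
    simp only [Measure.sum_apply _ hS, Measure.coe_nnreal_smul_apply]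
    refine Measurable.tsum fun i => (hX i).coe_nnreal_ennreal.mul ?_
    have h1 : ∀ ω, (volume.withDensity (f (unitCell (z i ω)) ω)).map (fun x => (x, z i ω)) S =
        ∫⁻ x, S.indicator 1 (x, z i ω) * f (unitCell (z i ω)) ω x := by
      intro ω
      have hm : MeasurableSet ((fun x => (x, z i ω)) ⁻¹' S) := hS.preimage measurable_prodMk_right
      rw [Measure.map_apply measurable_prodMk_right hS, withDensity_apply _ hm,
        ← lintegral_indicator hm]
      refine lintegral_congr fun x => ?_
      by_cases h : (x, z i ω) ∈ S
      · rw [Set.indicator_of_mem (by exact h), Set.indicator_of_mem h]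
        simp
      · rw [Set.indicator_of_notMem (by exact h), Set.indicator_of_notMem h, zero_mul]
    simp only [h1]
    refine Measurable.lintegral_prod_right' (f := fun p : Ω × EuclideanSpace ℝ (Fin d) =>
      S.indicator 1 (p.2, z i p.1) * f (unitCell (z i p.1)) p.1 p.2) ?_
    have h2 : Measurable fun p : (Fin d → ℤ) × (Ω × EuclideanSpace ℝ (Fin d)) =>
        f p.1 p.2.1 p.2.2 := measurable_from_prod_countable_right fun k => hf k
    have := hz i
    refine ((measurable_one.indicator hS).comp (by fun_prop)).mul
      (h2.comp ((measurable_unitCell.comp ?_).prodMk measurable_id))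
    fun_prop

variable {z : ℕ → Ω → EuclideanSpace ℝ (Fin d)} {X : ℕ → Ω → ℝ≥0} {hz : ∀ i, Measurable (z i)}
  {hX : ∀ i, Measurable (X i)} {f : (Fin d → ℤ) → Ω → EuclideanSpace ℝ (Fin d) → ℝ≥0∞}
  {hf : ∀ k, Measurable (Function.uncurry (f k))}

theorem lintegral_allocationKernel (ω : Ω)
    {H : EuclideanSpace ℝ (Fin d) × EuclideanSpace ℝ (Fin d) → ℝ≥0∞} (hH : Measurable H) :
    ∫⁻ xy, H xy ∂(allocationKernel z X hz hX f hf ω) =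
      ∑' i, (X i ω : ℝ≥0∞) * ∫⁻ x, f (unitCell (z i ω)) ω x * H (x, z i ω) := by
  change ∫⁻ xy, H xy ∂(Measure.sum fun i =>
    X i ω • (volume.withDensity (f (unitCell (z i ω)) ω)).map fun x => (x, z i ω)) = _
  rw [lintegral_sum_measure]
  refine tsum_congr fun i => ?_
  have hfm : Measurable (f (unitCell (z i ω)) ω) := (hf _).comp measurable_prodMk_left
  rw [lintegral_smul_measure, ENNReal.smul_def, smul_eq_mul, lintegral_map hH measurable_prodMk_right]
  congr 1
  exact lintegral_withDensity_eq_lintegral_mul _ hfm (hH.comp measurable_prodMk_right)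

variable [NeZero d]

theorem mem_dyadicBox_zero {k : Fin d → ℤ} {x : EuclideanSpace ℝ (Fin d)} :
    x ∈ dyadicBox 0 k ↔ unitCell x = k := by
  simp [dyadicBox, boxIndex_zero]

/-- Regroups a sum over points by their unit cells. -/
theorem sum_smul_dirac_apply_mul_tsum {s : ℕ → EuclideanSpace ℝ (Fin d)} {w : ℕ → ℝ≥0}
    {B : Set (EuclideanSpace ℝ (Fin d))} (hB : MeasurableSet B) (F : (Fin d → ℤ) → ℝ≥0∞) :
    ∑' i, (w i : ℝ≥0∞) * (B.indicator 1 (s i) * F (unitCell (s i))) =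
      ∑' k, (Measure.sum fun i => w i • Measure.dirac (s i)) (B ∩ dyadicBox 0 k) * F k := by
  simp only [sum_smul_dirac_apply (hB.inter (measurableSet_dyadicBox _ _)), weightedMass,
    ← ENNReal.tsum_mul_right]
  rw [ENNReal.tsum_comm]
  refine tsum_congr fun i => ?_
  rw [tsum_eq_single (unitCell (s i))]
  · by_cases h : s i ∈ B <;> simp [h, mem_dyadicBox_zero]
  · intro k hk
    rw [Set.indicator_of_notMem, zero_mul]
    rintro ⟨-, h⟩
    exact hk (mem_dyadicBox_zero.1 h).symm

/-- The cost is finite if the mass in each unit cell can be spread over the volume with a density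
whose cost is bounded and has, weighted by the mass, a finite mean. -/
theorem optimalMeanCost_lt_top_of_density {P : Measure Ω} {G : Type*} [Group G]
    [MulAction G (EuclideanSpace ℝ (Fin d))]
    (hG : IsAdmissibleAction G (EuclideanSpace ℝ (Fin d)))
    {mu : Kernel Ω (EuclideanSpace ℝ (Fin d))} (hz : ∀ i, Measurable (z i))
    (hX : ∀ i, Measurable (X i))
    (hrep : ∀ᵐ ω ∂P, mu ω = Measure.sum fun i => X i ω • Measure.dirac (z i ω))
    (hf : ∀ k, Measurable (Function.uncurry (f k)))
    (hmass : ∀ᵐ ω ∂P, ∀ k, mu ω (dyadicBox 0 k) ≠ 0 → ∫⁻ x, f k ω x = 1)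
    (hle : ∀ᵐ ω ∂P, ∀ x, ∑' k, mu ω (dyadicBox 0 k) * f k ω x ≤ 1)
    {ϑ : ℝ≥0 → ℝ≥0} (hϑ : Measurable ϑ) {F : (Fin d → ℤ) → Ω → ℝ≥0∞}
    (hF : ∀ k, Measurable (F k))
    (hcost : ∀ᵐ ω ∂P, ∀ k, mu ω (dyadicBox 0 k) ≠ 0 → ∀ y ∈ dyadicBox 0 k,
      ∫⁻ x, f k ω x * ϑ (nndist x y) ≤ F k ω)
    {C : ℝ≥0∞} (hC : C < ∞)
    (hmean : ∀ (k : Fin d → ℤ) (B : Set (EuclideanSpace ℝ (Fin d))), MeasurableSet B →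
      B ⊆ dyadicBox 0 k → ∫⁻ ω, mu ω B * F k ω ∂P ≤ C * volume B) :
    optimalMeanCost P G ϑ (Kernel.const Ω volume) mu < ∞ := by
  -- The hypotheses on total mass and cost of the density are only available in cells that carry
  -- mass; points of weight zero do not matter.
  have hpos : ∀ᵐ ω ∂P, ∀ i, X i ω ≠ 0 → mu ω (dyadicBox 0 (unitCell (z i ω))) ≠ 0 := by
    filter_upwards [hrep] with ω hω i hi h0
    rw [hω, sum_smul_dirac_apply (measurableSet_dyadicBox _ _), weightedMass,
      ENNReal.tsum_eq_zero] at h0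
    have := h0 i
    rw [Set.indicator_of_mem (mem_dyadicBox_unitCell 0 _)] at this
    exact hi (by simpa using this)
  refine lt_of_le_of_lt (iInf₂_le (allocationKernel z X hz hX f hf) ?_)
    (lt_of_le_of_lt (iSup₂_le fun B hB => ?_) hC)
  · filter_upwards [hrep, hmass, hle, hpos] with ω h1 h2 h3 h4
    constructor
    · refine Measure.le_iff.2 fun A hA => ?_
      rw [Measure.map_apply measurable_fst hA, ← lintegral_indicator_one (measurable_fst hA),
        lintegral_allocationKernel ω (measurable_one.indicator (measurable_fst hA))]
      simp only [← lintegral_const_mul' _ _ ENNReal.coe_ne_top]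
      have hfm : ∀ k, Measurable (f k ω) := fun k => (hf k).comp measurable_prodMk_left
      have hm : ∀ i, Measurable fun x => (X i ω : ℝ≥0∞) * (f (unitCell (z i ω)) ω x *
          (Prod.fst ⁻¹' A).indicator 1 (x, z i ω)) := fun i =>
        ((hfm _).mul ((measurable_one.indicator (measurable_fst hA)).comp
          measurable_prodMk_right)).const_mul _
      rw [← lintegral_tsum fun i => (hm i).aemeasurable, Kernel.const_apply, ← lintegral_indicator_one hA]
      refine lintegral_mono fun x => ?_
      by_cases hx : x ∈ A
      · rw [Set.indicator_of_mem hx]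
        refine le_trans (le_of_eq ?_) (h3 x)
        have := sum_smul_dirac_apply_mul_tsum (s := fun i => z i ω) (w := fun i => X i ω)
          MeasurableSet.univ fun k => f k ω x
        simp only [Set.univ_inter, ← h1, Set.indicator_univ, Pi.one_apply, one_mul] at this
        rw [← this]
        refine tsum_congr fun i => ?_
        rw [Set.indicator_of_mem (by exact hx), Pi.one_apply, mul_one]
      · rw [ENNReal.tsum_eq_zero.2 fun i => ?_]
        · exact zero_le
        · rw [Set.indicator_of_notMem (by exact hx), mul_zero, mul_zero]
    · ext A hA
      rw [Measure.map_apply measurable_snd hA, ← lintegral_indicator_one (measurable_snd hA),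
        lintegral_allocationKernel ω (measurable_one.indicator (measurable_snd hA)), h1,
        sum_smul_dirac_apply hA, weightedMass]
      refine tsum_congr fun i => ?_
      by_cases h0 : X i ω = 0
      · by_cases hA' : z i ω ∈ A <;> simp [h0, hA']
      · by_cases hA' : z i ω ∈ A
        · rw [Set.indicator_of_mem hA']
          have : ∀ x, (Prod.snd ⁻¹' A).indicator (1 : EuclideanSpace ℝ (Fin d) ×
              EuclideanSpace ℝ (Fin d) → ℝ≥0∞) (x, z i ω) = 1 := fun x =>
            Set.indicator_of_mem (by exact hA') _
          simp only [this, mul_one]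
          rw [h2 _ (h4 i h0), mul_one]
        · rw [Set.indicator_of_notMem hA']
          have : ∀ x, (Prod.snd ⁻¹' A).indicator (1 : EuclideanSpace ℝ (Fin d) ×
              EuclideanSpace ℝ (Fin d) → ℝ≥0∞) (x, z i ω) = 0 := fun x =>
            Set.indicator_of_notMem (by exact hA') _
          simp [this]
  · have hBm := hB.measurableSet hG
    have hBu : MeasurableSet ((Set.univ : Set (EuclideanSpace ℝ (Fin d))) ×ˢ B) :=
      MeasurableSet.univ.prod hBm
    -- `hmean` is applied to each `B ∩ dyadicBox 0 k`, so `B` need not be aligned with the grid.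
    have key : ∫⁻ ω, ∫⁻ xy in Set.univ ×ˢ B, (ϑ (nndist xy.1 xy.2) : ℝ≥0∞)
        ∂(allocationKernel z X hz hX f hf ω) ∂P ≤ C * volume B := by
      calc ∫⁻ ω, ∫⁻ xy in Set.univ ×ˢ B, (ϑ (nndist xy.1 xy.2) : ℝ≥0∞)
            ∂(allocationKernel z X hz hX f hf ω) ∂P
          ≤ ∫⁻ ω, ∑' k, mu ω (B ∩ dyadicBox 0 k) * F k ω ∂P := by
            refine lintegral_mono_ae ?_
            filter_upwards [hrep, hcost, hpos] with ω h1 h2 h3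
            rw [← lintegral_indicator hBu, lintegral_allocationKernel ω (Measurable.indicator
              (by fun_prop) hBu), h1, ← sum_smul_dirac_apply_mul_tsum hBm fun k => F k ω]
            refine ENNReal.tsum_le_tsum fun i => ?_
            by_cases h0 : X i ω = 0
            · simp [h0]
            refine mul_le_mul_right ?_ _
            by_cases hzB : z i ω ∈ B
            · rw [Set.indicator_of_mem hzB, Pi.one_apply, one_mul]
              refine le_trans (le_of_eq ?_) (h2 _ (h3 i h0) _ (mem_dyadicBox_unitCell 0 _))
              refine lintegral_congr fun x => ?_
              rw [Set.indicator_of_mem (by exact ⟨Set.mem_univ _, hzB⟩)]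
            · rw [Set.indicator_of_notMem hzB, zero_mul]
              refine le_of_eq (lintegral_eq_zero_of_ae_eq_zero (ae_of_all _ fun x => ?_))
              have hx : (x, z i ω) ∉ (Set.univ : Set (EuclideanSpace ℝ (Fin d))) ×ˢ B :=
                fun h => hzB h.2
              simp only [Set.indicator_of_notMem hx, mul_zero, Pi.zero_apply]
        _ = ∑' k, ∫⁻ ω, mu ω (B ∩ dyadicBox 0 k) * F k ω ∂P :=
            lintegral_tsum fun k => ((mu.measurable_coe (hBm.inter
              (measurableSet_dyadicBox 0 k))).mul (hF k)).aemeasurable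
        _ ≤ ∑' k, C * volume (B ∩ dyadicBox 0 k) := ENNReal.tsum_le_tsum fun k =>
            hmean k _ (hBm.inter (measurableSet_dyadicBox 0 k)) Set.inter_subset_right
        _ = C * volume B := by
            rw [ENNReal.tsum_mul_left, ← measure_iUnion (fun k k' hkk => ?_) fun k =>
              hBm.inter (measurableSet_dyadicBox 0 k), ← Set.inter_iUnion]
            · congr 2
              refine Set.inter_eq_left.2 fun x _ =>
                Set.mem_iUnion.2 ⟨unitCell x, mem_dyadicBox_unitCell 0 x⟩
            · refine Set.disjoint_left.2 fun x hx hx' => hkk ?_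
              rw [← mem_dyadicBox_zero.1 hx.2, mem_dyadicBox_zero.1 hx'.2]
    rcases eq_or_ne (volume B) 0 with h0 | h0
    · rw [h0, mul_zero] at key
      rw [le_zero_iff.1 key, mul_zero]
      exact zero_le
    rcases eq_or_ne (volume B) ∞ with ht | ht
    · simp [ht]
    calc _ ≤ (volume B)⁻¹ * (C * volume B) := by gcongr
      _ = C := by rw [mul_comm C, ← mul_assoc, ENNReal.inv_mul_cancel h0 ht, one_mul]

end AllocationKernel

/-! ### Stretching the halves of boxes to equal densities -/

section BoxFlow

variable {d : ℕ} [NeZero d]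

/-- Nonnegative masses of the dyadic boxes, additive over the two halves of a box. -/
structure IsBoxMass (β : ℕ → (Fin d → ℤ) → ℝ) : Prop where
  nonneg : ∀ n k, 0 ≤ β n k
  succ : ∀ n k, β (n + 1) k = β n k + β n (siblingCell n k)
  congr : ∀ n k k', boxIndex n k = boxIndex n k' → β n k = β n k'

theorem isBoxMass_measure {μ : Measure (EuclideanSpace ℝ (Fin d))}
    (hμ : ∀ n (k : Fin d → ℤ), μ (dyadicBox n k) < ∞) :
    IsBoxMass fun n k => (μ (dyadicBox n k)).toReal where
  nonneg _ _ := ENNReal.toReal_nonneg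
  succ n k := by
    rw [measure_dyadicBox_succ, ENNReal.toReal_add (hμ _ _).ne (hμ _ _).ne]
  congr n k k' h := by simp only [dyadicBox, h]

/-- The factor by which the half of `k` is stretched when two halves of a box of level `n + 1` are
rescaled to equal densities. -/
noncomputable def stretchRatio (β : ℕ → (Fin d → ℤ) → ℝ) (n : ℕ) (k : Fin d → ℤ) : ℝ :=
  2 * β n k / β (n + 1) k

/-- The end of the half of `k` that is fixed under the stretching. -/
noncomputable def stretchAnchor (n : ℕ) (k : Fin d → ℤ) : ℝ :=
  if boxIndex n k (splitAxis d n) % 2 = 0 then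
    (boxIndex n k (splitAxis d n) : ℝ) * 2 ^ boxDepth n (splitAxis d n)
  else ((boxIndex n k (splitAxis d n) : ℝ) + 1) * 2 ^ boxDepth n (splitAxis d n)

/-- The point `c` of the unit cell `k`, moved by the first `n` stretchings. -/
noncomputable def flowPoint (β : ℕ → (Fin d → ℤ) → ℝ) (k : Fin d → ℤ) (c : Fin d → ℝ) :
    ℕ → Fin d → ℝ
  | 0 => c
  | n + 1 => Function.update (flowPoint β k c n) (splitAxis d n)
      (stretchAnchor n k + (flowPoint β k c n (splitAxis d n) - stretchAnchor n k) *
        stretchRatio β n k)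

variable {β : ℕ → (Fin d → ℤ) → ℝ}

theorem flowPoint_succ_splitAxis (k : Fin d → ℤ) (c : Fin d → ℝ) (n : ℕ) :
    flowPoint β k c (n + 1) (splitAxis d n) = stretchAnchor n k +
      (flowPoint β k c n (splitAxis d n) - stretchAnchor n k) * stretchRatio β n k := by
  simp [flowPoint]

theorem flowPoint_succ_of_ne (k : Fin d → ℤ) (c : Fin d → ℝ) {n : ℕ} {i : Fin d}
    (hi : i ≠ splitAxis d n) : flowPoint β k c (n + 1) i = flowPoint β k c n i := by
  simp [flowPoint, hi]

theorem IsBoxMass.le_succ (hβ : IsBoxMass β) (n : ℕ) (k : Fin d → ℤ) : β n k ≤ β (n + 1) k := by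
  rw [hβ.succ]
  linarith [hβ.nonneg n (siblingCell n k)]

theorem IsBoxMass.stretchRatio_nonneg (hβ : IsBoxMass β) (n : ℕ) (k : Fin d → ℤ) :
    0 ≤ stretchRatio β n k :=
  div_nonneg (mul_nonneg zero_le_two (hβ.nonneg _ _)) (hβ.nonneg _ _)

theorem IsBoxMass.stretchRatio_le_two (hβ : IsBoxMass β) (n : ℕ) (k : Fin d → ℤ) :
    stretchRatio β n k ≤ 2 := by
  refine div_le_of_le_mul₀ (hβ.nonneg _ _) zero_le_two ?_
  gcongr
  exact hβ.le_succ n k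

/-- If the parent mass is at least 2^n, divide by it. Otherwise the parent deviates by at least 2^n,
and the trivial bound 1 suffices; this includes a parent of mass zero. -/
theorem IsBoxMass.abs_stretchRatio_sub_one_le (hβ : IsBoxMass β) (n : ℕ) (k : Fin d → ℤ) :
    |stretchRatio β n k - 1| ≤ (2 * |β n k - 2 ^ n| + |β (n + 1) k - 2 ^ (n + 1)|) / 2 ^ n := by
  have h2 : (0 : ℝ) < 2 ^ n := by positivity
  have hp : (2 : ℝ) ^ (n + 1) = 2 * 2 ^ n := by ring
  rcases le_total (2 ^ n) (β (n + 1) k) with h | h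
  · have hB : 0 < β (n + 1) k := h2.trans_le h
    have h3 : stretchRatio β n k - 1 = (2 * β n k - β (n + 1) k) / β (n + 1) k := by
      rw [stretchRatio]
      field_simp
    rw [h3, abs_div, abs_of_pos hB]
    have h4 : |2 * β n k - β (n + 1) k| ≤ 2 * |β n k - 2 ^ n| + |β (n + 1) k - 2 ^ (n + 1)| := by
      have : 2 * β n k - β (n + 1) k = 2 * (β n k - 2 ^ n) - (β (n + 1) k - 2 ^ (n + 1)) := by
        rw [hp]; ring
      rw [this]
      refine (abs_sub _ _).trans (le_of_eq ?_)
      rw [abs_mul, abs_two]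
    exact div_le_div₀ (by positivity) h4 h2 h
  · have h3 : |stretchRatio β n k - 1| ≤ 1 := by
      rw [abs_le]
      constructor <;> linarith [hβ.stretchRatio_nonneg n k, hβ.stretchRatio_le_two n k]
    refine h3.trans ?_
    rw [one_le_div h2, hp]
    have h4 := neg_abs_le (β (n + 1) k - 2 * 2 ^ n)
    have h5 := abs_nonneg (β n k - 2 ^ n)
    linarith

theorem stretchAnchor_eq_or (n : ℕ) (k : Fin d → ℤ) :
    (boxIndex n k (splitAxis d n) = 2 * boxIndex (n + 1) k (splitAxis d n) ∧
      stretchAnchor n k =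
        (boxIndex n k (splitAxis d n) : ℝ) * 2 ^ boxDepth n (splitAxis d n)) ∨
    (boxIndex n k (splitAxis d n) = 2 * boxIndex (n + 1) k (splitAxis d n) + 1 ∧
      stretchAnchor n k =
        ((boxIndex n k (splitAxis d n) : ℝ) + 1) * 2 ^ boxDepth n (splitAxis d n)) := by
  rw [boxIndex_succ_splitAxis, stretchAnchor]
  split_ifs with h
  · left
    exact ⟨by omega, rfl⟩
  · right
    exact ⟨by omega, rfl⟩

/-- A half is stretched about its outer face by a factor of at most 2, so it stays inside the parent
box. -/
theorem IsBoxMass.flowPoint_mem (hβ : IsBoxMass β) {k : Fin d → ℤ} {c : Fin d → ℝ}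
    (hc : ∀ i, c i ∈ Set.Icc (k i : ℝ) (k i + 1)) (n : ℕ) (i : Fin d) :
    flowPoint β k c n i ∈ Set.Icc ((boxIndex n k i : ℝ) * 2 ^ boxDepth n i)
      (((boxIndex n k i : ℝ) + 1) * 2 ^ boxDepth n i) := by
  induction n generalizing i with
  | zero => simpa [flowPoint, boxIndex_zero, boxDepth_zero] using hc i
  | succ n ih =>
    by_cases hi : i = splitAxis d n
    · subst hi
      rw [flowPoint_succ_splitAxis, boxDepth_succ_splitAxis, pow_succ]
      have h1 := ih (splitAxis d n)
      set t := flowPoint β k c n (splitAxis d n)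
      set S : ℝ := 2 ^ boxDepth n (splitAxis d n)
      have hρ0 := hβ.stretchRatio_nonneg n k
      have hρ2 := hβ.stretchRatio_le_two n k
      set ρ := stretchRatio β n k
      rcases stretchAnchor_eq_or n k with ⟨h2, h3⟩ | ⟨h2, h3⟩
      · rw [h3]
        have h4 : (boxIndex n k (splitAxis d n) : ℝ) =
          2 * boxIndex (n + 1) k (splitAxis d n) := by exact_mod_cast h2
        rw [h4] at h1 ⊢
        set b : ℝ := (boxIndex (n + 1) k (splitAxis d n) : ℝ)
        have h5 : 0 ≤ t - 2 * b * S := by linarith [h1.1]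
        have h6 : t - 2 * b * S ≤ S := by linarith [h1.2]
        have h7 : 0 ≤ (t - 2 * b * S) * ρ := mul_nonneg h5 hρ0
        have h8 : (t - 2 * b * S) * ρ ≤ S * 2 := mul_le_mul h6 hρ2 hρ0 (h5.trans h6)
        constructor <;> linarith
      · rw [h3]
        have h4 : (boxIndex n k (splitAxis d n) : ℝ) =
          2 * boxIndex (n + 1) k (splitAxis d n) + 1 := by exact_mod_cast h2
        rw [h4] at h1 ⊢
        set b : ℝ := (boxIndex (n + 1) k (splitAxis d n) : ℝ)
        have h5 : 0 ≤ (2 * b + 1 + 1) * S - t := by linarith [h1.2]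
        have h6 : (2 * b + 1 + 1) * S - t ≤ S := by linarith [h1.1]
        have h7 : 0 ≤ ((2 * b + 1 + 1) * S - t) * ρ := mul_nonneg h5 hρ0
        have h8 : ((2 * b + 1 + 1) * S - t) * ρ ≤ S * 2 := mul_le_mul h6 hρ2 hρ0 (h5.trans h6)
        constructor <;> linarith
    · rw [flowPoint_succ_of_ne _ _ hi, boxIndex_succ_of_ne hi, boxDepth_succ_of_ne hi]
      exact ih i

theorem abs_sub_stretchAnchor_le {n : ℕ} {k : Fin d → ℤ} {t : ℝ}
    (ht : t ∈ Set.Icc ((boxIndex n k (splitAxis d n) : ℝ) * 2 ^ boxDepth n (splitAxis d n))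
      (((boxIndex n k (splitAxis d n) : ℝ) + 1) * 2 ^ boxDepth n (splitAxis d n))) :
    |t - stretchAnchor n k| ≤ 2 ^ boxDepth n (splitAxis d n) := by
  obtain ⟨h1, h2⟩ := ht
  rw [abs_le]
  rcases stretchAnchor_eq_or n k with ⟨-, h3⟩ | ⟨-, h3⟩ <;> rw [h3] <;>
    constructor <;> nlinarith

/-- A bound for the displacement in the stretching from level `n` to level `n + 1`. -/
noncomputable def flowStep (d : ℕ) [NeZero d] (b : ℕ → ℝ) (n : ℕ) : ℝ :=
  2 ^ boxDepth n (splitAxis d n) * ((2 * |b n - 2 ^ n| + |b (n + 1) - 2 ^ (n + 1)|) / 2 ^ n)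

theorem flowStep_nonneg (b : ℕ → ℝ) (n : ℕ) : 0 ≤ flowStep d b n := by
  rw [flowStep]
  positivity

theorem IsBoxMass.abs_flowPoint_succ_sub_le (hβ : IsBoxMass β) {k : Fin d → ℤ} {c : Fin d → ℝ}
    (hc : ∀ i, c i ∈ Set.Icc (k i : ℝ) (k i + 1)) (n : ℕ) (i : Fin d) :
    |flowPoint β k c (n + 1) i - flowPoint β k c n i| ≤ flowStep d (fun n => β n k) n := by
  by_cases hi : i = splitAxis d n
  · subst hi
    rw [flowPoint_succ_splitAxis]
    have h1 : stretchAnchor n k + (flowPoint β k c n (splitAxis d n) - stretchAnchor n k) *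
        stretchRatio β n k - flowPoint β k c n (splitAxis d n) =
        (flowPoint β k c n (splitAxis d n) - stretchAnchor n k) * (stretchRatio β n k - 1) := by
      ring
    rw [h1, abs_mul]
    exact mul_le_mul (abs_sub_stretchAnchor_le (hβ.flowPoint_mem hc n _))
      (hβ.abs_stretchRatio_sub_one_le n k) (abs_nonneg _) (by positivity)
  · rw [flowPoint_succ_of_ne _ _ hi, sub_self, abs_zero]
    exact flowStep_nonneg _ _

theorem IsBoxMass.flowPoint_mono (hβ : IsBoxMass β) (k : Fin d → ℤ) {c c' : Fin d → ℝ}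
    (hc : c ≤ c') (n : ℕ) : flowPoint β k c n ≤ flowPoint β k c' n := by
  induction n with
  | zero => exact hc
  | succ n ih =>
    intro i
    by_cases hi : i = splitAxis d n
    · subst hi
      rw [flowPoint_succ_splitAxis, flowPoint_succ_splitAxis]
      have := hβ.stretchRatio_nonneg n k
      gcongr
      exact ih _
    · rw [flowPoint_succ_of_ne _ _ hi, flowPoint_succ_of_ne _ _ hi]
      exact ih i

/-- Each step changes one edge, by the factor 2β_n / β_(n+1), and the product telescopes. -/
theorem IsBoxMass.prod_flowPoint_sub (hβ : IsBoxMass β) {k : Fin d → ℤ} (h0 : 0 < β 0 k)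
    (c c' : Fin d → ℝ) (n : ℕ) :
    (∏ i, (flowPoint β k c' n i - flowPoint β k c n i)) * β n k =
      2 ^ n * β 0 k * ∏ i, (c' i - c i) := by
  induction n with
  | zero => simp [flowPoint, mul_comm]
  | succ n ih =>
    have hpos : 0 < β (n + 1) k := h0.trans_le
      (monotone_nat_of_le_succ (f := fun n => β n k) (fun n => hβ.le_succ n k) (Nat.zero_le _))
    have h1 : ∏ i, (flowPoint β k c' (n + 1) i - flowPoint β k c (n + 1) i) =
        (∏ i, (flowPoint β k c' n i - flowPoint β k c n i)) * stretchRatio β n k := by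
      rw [← Finset.mul_prod_erase _ _ (Finset.mem_univ (splitAxis d n)),
        ← Finset.mul_prod_erase _ (fun i => flowPoint β k c' n i - flowPoint β k c n i)
          (Finset.mem_univ (splitAxis d n)), flowPoint_succ_splitAxis, flowPoint_succ_splitAxis,
        Finset.prod_congr rfl fun i hi => by
          rw [flowPoint_succ_of_ne _ _ (Finset.ne_of_mem_erase hi),
            flowPoint_succ_of_ne _ _ (Finset.ne_of_mem_erase hi)]]
      ring
    rw [h1, mul_assoc, stretchRatio, div_mul_cancel₀ _ hpos.ne', pow_succ]
    linear_combination 2 * ih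

/-- The images of two distinct unit cells under the first `n` stretchings are separated by a
hyperplane orthogonal to a coordinate axis. -/
theorem IsBoxMass.separated (hβ : IsBoxMass β) {k k' : Fin d → ℤ} (hk : k ≠ k') (n : ℕ) :
    ∃ i, flowPoint β k (fun i => k i + 1) n i ≤ flowPoint β k' (fun i => k' i) n i ∨
      flowPoint β k' (fun i => k' i + 1) n i ≤ flowPoint β k (fun i => k i) n i := by
  have hlo : ∀ (k : Fin d → ℤ) (i : Fin d), (k i : ℝ) ∈ Set.Icc (k i : ℝ) (k i + 1) :=
    fun k i => ⟨le_rfl, by linarith⟩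
  have hhi : ∀ (k : Fin d → ℤ) (i : Fin d), (k i + 1 : ℝ) ∈ Set.Icc (k i : ℝ) (k i + 1) :=
    fun k i => ⟨by linarith, le_rfl⟩
  -- As long as the cells lie in different boxes of level `n`, their images are confined to these
  -- boxes.
  have hne : ∀ n, boxIndex n k ≠ boxIndex n k' →
      ∃ i, flowPoint β k (fun i => k i + 1) n i ≤ flowPoint β k' (fun i => k' i) n i ∨
        flowPoint β k' (fun i => k' i + 1) n i ≤ flowPoint β k (fun i => k i) n i := by
    intro n hn
    obtain ⟨i, hi⟩ := Function.ne_iff.1 hn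
    refine ⟨i, ?_⟩
    have hS : (0 : ℝ) ≤ 2 ^ boxDepth n i := by positivity
    rcases lt_or_gt_of_ne hi with h | h
    · left
      refine (hβ.flowPoint_mem (hhi k) n i).2.trans
        (le_trans ?_ (hβ.flowPoint_mem (hlo k') n i).1)
      refine mul_le_mul_of_nonneg_right ?_ hS
      exact_mod_cast h
    · right
      refine (hβ.flowPoint_mem (hhi k') n i).2.trans
        (le_trans ?_ (hβ.flowPoint_mem (hlo k) n i).1)
      refine mul_le_mul_of_nonneg_right ?_ hS
      exact_mod_cast h
  induction n with
  | zero => exact hne 0 (by rwa [boxIndex_zero, boxIndex_zero])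
  | succ n ih =>
    by_cases h1 : boxIndex (n + 1) k = boxIndex (n + 1) k'
    swap
    · exact hne _ h1
    by_cases h2 : boxIndex n k = boxIndex n k'
    -- In the same half, both cells undergo the same nondecreasing affine map, which preserves the
    -- separation.
    · have ha : stretchAnchor n k = stretchAnchor n k' := by simp only [stretchAnchor, h2]
      have hr : stretchRatio β n k = stretchRatio β n k' := by
        rw [stretchRatio, stretchRatio, hβ.congr n k k' h2, hβ.congr (n + 1) k k' h1]
      have hr0 := hβ.stretchRatio_nonneg n k'
      obtain ⟨i, hi⟩ := ih
      refine ⟨i, ?_⟩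
      by_cases hi' : i = splitAxis d n
      · subst hi'
        simp only [flowPoint_succ_splitAxis, ha, hr]
        refine hi.imp (fun h => ?_) (fun h => ?_) <;> gcongr
      · simpa only [flowPoint_succ_of_ne _ _ hi'] using hi
    · refine ⟨splitAxis d n, ?_⟩
      simp only [flowPoint_succ_splitAxis]
      have hsib : boxIndex n k' = boxIndex n (siblingCell n k) :=
        (boxIndex_succ_eq_iff.1 h1.symm).resolve_left fun h => h2 h.symm
      -- In opposite halves, the stretched lengths together do not exceed the side of the parent, so
      -- the halves stay apart.
      have hsum : stretchRatio β n k + stretchRatio β n k' ≤ 2 := by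
        rw [stretchRatio, stretchRatio, ← hβ.congr (n + 1) k k' h1, hβ.congr n k' _ hsib, ← add_div,
          ← mul_add, ← hβ.succ]
        exact div_le_of_le_mul₀ (hβ.nonneg _ _) zero_le_two le_rfl
      have hr := hβ.stretchRatio_nonneg n k
      have hr' := hβ.stretchRatio_nonneg n k'
      have hb : boxIndex (n + 1) k (splitAxis d n) = boxIndex (n + 1) k' (splitAxis d n) := by
        rw [h1]
      have hbne : boxIndex n k (splitAxis d n) ≠ boxIndex n k' (splitAxis d n) := by
        rw [hsib, boxIndex_siblingCell]
        split_ifs <;> omega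
      have hS : (0 : ℝ) < 2 ^ boxDepth n (splitAxis d n) := by positivity
      have m1 := hβ.flowPoint_mem (hlo k) n (splitAxis d n)
      have m2 := hβ.flowPoint_mem (hhi k) n (splitAxis d n)
      have m3 := hβ.flowPoint_mem (hlo k') n (splitAxis d n)
      have m4 := hβ.flowPoint_mem (hhi k') n (splitAxis d n)
      set S : ℝ := 2 ^ boxDepth n (splitAxis d n)
      have key : ∀ {b b' : ℝ} {t t' ρ ρ' : ℝ}, b' = b + 1 → t ≤ (b + 1) * S → b' * S ≤ t' →
          0 ≤ ρ → 0 ≤ ρ' → ρ + ρ' ≤ 2 →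
          b * S + (t - b * S) * ρ ≤ (b' + 1) * S + (t' - (b' + 1) * S) * ρ' := by
        intro b b' t t' ρ ρ' hb ht ht' hρ hρ' hs
        have e1 : (t - b * S) * ρ ≤ S * ρ := mul_le_mul_of_nonneg_right (by linarith) hρ
        have e2 : -S * ρ' ≤ (t' - (b' + 1) * S) * ρ' :=
          mul_le_mul_of_nonneg_right (by linarith) hρ'
        have e3 : S * (ρ + ρ') ≤ S * 2 := mul_le_mul_of_nonneg_left hs hS.le
        rw [hb] at *
        linarith
      rcases stretchAnchor_eq_or n k with ⟨a1, a2⟩ | ⟨a1, a2⟩ <;>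
        rcases stretchAnchor_eq_or n k' with ⟨a3, a4⟩ | ⟨a3, a4⟩
      · exact absurd (by rw [a1, a3, hb]) hbne
      · left
        rw [a2, a4]
        refine key ?_ m2.2 m3.1 hr hr' hsum
        rw [a3, a1, hb]
        push_cast
        ring
      · right
        rw [a2, a4]
        refine key ?_ m4.2 m1.1 hr' hr (by linarith)
        rw [a3, a1, hb]
        push_cast
        ring
      · exact absurd (by rw [a1, a3, hb]) hbne

end BoxFlow

/-! ### The limit boxes: volume, disjointness, displacement -/

section BoxFlowLimit

variable {d : ℕ}

theorem lower_corner_mem (k : Fin d → ℤ) (i : Fin d) : (k i : ℝ) ∈ Set.Icc (k i : ℝ) (k i + 1) :=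
  ⟨le_rfl, by linarith⟩

theorem upper_corner_mem (k : Fin d → ℤ) (i : Fin d) :
    (k i + 1 : ℝ) ∈ Set.Icc (k i : ℝ) (k i + 1) :=
  ⟨by linarith, le_rfl⟩

variable [NeZero d] {β : ℕ → (Fin d → ℤ) → ℝ} {k : Fin d → ℤ}

/-- The limit position of the point `c` of the unit cell `k` under all stretchings. -/
noncomputable def flowLimit (β : ℕ → (Fin d → ℤ) → ℝ) (k : Fin d → ℤ) (c : Fin d → ℝ)
    (i : Fin d) : ℝ :=
  c i + ∑' n, (flowPoint β k c (n + 1) i - flowPoint β k c n i)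

theorem IsBoxMass.tendsto_flowPoint (hβ : IsBoxMass β)
    (hs : Summable (flowStep d fun n => β n k)) {c : Fin d → ℝ}
    (hc : ∀ i, c i ∈ Set.Icc (k i : ℝ) (k i + 1)) (i : Fin d) :
    Tendsto (fun n => flowPoint β k c n i) atTop (𝓝 (flowLimit β k c i)) := by
  have h1 : Summable fun n => flowPoint β k c (n + 1) i - flowPoint β k c n i :=
    Summable.of_norm_bounded hs fun n => hβ.abs_flowPoint_succ_sub_le hc n i
  refine (h1.hasSum.tendsto_sum_nat.const_add (c i)).congr fun n => ?_
  rw [Finset.sum_range_sub fun n => flowPoint β k c n i]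
  simp [flowPoint]

theorem IsBoxMass.abs_flowLimit_sub_le (hβ : IsBoxMass β)
    (hs : Summable (flowStep d fun n => β n k)) {c : Fin d → ℝ}
    (hc : ∀ i, c i ∈ Set.Icc (k i : ℝ) (k i + 1)) (i : Fin d) :
    |flowLimit β k c i - c i| ≤ ∑' n, flowStep d (fun n => β n k) n := by
  rw [flowLimit, add_sub_cancel_left, ← Real.norm_eq_abs]
  exact tsum_of_norm_bounded hs.hasSum fun n => hβ.abs_flowPoint_succ_sub_le hc n i

/-- Box sides are at least 1, so a step dominates the relative deviation. -/
theorem tendsto_div_two_pow_of_summable_flowStep {b : ℕ → ℝ} (hs : Summable (flowStep d b)) :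
    Tendsto (fun n => b n / 2 ^ n) atTop (𝓝 1) := by
  rw [tendsto_iff_dist_tendsto_zero]
  refine squeeze_zero (fun _ => dist_nonneg) (fun n => ?_) hs.tendsto_atTop_zero
  have h2 : (0 : ℝ) < 2 ^ n := by positivity
  have h3 : b n / 2 ^ n - 1 = (b n - 2 ^ n) / 2 ^ n := by field_simp
  rw [Real.dist_eq, h3, abs_div, abs_of_pos h2, flowStep]
  refine le_trans ?_ (le_mul_of_one_le_left (by positivity) (one_le_pow₀ one_le_two))
  gcongr
  linarith [abs_nonneg (b n - 2 ^ n), abs_nonneg (b (n + 1) - 2 ^ (n + 1))]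

/-- The image of the unit cell `k` under all stretchings. -/
noncomputable def flowBox (β : ℕ → (Fin d → ℤ) → ℝ) (k : Fin d → ℤ) :
    Set (EuclideanSpace ℝ (Fin d)) :=
  (WithLp.ofLp : EuclideanSpace ℝ (Fin d) → Fin d → ℝ) ⁻¹' Set.pi Set.univ fun i =>
    Set.Ico (flowLimit β k (fun i => k i) i) (flowLimit β k (fun i => k i + 1) i)

theorem mem_flowBox {x : EuclideanSpace ℝ (Fin d)} :
    x ∈ flowBox β k ↔ ∀ i, flowLimit β k (fun i => k i) i ≤ x i ∧
      x i < flowLimit β k (fun i => k i + 1) i := by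
  simp [flowBox]

/-- At level n the image has volume 2^n β_0 / β_n, and β_n / 2^n tends to 1. -/
theorem IsBoxMass.volume_flowBox (hβ : IsBoxMass β) (hs : Summable (flowStep d fun n => β n k))
    (h0 : 0 < β 0 k) : volume (flowBox β k) = ENNReal.ofReal (β 0 k) := by
  have hlo := hβ.tendsto_flowPoint hs (lower_corner_mem k)
  have hhi := hβ.tendsto_flowPoint hs (upper_corner_mem k)
  rw [flowBox, (PiLp.volume_preserving_ofLp (Fin d)).measure_preimage
    (MeasurableSet.univ_pi fun i => measurableSet_Ico).nullMeasurableSet, Real.volume_pi_Ico,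
    ← ENNReal.ofReal_prod_of_nonneg fun i _ => sub_nonneg.2 (le_of_tendsto_of_tendsto'
      (hlo i) (hhi i) fun n => hβ.flowPoint_mono k (fun i => (lower_corner_mem k i).2) n i)]
  congr 1
  have h1 := (tendsto_finsetProd Finset.univ fun i _ => (hhi i).sub (hlo i)).mul
    (tendsto_div_two_pow_of_summable_flowStep hs)
  rw [mul_one] at h1
  refine tendsto_nhds_unique h1 (tendsto_const_nhds.congr fun n => ?_)
  have h2 := hβ.prod_flowPoint_sub h0 (fun i => k i) (fun i => k i + 1) n
  simp only [add_sub_cancel_left, Finset.prod_const_one, mul_one] at h2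
  rw [← mul_div_assoc, h2, mul_div_cancel_left₀ _ (by positivity)]

/-- A common point of two half-open boxes forces strict inequalities between opposite corners on
every axis. These persist at some finite level, against the separation there. -/
theorem IsBoxMass.disjoint_flowBox (hβ : IsBoxMass β) {k' : Fin d → ℤ}
    (hs : Summable (flowStep d fun n => β n k)) (hs' : Summable (flowStep d fun n => β n k'))
    (hk : k ≠ k') : Disjoint (flowBox β k) (flowBox β k') := by
  refine Set.disjoint_left.2 fun x hx hx' => ?_
  rw [mem_flowBox] at hx hx'
  have h1 : ∀ᶠ n in atTop, ∀ i, flowPoint β k' (fun i => k' i) n i <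
        flowPoint β k (fun i => k i + 1) n i ∧
      flowPoint β k (fun i => k i) n i < flowPoint β k' (fun i => k' i + 1) n i := by
    rw [eventually_all]
    intro i
    exact ((hβ.tendsto_flowPoint hs' (lower_corner_mem k') i).eventually_lt
        (hβ.tendsto_flowPoint hs (upper_corner_mem k) i) ((hx' i).1.trans_lt (hx i).2)).and
      ((hβ.tendsto_flowPoint hs (lower_corner_mem k) i).eventually_lt
        (hβ.tendsto_flowPoint hs' (upper_corner_mem k') i) ((hx i).1.trans_lt (hx' i).2))
  obtain ⟨n, hn⟩ := h1.exists
  obtain ⟨i, hi | hi⟩ := hβ.separated hk n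
  · exact (hn i).1.not_ge hi
  · exact (hn i).2.not_ge hi

theorem IsBoxMass.dist_le_of_mem_flowBox (hβ : IsBoxMass β)
    (hs : Summable (flowStep d fun n => β n k)) {x y : EuclideanSpace ℝ (Fin d)}
    (hx : x ∈ flowBox β k) (hy : y ∈ dyadicBox 0 k) :
    dist x y ≤ d * (1 + ∑' n, flowStep d (fun n => β n k) n) := by
  refine (EuclideanSpace.dist_le_sum_abs x y).trans ?_
  rw [mem_flowBox] at hx
  rw [mem_dyadicBox_iff] at hy
  have : ∀ i ∈ Finset.univ, |x i - y i| ≤ 1 + ∑' n, flowStep d (fun n => β n k) n := by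
    intro i _
    have h1 := abs_le.1 (hβ.abs_flowLimit_sub_le hs (lower_corner_mem k) i)
    have h2 := abs_le.1 (hβ.abs_flowLimit_sub_le hs (upper_corner_mem k) i)
    have h3 := hy i
    rw [boxIndex_zero, boxDepth_zero, pow_zero, mul_one, mul_one, Set.mem_Ico] at h3
    rw [abs_le]
    constructor <;> linarith [(hx i).1, (hx i).2, h3.1, h3.2, h1.1, h2.2]
  refine (Finset.sum_le_card_nsmul _ _ _ this).trans (le_of_eq ?_)
  rw [Finset.card_univ, Fintype.card_fin, nsmul_eq_mul]

end BoxFlowLimit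

/-! ### Moments of the total displacement in dimension at least three -/

section WeightedDeviation

variable {d : ℕ}

/-- The decay rate of the displacement per unit of deviation. -/
noncomputable def flowRate (d : ℕ) : ℝ≥0 := 2 ^ ((1 : ℝ) / d - 1)

/-- A bound for the total displacement of a point in terms of the masses of the boxes around
it. -/
noncomputable def totalDisplacement (d : ℕ) (m : ℕ → ℝ≥0∞) : ℝ≥0∞ :=
  8 * ∑' n, (flowRate d : ℝ≥0∞) ^ n * ‖(m n).toReal - 2 ^ n‖ₑ

theorem measurable_totalDisplacement : Measurable (totalDisplacement d) :=
  (Measurable.tsum fun n => by fun_prop).const_mul _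

/-- The exponent of 2 is 1/d - 1/2, negative for d ≥ 3. -/
theorem flowRate_mul_sqrt_two_lt_one (hd : 3 ≤ d) : flowRate d * NNReal.sqrt 2 < 1 := by
  rw [NNReal.sqrt_eq_rpow, flowRate, ← NNReal.rpow_add two_ne_zero]
  refine NNReal.rpow_lt_one_of_one_lt_of_neg one_lt_two ?_
  have h : (1 : ℝ) / d ≤ 1 / 3 := by
    gcongr
    exact_mod_cast hd
  linarith

variable [NeZero d]

theorem flowStep_le (b : ℕ → ℝ) (n : ℕ) :
    flowStep d b n ≤ 4 * ((flowRate d : ℝ) ^ n * |b n - 2 ^ n| +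
      (flowRate d : ℝ) ^ (n + 1) * |b (n + 1) - 2 ^ (n + 1)|) := by
  have h1 : (2 : ℝ) ^ boxDepth n (splitAxis d n) / 2 ^ n ≤ 2 * (flowRate d : ℝ) ^ n := by
    rw [div_le_iff₀ (by positivity)]
    refine (two_pow_boxDepth_le n _).trans (le_of_eq ?_)
    rw [flowRate, NNReal.coe_rpow, NNReal.coe_ofNat, ← Real.rpow_mul_natCast two_pos.le, mul_assoc,
      ← Real.rpow_natCast 2 n, ← Real.rpow_add two_pos]
    congr 2
    ring
  -- Moves the weight of the parent's deviation from level `n` to level `n + 1` at the price of a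
  -- factor 2.
  have h2 : (1 : ℝ) ≤ 2 * flowRate d := by
    rw [flowRate, NNReal.coe_rpow, NNReal.coe_ofNat, Real.rpow_sub_one two_ne_zero,
      mul_div_cancel₀ _ two_ne_zero]
    exact Real.one_le_rpow one_le_two (by positivity)
  calc flowStep d b n = 2 ^ boxDepth n (splitAxis d n) / 2 ^ n *
        (2 * |b n - 2 ^ n| + |b (n + 1) - 2 ^ (n + 1)|) := by rw [flowStep]; ring
    _ ≤ 2 * (flowRate d : ℝ) ^ n * (2 * |b n - 2 ^ n| + |b (n + 1) - 2 ^ (n + 1)|) := by gcongr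
    _ = 4 * ((flowRate d : ℝ) ^ n * |b n - 2 ^ n|) +
        2 * (flowRate d : ℝ) ^ n * |b (n + 1) - 2 ^ (n + 1)| := by ring
    _ ≤ 4 * ((flowRate d : ℝ) ^ n * |b n - 2 ^ n|) +
        2 * (flowRate d : ℝ) ^ n * |b (n + 1) - 2 ^ (n + 1)| * (2 * flowRate d) := by
        exact add_le_add le_rfl (le_mul_of_one_le_right (by positivity) h2)
    _ = _ := by ring

/-- A deviation enters the steps into and out of its level, with factor 4 each; hence the 8 in
`totalDisplacement`. -/
theorem tsum_flowStep_le (m : ℕ → ℝ≥0∞) :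
    ∑' n, ENNReal.ofReal (flowStep d (fun n => (m n).toReal) n) ≤ totalDisplacement d m := by
  set a : ℕ → ℝ≥0∞ := fun n => (flowRate d : ℝ≥0∞) ^ n * ‖(m n).toReal - 2 ^ n‖ₑ with ha
  have h1 : ∀ n, ENNReal.ofReal (flowStep d (fun n => (m n).toReal) n) ≤ 4 * (a n + a (n + 1)) := by
    intro n
    have h3 : ∀ n, a n =
        ENNReal.ofReal ((flowRate d : ℝ) ^ n * |(m n).toReal - 2 ^ n|) := fun n => by
      rw [ENNReal.ofReal_mul (by positivity), ENNReal.ofReal_pow NNReal.zero_le_coe,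
        ENNReal.ofReal_coe_nnreal, ← Real.enorm_eq_ofReal_abs]
    rw [h3, h3, ← ENNReal.ofReal_add (by positivity) (by positivity),
      ← ENNReal.ofReal_ofNat 4, ← ENNReal.ofReal_mul (by norm_num)]
    exact ENNReal.ofReal_le_ofReal (flowStep_le _ n)
  calc _ ≤ ∑' n, 4 * (a n + a (n + 1)) := ENNReal.tsum_le_tsum h1
    _ = 4 * (∑' n, a n + ∑' n, a (n + 1)) := by
        rw [ENNReal.tsum_mul_left, ENNReal.tsum_add]
    _ ≤ 4 * (∑' n, a n + ∑' n, a n) := by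
        exact mul_le_mul_right (add_le_add le_rfl
          (ENNReal.tsum_comp_le_tsum_of_injective (add_left_injective 1) a)) _
    _ = totalDisplacement d m := by
        rw [totalDisplacement, ← two_mul, ← mul_assoc, ha]
        norm_num

/-- Minkowski's inequality for series, by monotone convergence from finite sums. -/
theorem ENNReal.lintegral_rpow_tsum_le {Ω : Type*} [MeasurableSpace Ω] {P : Measure Ω}
    {g : ℕ → Ω → ℝ≥0∞} (hg : ∀ n, Measurable (g n)) {q : ℝ} (hq : 1 ≤ q) :
    (∫⁻ ω, (∑' n, g n ω) ^ q ∂P) ^ (1 / q) ≤ ∑' n, (∫⁻ ω, g n ω ^ q ∂P) ^ (1 / q) := by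
  have hq0 : 0 < q := by linarith
  have hfin : ∀ N, (∫⁻ ω, (∑ n ∈ Finset.range N, g n ω) ^ q ∂P) ^ (1 / q) ≤
      ∑ n ∈ Finset.range N, (∫⁻ ω, g n ω ^ q ∂P) ^ (1 / q) := by
    intro N
    induction N with
    | zero => simp [hq0]
    | succ N ih =>
      simp only [Finset.sum_range_succ]
      refine (ENNReal.lintegral_Lp_add_le (f := fun ω => ∑ n ∈ Finset.range N, g n ω) (g := g N)
        (by fun_prop) (by fun_prop) hq).trans ?_
      gcongr
  have h1 : ∀ ω, (∑' n, g n ω) ^ q = ⨆ N, (∑ n ∈ Finset.range N, g n ω) ^ q := fun ω => by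
    rw [ENNReal.tsum_eq_iSup_nat]
    exact (ENNReal.orderIsoRpow q hq0).map_iSup _
  simp only [h1]
  rw [lintegral_iSup (fun N => by fun_prop)]
  · have h2 := (ENNReal.orderIsoRpow (1 / q) (by positivity)).map_iSup
      fun N => ∫⁻ ω, (∑ n ∈ Finset.range N, g n ω) ^ q ∂P
    simp only [ENNReal.orderIsoRpow_apply] at h2
    rw [h2]
    exact iSup_le fun N => (hfin N).trans (ENNReal.sum_le_tsum _)
  · intro N N' hN ω
    refine ENNReal.rpow_le_rpow ?_ hq0.le
    exact Finset.sum_le_sum_of_subset (Finset.range_mono hN)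

variable {Ω : Type*} [MeasurableSpace Ω] {P : Measure Ω}
  [IsProbabilityMeasure P] {α : ℝ≥0} {γ : Measure ℝ≥0} [IsProbabilityMeasure γ]
  {mu : Kernel Ω (EuclideanSpace ℝ (Fin d))}

theorem IsCompoundPoisson.lintegral_totalDisplacement_rpow_le (hd : 3 ≤ d)
    (hmu : IsCompoundPoisson P α γ mu) (hint : HasUnitIntensity P mu) {q : ℝ} (hq : 2 < q)
    (hmom : weightMoment γ q < ∞) :
    ∃ K : ℝ≥0, ∀ k : Fin d → ℤ,
      ∫⁻ ω, totalDisplacement d (fun n => mu ω (dyadicBox n k)) ^ q ∂P ≤ K := by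
  have hq0 : 0 < q := by linarith
  obtain ⟨K, hK⟩ := hmu.lintegral_boxDeviation_rpow_le hint hq hmom
  set θ := flowRate d * NNReal.sqrt 2 with hθ
  have hθ1 : (θ : ℝ≥0∞) < 1 := by exact_mod_cast flowRate_mul_sqrt_two_lt_one hd
  have hS : (1 - (θ : ℝ≥0∞))⁻¹ ≠ ∞ := ENNReal.inv_ne_top.2 (tsub_pos_of_lt hθ1).ne'
  set C : ℝ≥0∞ := 8 ^ q * ((K : ℝ≥0∞) ^ (1 / q) * (1 - (θ : ℝ≥0∞))⁻¹) ^ q with hC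
  have hCt : C ≠ ∞ := by
    refine ENNReal.mul_ne_top (ENNReal.rpow_ne_top_of_nonneg hq0.le (by simp))
      (ENNReal.rpow_ne_top_of_nonneg hq0.le (ENNReal.mul_ne_top
        (ENNReal.rpow_ne_top_of_nonneg (by positivity) ENNReal.coe_ne_top) hS))
  refine ⟨C.toNNReal, fun k => ?_⟩
  rw [ENNReal.coe_toNNReal hCt]
  have hmeas := fun n => measurable_boxDeviation (mu := mu) n k
  have hterm : ∀ n, (∫⁻ ω, ((flowRate d : ℝ≥0∞) ^ n * ‖boxDeviation mu n k ω‖ₑ) ^ q ∂P) ^ (1 / q) ≤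
      (K : ℝ≥0∞) ^ (1 / q) * (θ : ℝ≥0∞) ^ n := by
    intro n
    have h1 : ((flowRate d : ℝ≥0∞) ^ n) ^ q ≠ ∞ :=
      ENNReal.rpow_ne_top_of_nonneg hq0.le (ENNReal.pow_ne_top ENNReal.coe_ne_top)
    simp only [ENNReal.mul_rpow_of_nonneg _ _ hq0.le]
    rw [lintegral_const_mul' _ _ h1]
    calc (((flowRate d : ℝ≥0∞) ^ n) ^ q * ∫⁻ ω, ‖boxDeviation mu n k ω‖ₑ ^ q ∂P) ^ (1 / q)
        ≤ (((flowRate d : ℝ≥0∞) ^ n) ^ q *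
          (K * ((NNReal.sqrt 2 ^ q : ℝ≥0) : ℝ≥0∞) ^ n)) ^ (1 / q) := by
          gcongr
          exact hK n k
      _ = _ := by
          have h2 : ((NNReal.sqrt 2 ^ q : ℝ≥0) : ℝ≥0∞) ^ n = ((NNReal.sqrt 2 : ℝ≥0∞) ^ n) ^ q := by
            rw [ENNReal.coe_rpow_of_nonneg _ hq0.le, ← ENNReal.rpow_natCast, ← ENNReal.rpow_natCast,
              ← ENNReal.rpow_mul, ← ENNReal.rpow_mul, mul_comm]
          rw [h2, mul_left_comm, ← ENNReal.mul_rpow_of_nonneg _ _ hq0.le, ← mul_pow,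
            ENNReal.mul_rpow_of_nonneg _ _ (by positivity), ← ENNReal.rpow_mul,
            mul_one_div_cancel hq0.ne', ENNReal.rpow_one, hθ, ENNReal.coe_mul]
  have h2 := (ENNReal.lintegral_rpow_tsum_le (P := P)
    (g := fun n ω => (flowRate d : ℝ≥0∞) ^ n * ‖boxDeviation mu n k ω‖ₑ)
    (fun n => by have := hmeas n; fun_prop) (q := q) (by linarith)).trans
      (ENNReal.tsum_le_tsum hterm)
  rw [ENNReal.tsum_mul_left, ENNReal.tsum_geometric] at h2
  have h3 := ENNReal.rpow_le_rpow h2 hq0.le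
  rw [← ENNReal.rpow_mul, one_div_mul_cancel hq0.ne', ENNReal.rpow_one] at h3
  calc ∫⁻ ω, totalDisplacement d (fun n => mu ω (dyadicBox n k)) ^ q ∂P
      = ∫⁻ ω, 8 ^ q * (∑' n, (flowRate d : ℝ≥0∞) ^ n * ‖boxDeviation mu n k ω‖ₑ) ^ q ∂P := by
        refine lintegral_congr fun ω => ?_
        rw [totalDisplacement, ENNReal.mul_rpow_of_nonneg _ _ hq0.le]
        rfl
    _ ≤ C := by
        rw [lintegral_const_mul' _ _ (ENNReal.rpow_ne_top_of_nonneg hq0.le (by simp))]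
        exact mul_le_mul_right h3 _

end WeightedDeviation

/-! ### Parts (iii) and (iv): cost of the stretching semicoupling -/

section PolynomialCost

variable {d : ℕ} [NeZero d] {Ω : Type*} [MeasurableSpace Ω]

theorem measurable_flowPoint {b : Ω → ℕ → (Fin d → ℤ) → ℝ}
    (hb : ∀ n k, Measurable fun ω => b ω n k) (k : Fin d → ℤ) (c : Fin d → ℝ) (n : ℕ) (i : Fin d) :
    Measurable fun ω => flowPoint (b ω) k c n i := by
  induction n generalizing i with
  | zero => exact measurable_const
  | succ n ih =>
    by_cases hi : i = splitAxis d n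
    · subst hi
      simp only [flowPoint_succ_splitAxis, stretchRatio]
      have := ih (splitAxis d n)
      fun_prop
    · simp only [flowPoint_succ_of_ne _ _ hi]
      exact ih i

theorem measurableSet_flowBox {b : Ω → ℕ → (Fin d → ℤ) → ℝ}
    (hb : ∀ n k, Measurable fun ω => b ω n k) (k : Fin d → ℤ) :
    MeasurableSet {p : Ω × EuclideanSpace ℝ (Fin d) | p.2 ∈ flowBox (b p.1) k} := by
  have hlim : ∀ (c : Fin d → ℝ) i, Measurable fun ω => flowLimit (b ω) k c i := fun c i =>
    measurable_const.add (Measurable.tsum fun n =>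
      (measurable_flowPoint hb k c (n + 1) i).sub (measurable_flowPoint hb k c n i))
  simp only [mem_flowBox, Set.ofPred_forall]
  refine MeasurableSet.iInter fun i => ?_
  have h1 : Measurable fun p : Ω × EuclideanSpace ℝ (Fin d) => p.2 i := by fun_prop
  exact (measurableSet_le ((hlim (fun i => k i) i).comp measurable_fst) h1).inter
    (measurableSet_lt h1 ((hlim (fun i => k i + 1) i).comp measurable_fst))

/-- Bound the product by the (p+1)-th power of the larger factor, which is at least 1. It decouples
the mass of a cell from its displacement, which are dependent. -/
theorem ENNReal.mul_rpow_le_add {x y : ℝ≥0∞} {p q : ℝ} (hp : 0 ≤ p) (hpq : p + 1 ≤ q) (hy : 1 ≤ y) :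
    x * y ^ p ≤ x ^ q + y ^ q := by
  have key : ∀ t : ℝ≥0∞, t * t ^ p = t ^ (p + 1) := fun t => by
    rw [ENNReal.rpow_add_of_nonneg _ _ hp zero_le_one, ENNReal.rpow_one, mul_comm]
  rcases le_total x y with h | h
  · refine le_trans ?_ le_add_self
    calc x * y ^ p ≤ y * y ^ p := by gcongr
      _ = y ^ (p + 1) := key y
      _ ≤ y ^ q := ENNReal.rpow_le_rpow_of_exponent_le hy hpq
  · refine le_trans ?_ le_self_add
    calc x * y ^ p ≤ x * x ^ p := by gcongr
      _ = x ^ (p + 1) := key x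
      _ ≤ x ^ q := ENNReal.rpow_le_rpow_of_exponent_le (hy.trans h) hpq

variable {P : Measure Ω} [IsProbabilityMeasure P] {α : ℝ≥0} {γ : Measure ℝ≥0}
  [IsProbabilityMeasure γ] {mu : Kernel Ω (EuclideanSpace ℝ (Fin d))}

theorem summable_flowStep_of_lt_top {m : ℕ → ℝ≥0∞} (hm : totalDisplacement d m < ∞) :
    Summable (flowStep d fun n => (m n).toReal) := by
  have h1 := ENNReal.summable_toReal ((tsum_flowStep_le m).trans_lt hm).ne
  simpa only [ENNReal.toReal_ofReal (flowStep_nonneg _ _)] using h1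

/-- The masses of the dyadic boxes. -/
noncomputable def boxMass (mu : Kernel Ω (EuclideanSpace ℝ (Fin d))) (ω : Ω) (n : ℕ)
    (k : Fin d → ℤ) : ℝ := (mu ω (dyadicBox n k)).toReal

theorem measurable_boxMass (n : ℕ) (k : Fin d → ℤ) : Measurable fun ω => boxMass mu ω n k :=
  (mu.measurable_coe (measurableSet_dyadicBox n k)).ennreal_toReal

theorem measurable_boxMasses (k : Fin d → ℤ) : Measurable fun ω n => mu ω (dyadicBox n k) :=
  measurable_pi_lambda _ fun n => mu.measurable_coe (measurableSet_dyadicBox n k)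

/-- The uniform probability density on the box into which the unit cell `k` is stretched. -/
noncomputable def flowDensity (mu : Kernel Ω (EuclideanSpace ℝ (Fin d))) (k : Fin d → ℤ) (ω : Ω) :
    EuclideanSpace ℝ (Fin d) → ℝ≥0∞ :=
  (flowBox (boxMass mu ω) k).indicator fun _ => (mu ω (dyadicBox 0 k))⁻¹

theorem measurable_flowDensity (k : Fin d → ℤ) :
    Measurable (Function.uncurry (flowDensity mu k)) := by
  have h1 : Function.uncurry (flowDensity mu k) =
      {p : Ω × EuclideanSpace ℝ (Fin d) | p.2 ∈ flowBox (boxMass mu p.1) k}.indicator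
        fun p => (mu p.1 (dyadicBox 0 k))⁻¹ := by
    ext ⟨ω, x⟩
    by_cases h : x ∈ flowBox (boxMass mu ω) k <;> simp [flowDensity, h]
  rw [h1]
  exact (((mu.measurable_coe (measurableSet_dyadicBox 0 k)).comp measurable_fst).inv).indicator
    (measurableSet_flowBox (b := boxMass mu) measurable_boxMass k)

theorem lintegral_flowDensity {ω : Ω} {k : Fin d → ℤ} (hβ : IsBoxMass (boxMass mu ω))
    (hs : Summable (flowStep d fun n => boxMass mu ω n k)) (h0 : mu ω (dyadicBox 0 k) ≠ 0)
    (h1 : mu ω (dyadicBox 0 k) < ∞) : ∫⁻ x, flowDensity mu k ω x = 1 := by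
  have hm : MeasurableSet (flowBox (boxMass mu ω) k) :=
    measurable_prodMk_left (x := ω) (measurableSet_flowBox (b := boxMass mu) measurable_boxMass k)
  have hpos : 0 < boxMass mu ω 0 k := by
    rw [boxMass]
    exact ENNReal.toReal_pos h0 h1.ne
  rw [flowDensity, lintegral_indicator_const hm, hβ.volume_flowBox hs hpos, boxMass,
    ENNReal.ofReal_toReal h1.ne, ENNReal.inv_mul_cancel h0 h1.ne]

/-- At most one limit box contains `x`, and there mass times inverse mass is at most 1, also when
the mass is 0. -/
theorem tsum_mul_flowDensity_le {ω : Ω} (hβ : IsBoxMass (boxMass mu ω))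
    (hs : ∀ k, Summable (flowStep d fun n => boxMass mu ω n k)) (x : EuclideanSpace ℝ (Fin d)) :
    ∑' k, mu ω (dyadicBox 0 k) * flowDensity mu k ω x ≤ 1 := by
  by_cases hx : ∃ k, x ∈ flowBox (boxMass mu ω) k
  · obtain ⟨k, hk⟩ := hx
    rw [tsum_eq_single k]
    · rw [flowDensity, Set.indicator_of_mem hk]
      exact ENNReal.mul_inv_le_one _
    · intro k' hk'
      rw [flowDensity, Set.indicator_of_notMem, mul_zero]
      exact fun h => Set.disjoint_left.1 (hβ.disjoint_flowBox (hs k') (hs k) hk') h hk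
  · simp only [not_exists] at hx
    simp [flowDensity, hx]

theorem lintegral_flowDensity_mul_le {ω : Ω} {k : Fin d → ℤ} (hβ : IsBoxMass (boxMass mu ω))
    (hs : Summable (flowStep d fun n => boxMass mu ω n k)) (h0 : mu ω (dyadicBox 0 k) ≠ 0)
    (h1 : mu ω (dyadicBox 0 k) < ∞) {p : ℝ} (hp : 0 ≤ p) {y : EuclideanSpace ℝ (Fin d)}
    (hy : y ∈ dyadicBox 0 k) :
    ∫⁻ x, flowDensity mu k ω x * ((nndist x y ^ p : ℝ≥0) : ℝ≥0∞) ≤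
      (d * (1 + totalDisplacement d fun n => mu ω (dyadicBox n k))) ^ p := by
  set T := (d * (1 + totalDisplacement d fun n => mu ω (dyadicBox n k)) : ℝ≥0∞) ^ p with hT
  calc _ ≤ ∫⁻ x, flowDensity mu k ω x * T := by
        refine lintegral_mono fun x => ?_
        by_cases hx : x ∈ flowBox (boxMass mu ω) k
        · refine mul_le_mul_right ?_ _
          rw [hT, ENNReal.coe_rpow_of_nonneg _ hp]
          refine ENNReal.rpow_le_rpow ?_ hp
          rw [← edist_nndist, edist_dist]
          refine (ENNReal.ofReal_le_ofReal (hβ.dist_le_of_mem_flowBox hs hx hy)).trans ?_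
          rw [ENNReal.ofReal_mul (by positivity), ENNReal.ofReal_add zero_le_one
            (tsum_nonneg fun n => flowStep_nonneg _ n), ENNReal.ofReal_natCast, ENNReal.ofReal_one,
            ENNReal.ofReal_tsum_of_nonneg (fun n => flowStep_nonneg _ n) hs]
          gcongr
          exact tsum_flowStep_le _
        · simp [flowDensity, hx]
    _ = T := by
        have hm : Measurable (flowDensity mu k ω) :=
          (measurable_flowDensity k).of_uncurry_left
        rw [lintegral_mul_const _ hm,
          lintegral_flowDensity hβ hs h0 h1, one_mul]

theorem optimalMeanCost_rpow_lt_top {G : Type*} [Group G] [MulAction G (EuclideanSpace ℝ (Fin d))]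
    (hG : IsAdmissibleAction G (EuclideanSpace ℝ (Fin d))) (hd : 3 ≤ d)
    (hmu : IsCompoundPoisson P α γ mu) (hint : HasUnitIntensity P mu) {p q : ℝ} (hp : 0 < p)
    (hq : 2 < q) (hpq : p + 1 ≤ q) (hmom : weightMoment γ q < ∞) :
    optimalMeanCost P G (fun r => r ^ p) (Kernel.const Ω volume) mu < ∞ := by
  have hq0 : 0 < q := by linarith
  obtain ⟨K, hK⟩ := hmu.lintegral_totalDisplacement_rpow_le hd hint hq hmom
  have hU1 : ∀ k : Fin d → ℤ, volume (dyadicBox 0 k) < ∞ := fun k => by simp [volume_dyadicBox]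
  have hUq := hmu.lintegral_rpow_lt_top (measurableSet_dyadicBox 0 0) (hU1 0)
    (q := q) (by linarith) hmom
  have hDm : ∀ k : Fin d → ℤ,
      Measurable fun ω => totalDisplacement d (fun n => mu ω (dyadicBox n k)) := fun k =>
    measurable_totalDisplacement.comp (measurable_boxMasses k)
  have hD : ∀ᵐ ω ∂P, ∀ k : Fin d → ℤ,
      totalDisplacement d (fun n => mu ω (dyadicBox n k)) < ∞ := by
    refine ae_all_iff.2 fun k => ?_
    filter_upwards [ae_lt_top ((hDm k).pow_const q) ((hK k).trans_lt ENNReal.coe_lt_top).ne] with ω h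
    exact (ENNReal.rpow_lt_top_iff_of_pos hq0).1 h
  have hgood : ∀ᵐ ω ∂P, IsBoxMass (boxMass mu ω) ∧
      ∀ k, Summable (flowStep d fun n => boxMass mu ω n k) := by
    filter_upwards [hint.ae_dyadicBox_lt_top, hD] with ω h1 h2
    exact ⟨isBoxMass_measure h1, fun k => summable_flowStep_of_lt_top (h2 k)⟩
  obtain ⟨z, X, hz, hX, -, -, -, hrep⟩ := id hmu
  refine optimalMeanCost_lt_top_of_density (z := z) (X := X) (f := flowDensity mu)
    (F := fun k ω => (d * (1 + totalDisplacement d (fun n => mu ω (dyadicBox n k)))) ^ p)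
    (C := ∫⁻ ω, mu ω (dyadicBox 0 (0 : Fin d → ℤ)) ^ q ∂P + d ^ q * (2 ^ (q - 1) * (1 + K)))
    hG hz.measurable hX hrep measurable_flowDensity ?_ ?_
    (NNReal.continuous_rpow_const hp.le).measurable
    (fun k => by have := hDm k; fun_prop) ?_ ?_ ?_
  · filter_upwards [hint.ae_dyadicBox_lt_top, hgood] with ω h1 h2 k h0
    exact lintegral_flowDensity h2.1 (h2.2 k) h0 (h1 0 k)
  · filter_upwards [hgood] with ω h2 x
    exact tsum_mul_flowDensity_le h2.1 h2.2 x
  · filter_upwards [hint.ae_dyadicBox_lt_top, hgood] with ω h1 h2 k h0 y hy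
    exact lintegral_flowDensity_mul_le h2.1 (h2.2 k) h0 (h1 0 k) hp.le hy
  · refine ENNReal.add_lt_top.2 ⟨hUq, ENNReal.mul_lt_top
      (ENNReal.rpow_lt_top_of_nonneg hq0.le (by simp)) (ENNReal.mul_lt_top
      (ENNReal.rpow_lt_top_of_nonneg (by linarith) (by simp)) (by simp))⟩
  · intro k B hB hBk
    rw [mul_comm _ (volume B)]
    have h1 := hmu.lintegral_mass_mul_boxMasses hB hBk
      (F := fun m => (d * (1 + totalDisplacement d m)) ^ p)
      (by have := measurable_totalDisplacement (d := d); fun_prop)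
    rw [h1]
    gcongr
    have hd1 : (1 : ℝ≥0∞) ≤ d := by exact_mod_cast (by omega : 1 ≤ d)
    calc ∫⁻ ω, mu ω (dyadicBox 0 k) *
          (d * (1 + totalDisplacement d fun n => mu ω (dyadicBox n k))) ^ p ∂P
        ≤ ∫⁻ ω, (mu ω (dyadicBox 0 k) ^ q + d ^ q * (2 ^ (q - 1) *
            (1 + totalDisplacement d (fun n => mu ω (dyadicBox n k)) ^ q))) ∂P := by
          refine lintegral_mono fun ω => ?_
          refine (ENNReal.mul_rpow_le_add hp.le hpq
            (one_le_mul hd1 le_self_add)).trans ?_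
          rw [ENNReal.mul_rpow_of_nonneg _ _ hq0.le]
          gcongr
          simpa using ENNReal.rpow_add_le_mul_rpow_add_rpow 1
            (totalDisplacement d fun n => mu ω (dyadicBox n k)) (p := q) (by linarith)
      _ = ∫⁻ ω, mu ω (dyadicBox 0 k) ^ q ∂P + d ^ q * (2 ^ (q - 1) *
            (1 + ∫⁻ ω, totalDisplacement d (fun n => mu ω (dyadicBox n k)) ^ q ∂P)) := by
          rw [lintegral_add_left ((mu.measurable_coe (measurableSet_dyadicBox 0 k)).pow_const q),
            lintegral_const_mul' _ _ (ENNReal.rpow_ne_top_of_nonneg hq0.le (by simp)),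
            lintegral_const_mul' _ _ (ENNReal.rpow_ne_top_of_nonneg (by linarith) (by simp)),
            lintegral_add_left measurable_const]
          simp
      _ ≤ _ := by
          rw [hmu.lintegral_comp_eq (measurableSet_dyadicBox 0 0) (measurableSet_dyadicBox 0 k)
            (hU1 0) (by rw [volume_dyadicBox, volume_dyadicBox]) (g := fun t => t ^ q)
            (by fun_prop)]
          gcongr
          exact hK k

end PolynomialCost

/-! ### Bookkeeping for the greedy matching -/

section Survival

/-- The fraction that remains after, for each `i < n`, the amount `A i` has been matched as far as
possible with the amount `B i`. -/
noncomputable def survival (A B : ℕ → ℝ≥0) : ℕ → ℝ≥0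
  | 0 => 1
  | n + 1 => survival A B n * ((A n - B n) / A n)

variable {A B : ℕ → ℝ≥0}

theorem survival_succ_le (n : ℕ) : survival A B (n + 1) ≤ survival A B n :=
  mul_le_of_le_one_right' (div_le_one_of_le₀ tsub_le_self zero_le)

/-- The matched fraction min(A, B) / A is written as B / max(A, B): the denominator is symmetric in
demand and supply, so one density serves both marginals. -/
theorem survival_succ_add {n : ℕ} (h : A n = 0 → survival A B n = 0) :
    survival A B (n + 1) + survival A B n * (B n / max (A n) (B n)) = survival A B n := by
  rw [survival, ← mul_add]
  rcases eq_or_ne (A n) 0 with h0 | h0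
  · rw [h h0, zero_mul]
  rcases le_total (B n) (A n) with hle | hle
  · rw [max_eq_left hle, ← add_div, tsub_add_cancel_of_le hle, div_self h0, mul_one]
  · have hB : B n ≠ 0 := fun hB => h0 (by simpa [hB] using hle)
    rw [max_eq_right hle, tsub_eq_zero_of_le hle, zero_div, zero_add, div_self hB, mul_one]

theorem sum_survival_add (h : ∀ n, A n = 0 → survival A B n = 0) (N : ℕ) :
    ∑ n ∈ Finset.range N, survival A B n * (B n / max (A n) (B n)) + survival A B N = 1 := by
  induction N with
  | zero => simp [survival]
  | succ N ih => rw [Finset.sum_range_succ, add_assoc, add_comm (survival A B N * _),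
      survival_succ_add (h N), ih]

/-- The mass to be matched in a box of level `n`, given the masses `m` of the boxes of level at most
`n` around a cell. -/
noncomputable def boxDemand (m : ℕ → ℝ≥0) : ℕ → ℝ≥0
  | 0 => m 0
  | n + 1 => (m n - 2 ^ n) + (m (n + 1) - m n - 2 ^ n)

/-- The volume available in a box of level `n`. -/
noncomputable def boxSupply (m : ℕ → ℝ≥0) : ℕ → ℝ≥0
  | 0 => 1
  | n + 1 => (2 ^ n - m n) + (2 ^ n - (m (n + 1) - m n))

variable {m : ℕ → ℝ≥0}

/-- Demand minus supply is mass minus volume, since the matching removes equal amounts of both.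
Hence exactly the excess, or the deficit, of a box is left over. -/
theorem boxDemand_add (hm : Monotone m) (n : ℕ) :
    boxDemand m n + 2 ^ n = boxSupply m n + m n := by
  cases n with
  | zero => rw [boxDemand, boxSupply, pow_zero, add_comm]
  | succ n =>
    have key : ∀ a b : ℝ≥0, a - b + b = b - a + a := fun a b => by
      rw [tsub_add_eq_max, tsub_add_eq_max, max_comm]
    have h1 := key (m n) (2 ^ n)
    have h2 := key (m (n + 1) - m n) (2 ^ n)
    have h3 : m (n + 1) = m n + (m (n + 1) - m n) := (add_tsub_cancel_of_le (hm n.le_succ)).symm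
    rw [boxDemand, boxSupply]
    calc (m n - 2 ^ n) + (m (n + 1) - m n - 2 ^ n) + 2 ^ (n + 1)
        = ((m n - 2 ^ n) + 2 ^ n) + ((m (n + 1) - m n - 2 ^ n) + 2 ^ n) := by ring
      _ = ((2 ^ n - m n) + (2 ^ n - (m (n + 1) - m n))) + (m n + (m (n + 1) - m n)) := by
        rw [h1, h2]
        ring
      _ = _ := by rw [← h3]

theorem boxDemand_sub_boxSupply (hm : Monotone m) (n : ℕ) :
    boxDemand m n - boxSupply m n = m n - 2 ^ n := by
  rw [← add_tsub_add_eq_tsub_right _ (2 ^ n), boxDemand_add hm, add_tsub_add_eq_tsub_left]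

theorem boxSupply_sub_boxDemand (hm : Monotone m) (n : ℕ) :
    boxSupply m n - boxDemand m n = 2 ^ n - m n := by
  rw [← add_tsub_add_eq_tsub_right _ (2 ^ n), boxDemand_add hm, add_tsub_add_eq_tsub_left]

/-- No demand at level n + 1 means no excess in the half containing the cell, so its last factor
vanished. This makes the divisions by zero demand harmless. -/
theorem survival_eq_zero_of_boxDemand (hm : Monotone m) (h0 : m 0 ≠ 0) (n : ℕ)
    (h : boxDemand m n = 0) : survival (boxDemand m) (boxSupply m) n = 0 := by
  cases n with
  | zero => exact absurd h h0
  | succ n =>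
    rw [boxDemand, add_eq_zero] at h
    rw [survival, boxDemand_sub_boxSupply hm, h.1, zero_div, mul_zero]

theorem survival_eq_zero_of_boxSupply (hm : Monotone m) (n : ℕ)
    (h : boxSupply m n = 0) : survival (boxSupply m) (boxDemand m) n = 0 := by
  cases n with
  | zero => exact absurd h one_ne_zero
  | succ n =>
    rw [boxSupply, add_eq_zero] at h
    rw [survival, boxSupply_sub_boxDemand hm, h.1, zero_div, mul_zero]

theorem measurable_boxDemand (n : ℕ) : Measurable fun m : ℕ → ℝ≥0 => boxDemand m n := by
  cases n <;> simp only [boxDemand] <;> fun_prop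

theorem measurable_boxSupply (n : ℕ) : Measurable fun m : ℕ → ℝ≥0 => boxSupply m n := by
  cases n <;> simp only [boxSupply] <;> fun_prop

theorem measurable_survival {S : Type*} [MeasurableSpace S] {A B : S → ℕ → ℝ≥0}
    (hA : ∀ n, Measurable fun s => A s n) (hB : ∀ n, Measurable fun s => B s n) (n : ℕ) :
    Measurable fun s => survival (A s) (B s) n := by
  induction n with
  | zero => exact measurable_const
  | succ n ih =>
    simp only [survival]
    exact ih.mul (((hA n).sub (hB n)).div (hA n))

end Survival

/-! ### The nested matching inside dyadic boxes -/

section NestedMatching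

variable {d : ℕ} [NeZero d]

theorem tsum_measure_mul_eq_lintegral (μ : Measure (EuclideanSpace ℝ (Fin d)))
    (g : (Fin d → ℤ) → ℝ≥0∞) :
    ∑' k, μ (dyadicBox 0 k) * g k = ∫⁻ x, g (unitCell x) ∂μ := by
  rw [← lintegral_map (f := g) (by fun_prop) measurable_unitCell, lintegral_countable']
  refine tsum_congr fun k => ?_
  rw [Measure.map_apply measurable_unitCell (measurableSet_singleton k), mul_comm]
  congr 2
  ext x
  exact mem_dyadicBox_zero

/-- Each half of a box keeps `A - B` after matching, and `hsucc` adds the halves up. It is used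
twice: for the random mass, and for volume with the roles of demand and supply exchanged. -/
theorem setLIntegral_survival {ν : Measure (EuclideanSpace ℝ (Fin d))}
    {A B : (Fin d → ℤ) → ℕ → ℝ≥0} (h0 : ∀ k, ν (dyadicBox 0 k) = A k 0)
    (hsucc : ∀ k n, A k (n + 1) =
      (A k n - B k n) + (A (siblingCell n k) n - B (siblingCell n k) n))
    (hA : ∀ n k k', boxIndex n k = boxIndex n k' → A k n = A k' n)
    (hB : ∀ n k k', boxIndex n k = boxIndex n k' → B k n = B k' n) (n : ℕ) (k : Fin d → ℤ) :
    ∫⁻ x in dyadicBox n k, (survival (A (unitCell x)) (B (unitCell x)) n : ℝ≥0∞) ∂ν = A k n := by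
  induction n generalizing k with
  | zero => simp [survival, h0]
  | succ n ih =>
    have hhalf : ∀ k, ∫⁻ x in dyadicBox n k,
        (survival (A (unitCell x)) (B (unitCell x)) (n + 1) : ℝ≥0∞) ∂ν =
        ((A k n - B k n : ℝ≥0) : ℝ≥0∞) := by
      intro k
      calc _ = ∫⁻ x in dyadicBox n k, (survival (A (unitCell x)) (B (unitCell x)) n : ℝ≥0∞) *
            ((A k n - B k n) / A k n : ℝ≥0) ∂ν := by
            refine setLIntegral_congr_fun (measurableSet_dyadicBox n k) fun x hx => ?_
            simp only [survival, hA n _ k hx, hB n _ k hx, ENNReal.coe_mul]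
        _ = ((A k n * ((A k n - B k n) / A k n) : ℝ≥0) : ℝ≥0∞) := by
            rw [lintegral_mul_const' _ _ ENNReal.coe_ne_top, ih, ENNReal.coe_mul]
        _ = _ := by
            rcases eq_or_ne (A k n) 0 with h | h
            · simp [h]
            · rw [mul_div_cancel₀ _ h]
    rw [dyadicBox_succ, lintegral_union (measurableSet_dyadicBox _ _)
      (disjoint_dyadicBox_sibling n k), hhalf, hhalf, hsucc, ENNReal.coe_add]

/-- The masses of the boxes around a cell. -/
noncomputable def cellMasses (μ : Measure (EuclideanSpace ℝ (Fin d))) (k : Fin d → ℤ) (n : ℕ) :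
    ℝ≥0 := (μ (dyadicBox n k)).toNNReal

variable {μ : Measure (EuclideanSpace ℝ (Fin d))}

theorem monotone_cellMasses (hμ : ∀ n (k : Fin d → ℤ), μ (dyadicBox n k) < ∞) (k : Fin d → ℤ) :
    Monotone (cellMasses μ k) := fun _ n h =>
  ENNReal.toNNReal_mono (hμ n k).ne (measure_mono (dyadicBox_mono k h))

theorem cellMasses_succ (hμ : ∀ n (k : Fin d → ℤ), μ (dyadicBox n k) < ∞) (k : Fin d → ℤ) (n : ℕ) :
    cellMasses μ k (n + 1) = cellMasses μ k n + cellMasses μ (siblingCell n k) n := by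
  rw [cellMasses, measure_dyadicBox_succ, ENNReal.toNNReal_add (hμ _ _).ne (hμ _ _).ne]
  rfl

theorem cellMasses_congr {n : ℕ} {k k' : Fin d → ℤ} (h : boxIndex n k = boxIndex n k') :
    cellMasses μ k n = cellMasses μ k' n := by
  simp only [cellMasses, dyadicBox, h]

theorem boxDemand_cellMasses_succ (hμ : ∀ n (k : Fin d → ℤ), μ (dyadicBox n k) < ∞)
    (k : Fin d → ℤ) (n : ℕ) : boxDemand (cellMasses μ k) (n + 1) =
      (cellMasses μ k n - 2 ^ n) + (cellMasses μ (siblingCell n k) n - 2 ^ n) := by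
  rw [boxDemand, cellMasses_succ hμ, add_tsub_cancel_left]

theorem boxSupply_cellMasses_succ (hμ : ∀ n (k : Fin d → ℤ), μ (dyadicBox n k) < ∞)
    (k : Fin d → ℤ) (n : ℕ) : boxSupply (cellMasses μ k) (n + 1) =
      (2 ^ n - cellMasses μ k n) + (2 ^ n - cellMasses μ (siblingCell n k) n) := by
  rw [boxSupply, cellMasses_succ hμ, add_tsub_cancel_left]

theorem add_sibling_congr {f : (Fin d → ℤ) → ℝ≥0} {n : ℕ}
    (hf : ∀ k k', boxIndex n k = boxIndex n k' → f k = f k') {k k' : Fin d → ℤ}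
    (h : boxIndex (n + 1) k = boxIndex (n + 1) k') :
    f k + f (siblingCell n k) = f k' + f (siblingCell n k') := by
  have h1 : boxIndex (n + 1) (siblingCell n k) = boxIndex (n + 1) k' :=
    (boxIndex_succ_eq_iff.2 (Or.inr rfl)).trans h
  have hne := boxIndex_siblingCell_ne n k
  rcases boxIndex_succ_eq_iff.1 h with h2 | h2 <;> rcases boxIndex_succ_eq_iff.1 h1 with h3 | h3
  · exact absurd (h3.trans h2.symm) hne
  · rw [hf _ _ h2, hf _ _ h3]
  · rw [hf _ _ h2, hf _ _ h3, add_comm]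
  · exact absurd (h3.trans h2.symm) hne

theorem boxDemand_congr (hμ : ∀ n (k : Fin d → ℤ), μ (dyadicBox n k) < ∞) (n : ℕ)
    (k k' : Fin d → ℤ) (h : boxIndex n k = boxIndex n k') :
    boxDemand (cellMasses μ k) n = boxDemand (cellMasses μ k') n := by
  cases n with
  | zero => exact cellMasses_congr h
  | succ n =>
    rw [boxDemand_cellMasses_succ hμ, boxDemand_cellMasses_succ hμ]
    exact add_sibling_congr (f := fun k => cellMasses μ k n - 2 ^ n)
      (fun k k' h => by rw [cellMasses_congr h]) h

theorem boxSupply_congr (hμ : ∀ n (k : Fin d → ℤ), μ (dyadicBox n k) < ∞) (n : ℕ)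
    (k k' : Fin d → ℤ) (h : boxIndex n k = boxIndex n k') :
    boxSupply (cellMasses μ k) n = boxSupply (cellMasses μ k') n := by
  cases n with
  | zero => rfl
  | succ n =>
    rw [boxSupply_cellMasses_succ hμ, boxSupply_cellMasses_succ hμ]
    exact add_sibling_congr (f := fun k => 2 ^ n - cellMasses μ k n)
      (fun k k' h => by rw [cellMasses_congr h]) h

/-- The fraction of the mass in the unit cell `k` that is not matched inside boxes of level less
than `n`. -/
noncomputable def remainingDemand (μ : Measure (EuclideanSpace ℝ (Fin d))) (k : Fin d → ℤ) :
    ℕ → ℝ≥0 :=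
  survival (boxDemand (cellMasses μ k)) (boxSupply (cellMasses μ k))

/-- The fraction of the volume of the unit cell `k` that is not matched inside boxes of level less
than `n`. -/
noncomputable def remainingSupply (μ : Measure (EuclideanSpace ℝ (Fin d))) (k : Fin d → ℤ) :
    ℕ → ℝ≥0 :=
  survival (boxSupply (cellMasses μ k)) (boxDemand (cellMasses μ k))

theorem setLIntegral_remainingDemand (hμ : ∀ n (k : Fin d → ℤ), μ (dyadicBox n k) < ∞) (n : ℕ)
    (k : Fin d → ℤ) : ∫⁻ x in dyadicBox n k, (remainingDemand μ (unitCell x) n : ℝ≥0∞) ∂μ =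
      boxDemand (cellMasses μ k) n := by
  refine setLIntegral_survival (A := fun k => boxDemand (cellMasses μ k))
    (B := fun k => boxSupply (cellMasses μ k))
    (fun k => (ENNReal.coe_toNNReal (hμ 0 k).ne).symm) (fun k n => ?_) (boxDemand_congr hμ)
    (boxSupply_congr hμ) n k
  rw [boxDemand_cellMasses_succ hμ, boxDemand_sub_boxSupply (monotone_cellMasses hμ _),
    boxDemand_sub_boxSupply (monotone_cellMasses hμ _)]

theorem setLIntegral_remainingSupply (hμ : ∀ n (k : Fin d → ℤ), μ (dyadicBox n k) < ∞) (n : ℕ)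
    (k : Fin d → ℤ) : ∫⁻ x in dyadicBox n k, (remainingSupply μ (unitCell x) n : ℝ≥0∞) =
      boxSupply (cellMasses μ k) n := by
  refine setLIntegral_survival (A := fun k => boxSupply (cellMasses μ k))
    (B := fun k => boxDemand (cellMasses μ k))
    (fun k => by simp [volume_dyadicBox, boxSupply]) (fun k n => ?_) (boxSupply_congr hμ)
    (boxDemand_congr hμ) n k
  rw [boxSupply_cellMasses_succ hμ, boxSupply_sub_boxDemand (monotone_cellMasses hμ _),
    boxSupply_sub_boxDemand (monotone_cellMasses hμ _)]

/-- The density, at the points of the unit cell `k'`, of the distribution over the available volume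
of that part of the mass in the unit cell `k` which is matched inside the box of level `n`. -/
noncomputable def levelDensity (μ : Measure (EuclideanSpace ℝ (Fin d))) (n : ℕ)
    (k k' : Fin d → ℤ) : ℝ≥0∞ :=
  if boxIndex n k' = boxIndex n k then ((remainingDemand μ k n * (remainingSupply μ k' n /
    max (boxDemand (cellMasses μ k) n) (boxSupply (cellMasses μ k) n)) : ℝ≥0) : ℝ≥0∞) else 0

theorem lintegral_levelDensity (hμ : ∀ n (k : Fin d → ℤ), μ (dyadicBox n k) < ∞) (n : ℕ)
    (k : Fin d → ℤ) : ∫⁻ x, levelDensity μ n k (unitCell x) =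
      ((remainingDemand μ k n * (boxSupply (cellMasses μ k) n /
        max (boxDemand (cellMasses μ k) n) (boxSupply (cellMasses μ k) n)) : ℝ≥0) : ℝ≥0∞) := by
  set c := max (boxDemand (cellMasses μ k) n) (boxSupply (cellMasses μ k) n)
  have h1 : ∀ x, levelDensity μ n k (unitCell x) = (dyadicBox n k).indicator
      (fun x => ((remainingDemand μ k n / c : ℝ≥0) : ℝ≥0∞) *
        (remainingSupply μ (unitCell x) n : ℝ≥0∞)) x := by
    intro x
    by_cases hx : x ∈ dyadicBox n k
    · rw [Set.indicator_of_mem hx, levelDensity, if_pos (by exact hx), ← ENNReal.coe_mul]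
      congr 1
      ring
    · rw [Set.indicator_of_notMem hx, levelDensity, if_neg (by exact hx)]
  simp only [h1]
  rw [lintegral_indicator (measurableSet_dyadicBox n k), lintegral_const_mul' _ _
    ENNReal.coe_ne_top, setLIntegral_remainingSupply hμ, ← ENNReal.coe_mul]
  congr 1
  ring

theorem tsum_measure_mul_levelDensity (hμ : ∀ n (k : Fin d → ℤ), μ (dyadicBox n k) < ∞) (n : ℕ)
    (k' : Fin d → ℤ) : ∑' k, μ (dyadicBox 0 k) * levelDensity μ n k k' =
      ((remainingSupply μ k' n * (boxDemand (cellMasses μ k') n /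
        max (boxSupply (cellMasses μ k') n) (boxDemand (cellMasses μ k') n)) : ℝ≥0) : ℝ≥0∞) := by
  rw [tsum_measure_mul_eq_lintegral]
  set c := max (boxSupply (cellMasses μ k') n) (boxDemand (cellMasses μ k') n) with hc
  have h1 : ∀ y, levelDensity μ n (unitCell y) k' = (dyadicBox n k').indicator
      (fun y => ((remainingSupply μ k' n / c : ℝ≥0) : ℝ≥0∞) *
        (remainingDemand μ (unitCell y) n : ℝ≥0∞)) y := by
    intro y
    by_cases hy : y ∈ dyadicBox n k'
    · have hy' : boxIndex n (unitCell y) = boxIndex n k' := hy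
      rw [Set.indicator_of_mem hy, levelDensity, if_pos hy'.symm, ← ENNReal.coe_mul,
        boxDemand_congr hμ n _ _ hy', boxSupply_congr hμ n _ _ hy', max_comm, ← hc]
      congr 1
      ring
    · rw [Set.indicator_of_notMem hy, levelDensity, if_neg fun h => hy (by exact h.symm)]
  simp only [h1]
  rw [lintegral_indicator (measurableSet_dyadicBox n k'), lintegral_const_mul' _ _
    ENNReal.coe_ne_top, setLIntegral_remainingDemand hμ, ← ENNReal.coe_mul]
  congr 1
  ring

/-- The fractions matched below level N and the surviving fraction add up to 1, and the latter tends
to 0. -/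
theorem lintegral_tsum_levelDensity (hμ : ∀ n (k : Fin d → ℤ), μ (dyadicBox n k) < ∞)
    {k : Fin d → ℤ} (h0 : μ (dyadicBox 0 k) ≠ 0)
    (hlim : Tendsto (remainingDemand μ k) atTop (𝓝 0)) :
    ∫⁻ x, ∑' n, levelDensity μ n k (unitCell x) = 1 := by
  have hm : ∀ n, Measurable fun x => levelDensity μ n k (unitCell x) := fun n =>
    (measurable_of_countable (levelDensity μ n k)).comp measurable_unitCell
  rw [lintegral_tsum fun n => (hm n).aemeasurable]
  simp only [lintegral_levelDensity hμ]
  have hm0 : cellMasses μ k 0 ≠ 0 := by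
    rw [cellMasses, Ne, ENNReal.toNNReal_eq_zero_iff, not_or]
    exact ⟨h0, (hμ 0 k).ne⟩
  have h1 := sum_survival_add (survival_eq_zero_of_boxDemand (monotone_cellMasses hμ k) hm0)
  have h2 := (ENNReal.tendsto_nat_tsum fun n => ((remainingDemand μ k n *
    (boxSupply (cellMasses μ k) n / max (boxDemand (cellMasses μ k) n)
      (boxSupply (cellMasses μ k) n)) : ℝ≥0) : ℝ≥0∞)).add (ENNReal.tendsto_coe.2 hlim)
  rw [ENNReal.coe_zero, add_zero] at h2
  refine tendsto_nhds_unique h2 (tendsto_const_nhds.congr fun N => ?_)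
  rw [← ENNReal.ofNNReal_finsetSum, ← ENNReal.coe_add, remainingDemand, h1, ENNReal.coe_one]

theorem tsum_measure_mul_tsum_levelDensity_le
    (hμ : ∀ n (k : Fin d → ℤ), μ (dyadicBox n k) < ∞) (k' : Fin d → ℤ) :
    ∑' k, μ (dyadicBox 0 k) * ∑' n, levelDensity μ n k k' ≤ 1 := by
  simp only [← ENNReal.tsum_mul_left]
  rw [ENNReal.tsum_comm]
  simp only [tsum_measure_mul_levelDensity hμ]
  rw [ENNReal.tsum_eq_iSup_nat]
  refine iSup_le fun N => ?_
  rw [← ENNReal.ofNNReal_finsetSum, ← ENNReal.coe_one, ENNReal.coe_le_coe,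
    ← sum_survival_add (survival_eq_zero_of_boxSupply (monotone_cellMasses hμ k')) N]
  exact le_self_add

end NestedMatching

/-! ### Part (ii): cost of the nested matching -/

section ConcaveCost

theorem ConcaveOn.monotoneOn_Ici_of_nonneg {g : ℝ → ℝ} {a : ℝ} (hg : ConcaveOn ℝ (Set.Ici a) g)
    (hpos : ∀ r, a ≤ r → 0 ≤ g r) : MonotoneOn g (Set.Ici a) := by
  intro x hx y hy hxy
  rcases hxy.eq_or_lt with rfl | hlt
  · exact le_rfl
  by_contra! h
  set s := (g y - g x) / (y - x) with hs
  have hs0 : s < 0 := div_neg_of_neg_of_pos (sub_neg.2 h) (sub_pos.2 hlt)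
  have hgy := hpos y hy
  -- At distance `δ` beyond `y`, the line of negative slope `s`, which bounds `g` from above there,
  -- has reached -1.
  set δ := (g y + 1) / (-s) with hδ
  have hδ0 : 0 < δ := div_pos (by linarith) (by linarith)
  have hz : y < y + δ := by linarith
  have h1 := hg.slope_anti_adjacent hx (le_trans hy hz.le) hlt hz
  rw [← hs, add_sub_cancel_left, div_le_iff₀ hδ0] at h1
  have h2 : s * δ = -(g y + 1) := by
    rw [hδ, div_neg, mul_neg, mul_div_cancel₀ _ hs0.ne]
  have h3 := hpos (y + δ) (le_trans hy hz.le)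
  linarith

variable {d : ℕ}

/-- A bound for the diameter of the boxes of level `n`. -/
noncomputable def boxDiameter (d n : ℕ) : ℝ≥0 := 2 * d * 2 ^ ((n : ℝ) / d)

theorem boxDiameter_succ (n : ℕ) :
    boxDiameter d (n + 1) = boxDiameter d n * 2 ^ ((1 : ℝ) / d) := by
  rw [boxDiameter, boxDiameter, mul_assoc _ _ (2 ^ ((1 : ℝ) / d)), ← NNReal.rpow_add two_ne_zero]
  push_cast
  rw [add_div]

variable [NeZero d]

theorem one_lt_boxDiameter (n : ℕ) : 1 < boxDiameter d n := by
  have h1 : (1 : ℝ≥0) ≤ d := by exact_mod_cast NeZero.one_le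
  have h2 : (1 : ℝ≥0) ≤ 2 ^ ((n : ℝ) / d) := NNReal.one_le_rpow one_le_two (by positivity)
  calc (1 : ℝ≥0) < 2 * 1 * 1 := by norm_num
    _ ≤ boxDiameter d n := by
        rw [boxDiameter]
        gcongr

theorem boxDiameter_rpow (n : ℕ) : (boxDiameter d n : ℝ) ^ ((d : ℝ) / 2) =
    (2 * d) ^ ((d : ℝ) / 2) * Real.sqrt 2 ^ n := by
  have hd : (d : ℝ) ≠ 0 := Nat.cast_ne_zero.2 (NeZero.ne d)
  rw [boxDiameter]
  push_cast
  rw [Real.mul_rpow (by positivity) (by positivity), ← Real.rpow_mul two_pos.le,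
    Real.sqrt_eq_rpow, ← Real.rpow_mul_natCast two_pos.le]
  congr 2
  field_simp

theorem tsum_ofReal_boxDiameter_lt_top {g : ℝ → ℝ} (hg : ConcaveOn ℝ (Set.Ici 1) g)
    (hpos : ∀ r, 1 ≤ r → 0 ≤ g r)
    (hint : IntegrableOn (fun r : ℝ => g r / r ^ (1 + (d : ℝ) / 2)) (Set.Ioi 1)) :
    ∑' n, ENNReal.ofReal (g (boxDiameter d n)) * (((NNReal.sqrt 2)⁻¹ : ℝ≥0) : ℝ≥0∞) ^ n < ∞ := by
  have hmono := hg.monotoneOn_Ici_of_nonneg hpos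
  set s : ℝ := 1 + (d : ℝ) / 2 with hs
  set t : ℝ := 2 ^ ((1 : ℝ) / d) with ht
  have hd0 : (0 : ℝ) < d := Nat.cast_pos.2 (Nat.pos_of_neZero d)
  have ht1 : 1 < t := Real.one_lt_rpow one_lt_two (by positivity)
  set r : ℕ → ℝ := fun n => boxDiameter d n with hr
  have hr1 : ∀ n, 1 < r n := fun n => by exact_mod_cast one_lt_boxDiameter (d := d) n
  have hrs : ∀ n, r (n + 1) = r n * t := fun n => by
    simp only [hr]
    rw [boxDiameter_succ]
    push_cast
    rfl
  have hrm : Monotone r := monotone_nat_of_le_succ fun n => by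
    rw [hrs]
    exact le_mul_of_one_le_right (by linarith [hr1 n]) ht1.le
  -- On the interval from `r n` to `t * r n`, of length `(t - 1) * r n`, the integrand is at least
  -- g(r_n) / (t r_n)^s, and r_n^s = r_n (2d)^(d/2) √2^n.
  set κ : ℝ := (t - 1) / (t ^ s * (2 * d) ^ ((d : ℝ) / 2)) with hκ
  have hκ0 : 0 < κ := div_pos (by linarith) (by positivity)
  have hterm : ∀ n, ENNReal.ofReal κ * (ENNReal.ofReal (g (r n)) *
      (((NNReal.sqrt 2)⁻¹ : ℝ≥0) : ℝ≥0∞) ^ n) ≤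
      ∫⁻ x in Set.Ico (r n) (r (n + 1)), ENNReal.ofReal (g x / x ^ s) := by
    intro n
    have hrn : 0 < r n := by linarith [hr1 n]
    have hrn' : 0 < r (n + 1) := by linarith [hr1 (n + 1)]
    have hgr := hpos _ (hr1 n).le
    have h1 : ∀ x ∈ Set.Ico (r n) (r (n + 1)), ENNReal.ofReal (g (r n) / r (n + 1) ^ s) ≤
        ENNReal.ofReal (g x / x ^ s) := by
      intro x hx
      have hx0 : 0 < x := hrn.trans_le hx.1
      have h1x : 1 ≤ x := (hr1 n).le.trans hx.1
      refine ENNReal.ofReal_le_ofReal (div_le_div₀ (hpos x h1x)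
        (hmono (hr1 n).le h1x hx.1) (by positivity) ?_)
      exact Real.rpow_le_rpow hx0.le hx.2.le (by positivity)
    refine le_trans (le_of_eq ?_) (setLIntegral_mono' measurableSet_Ico h1)
    rw [setLIntegral_const, Real.volume_Ico]
    have h2 : (((NNReal.sqrt 2)⁻¹ : ℝ≥0) : ℝ≥0∞) ^ n = ENNReal.ofReal ((Real.sqrt 2)⁻¹ ^ n) := by
      rw [ENNReal.ofReal_pow (by positivity), ← ENNReal.ofReal_coe_nnreal]
      simp
    rw [h2, ← ENNReal.ofReal_mul hgr, ← ENNReal.ofReal_mul hκ0.le,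
      ← ENNReal.ofReal_mul (by positivity)]
    congr 1
    have h3 : r n ^ s = r n * ((2 * d) ^ ((d : ℝ) / 2) * Real.sqrt 2 ^ n) := by
      rw [hs, Real.rpow_add hrn, Real.rpow_one, ← boxDiameter_rpow]
    rw [hrs, Real.mul_rpow hrn.le (by positivity), h3, hκ, inv_pow]
    field_simp
  have hall : ∑' n, ∫⁻ x in Set.Ico (r n) (r (n + 1)), ENNReal.ofReal (g x / x ^ s) ≤
      ∫⁻ x in Set.Ioi 1, ENNReal.ofReal (g x / x ^ s) := by
    have hdisj : Pairwise (Function.onFun Disjoint fun n => Set.Ico (r n) (r (n + 1))) :=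
      hrm.pairwise_disjoint_on_Ico_succ
    rw [← lintegral_iUnion (fun n => measurableSet_Ico) hdisj]
    exact lintegral_mono_set (Set.iUnion_subset fun n x hx => (hr1 n).trans_le hx.1)
  have h1 := ((ENNReal.tsum_le_tsum hterm).trans hall).trans_lt hint.lintegral_lt_top
  rw [ENNReal.tsum_mul_left] at h1
  exact ENNReal.lt_top_of_mul_ne_top_right h1.ne (ENNReal.ofReal_pos.2 hκ0).ne'

variable {Ω : Type*} [MeasurableSpace Ω] {mu : Kernel Ω (EuclideanSpace ℝ (Fin d))}

theorem measurable_survival_toNNReal (n : ℕ) : Measurable fun m : ℕ → ℝ≥0∞ =>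
    survival (boxDemand fun n => (m n).toNNReal) (boxSupply fun n => (m n).toNNReal) n := by
  have h : Measurable fun (m : ℕ → ℝ≥0∞) n => (m n).toNNReal := by fun_prop
  exact measurable_survival (fun n => (measurable_boxDemand n).comp h)
    (fun n => (measurable_boxSupply n).comp h) n

theorem measurable_cellMasses (k : Fin d → ℤ) :
    Measurable fun ω => cellMasses (mu ω) k :=
  measurable_pi_lambda _ fun n =>
    (mu.measurable_coe (measurableSet_dyadicBox n k)).ennreal_toNNReal

theorem measurable_remainingDemand (k : Fin d → ℤ) (n : ℕ) :
    Measurable fun ω => remainingDemand (mu ω) k n :=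
  measurable_survival (fun n => (measurable_boxDemand n).comp (measurable_cellMasses k))
    (fun n => (measurable_boxSupply n).comp (measurable_cellMasses k)) n

theorem measurable_remainingSupply (k : Fin d → ℤ) (n : ℕ) :
    Measurable fun ω => remainingSupply (mu ω) k n :=
  measurable_survival (fun n => (measurable_boxSupply n).comp (measurable_cellMasses k))
    (fun n => (measurable_boxDemand n).comp (measurable_cellMasses k)) n

theorem measurable_levelDensity (n : ℕ) (k : Fin d → ℤ) : Measurable (Function.uncurry
    fun ω (x : EuclideanSpace ℝ (Fin d)) => levelDensity (mu ω) n k (unitCell x)) := by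
  have h1 : ∀ k', Measurable fun ω => levelDensity (mu ω) n k k' := by
    intro k'
    simp only [levelDensity]
    split_ifs
    · exact ((measurable_remainingDemand k n).mul ((measurable_remainingSupply k' n).div
        (((measurable_boxDemand n).comp (measurable_cellMasses k)).max
          ((measurable_boxSupply n).comp (measurable_cellMasses k))))).coe_nnreal_ennreal
    · exact measurable_const
  have h2 : Measurable fun p : Ω × (Fin d → ℤ) => levelDensity (mu p.1) n k p.2 :=
    measurable_from_prod_countable_left h1
  exact h2.comp (measurable_fst.prodMk (measurable_unitCell.comp measurable_snd))

variable {P : Measure Ω} [IsProbabilityMeasure P] {α : ℝ≥0} {γ : Measure ℝ≥0}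

/-- All 2^n cells of a box contribute the same mean, because the law of the surrounding box masses
does not depend on the cell; their sum is the demand of the box. -/
theorem IsCompoundPoisson.lintegral_mass_mul_remainingDemand (hmu : IsCompoundPoisson P α γ mu)
    (hint : HasUnitIntensity P mu) (n : ℕ) (k : Fin d → ℤ) :
    2 ^ n * ∫⁻ ω, mu ω (dyadicBox 0 k) * remainingDemand (mu ω) k n ∂P =
      ∫⁻ ω, boxDemand (cellMasses (mu ω) k) n ∂P := by
  set e := ∫⁻ ω, mu ω (dyadicBox 0 k) * remainingDemand (mu ω) k n ∂P with he
  have hall : ∀ k', ∫⁻ ω, mu ω (dyadicBox 0 k') * remainingDemand (mu ω) k' n ∂P = e := fun k' =>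
    hmu.lintegral_boxMasses_eq k' k (H := fun m => m 0 *
      (survival (boxDemand fun n => (m n).toNNReal) (boxSupply fun n => (m n).toNNReal) n : ℝ≥0))
      ((measurable_pi_apply 0).mul (measurable_survival_toNNReal n).coe_nnreal_ennreal)
  have hsum : ∀ (ν : Measure (EuclideanSpace ℝ (Fin d))) (g : (Fin d → ℤ) → ℝ≥0∞),
      ∑' k', ν (dyadicBox 0 k') * (if boxIndex n k' = boxIndex n k then g k' else 0) =
        ∫⁻ x in dyadicBox n k, g (unitCell x) ∂ν := by
    intro ν g
    rw [tsum_measure_mul_eq_lintegral ν fun k' =>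
      if boxIndex n k' = boxIndex n k then g k' else 0,
      ← lintegral_indicator (measurableSet_dyadicBox n k)]
    refine lintegral_congr fun x => ?_
    by_cases hx : x ∈ dyadicBox n k
    · rw [Set.indicator_of_mem hx, if_pos (by exact hx)]
    · rw [Set.indicator_of_notMem hx, if_neg (by exact hx)]
  have hmeas : ∀ k', Measurable fun ω =>
      mu ω (dyadicBox 0 k') * (remainingDemand (mu ω) k' n : ℝ≥0∞) := fun k' =>
    (mu.measurable_coe (measurableSet_dyadicBox 0 k')).mul
      (measurable_remainingDemand k' n).coe_nnreal_ennreal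
  calc 2 ^ n * e = ∑' k' : Fin d → ℤ, volume (dyadicBox 0 k') *
        (if boxIndex n k' = boxIndex n k then e else 0) := by
        rw [hsum, setLIntegral_const, volume_dyadicBox, mul_comm]
    _ = ∑' k' : Fin d → ℤ, ∫⁻ ω, mu ω (dyadicBox 0 k') * (if boxIndex n k' = boxIndex n k then
          (remainingDemand (mu ω) k' n : ℝ≥0∞) else 0) ∂P := by
        refine tsum_congr fun k' => ?_
        split_ifs
        · rw [hall, volume_dyadicBox, pow_zero, one_mul]
        · simp
    _ = ∫⁻ ω, ∑' k' : Fin d → ℤ, mu ω (dyadicBox 0 k') *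
          (if boxIndex n k' = boxIndex n k then (remainingDemand (mu ω) k' n : ℝ≥0∞) else 0) ∂P := by
        refine (lintegral_tsum fun k' => ?_).symm
        split_ifs
        · exact (hmeas k').aemeasurable
        · simp
    _ = _ := by
        refine lintegral_congr_ae ?_
        filter_upwards [hint.ae_dyadicBox_lt_top] with ω hω
        rw [hsum (mu ω) fun k' => (remainingDemand (mu ω) k' n : ℝ≥0∞),
          setLIntegral_remainingDemand hω]

variable [IsProbabilityMeasure γ]

theorem coe_cellMasses_sub_le (n : ℕ) (k : Fin d → ℤ) (ω : Ω) :
    ((cellMasses (mu ω) k n - 2 ^ n : ℝ≥0) : ℝ≥0∞) ≤ ‖boxDeviation mu n k ω‖ₑ := by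
  rw [enorm_eq_nnnorm, ENNReal.coe_le_coe, ← NNReal.coe_le_coe, NNReal.coe_sub_def, coe_nnnorm,
    Real.norm_eq_abs]
  exact max_le (le_abs_self _) (abs_nonneg _)

theorem IsCompoundPoisson.lintegral_mass_mul_remainingDemand_le
    (hmu : IsCompoundPoisson P α γ mu) (hint : HasUnitIntensity P mu)
    (hmom : weightMoment γ 2 < ∞) : ∃ K : ℝ≥0, ∀ n (k : Fin d → ℤ),
      ∫⁻ ω, mu ω (dyadicBox 0 k) * remainingDemand (mu ω) k n ∂P ≤
        K * (((NNReal.sqrt 2)⁻¹ : ℝ≥0) : ℝ≥0∞) ^ n := by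
  obtain ⟨c, hc⟩ := hmu.lintegral_boxDeviation_le hint hmom
  set s := NNReal.sqrt 2 with hs
  have hs0 : s ≠ 0 := (NNReal.sqrt_pos.2 two_pos).ne'
  have hs2 : s * s = 2 := NNReal.mul_self_sqrt 2
  -- The 1 covers level 0, where unit intensity gives the value 1; the other levels follow from the
  -- first moments of the two half-box deviations.
  refine ⟨1 + c * s, fun n k => ?_⟩
  cases n with
  | zero =>
    have h1 := hint _ (measurableSet_dyadicBox 0 k)
    rw [volume_dyadicBox, pow_zero] at h1
    simp [remainingDemand, survival, h1]
  | succ n =>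
    have h2 : ∫⁻ ω, boxDemand (cellMasses (mu ω) k) (n + 1) ∂P ≤ c * (s : ℝ≥0∞) ^ n +
        c * (s : ℝ≥0∞) ^ n := by
      refine (lintegral_mono_ae (g := fun ω => ‖boxDeviation mu n k ω‖ₑ +
        ‖boxDeviation mu n (siblingCell n k) ω‖ₑ) ?_).trans ?_
      · filter_upwards [hint.ae_dyadicBox_lt_top] with ω hω
        rw [boxDemand_cellMasses_succ hω, ENNReal.coe_add]
        exact add_le_add (coe_cellMasses_sub_le _ _ _) (coe_cellMasses_sub_le _ _ _)
      · have := measurable_boxDeviation (mu := mu) n k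
        rw [lintegral_add_left (by fun_prop)]
        exact add_le_add (hc n k) (hc n _)
    rw [← hmu.lintegral_mass_mul_remainingDemand hint] at h2
    have h3 : c * s ^ n + c * s ^ n ≤ 2 ^ (n + 1) * ((1 + c * s) * s⁻¹ ^ (n + 1)) := by
      have h4 : 2 ^ (n + 1) * ((1 + c * s) * s⁻¹ ^ (n + 1)) = s ^ (n + 1) + 2 * (c * s ^ n) := by
        have h5 : 2 ^ (n + 1) * s⁻¹ ^ (n + 1) = s ^ (n + 1) := by
          rw [← mul_pow, ← hs2, mul_assoc, mul_inv_cancel₀ hs0, mul_one]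
        calc 2 ^ (n + 1) * ((1 + c * s) * s⁻¹ ^ (n + 1))
            = (1 + c * s) * (2 ^ (n + 1) * s⁻¹ ^ (n + 1)) := by ring
          _ = s ^ (n + 1) + s * s * (c * s ^ n) := by
            rw [h5]
            ring
          _ = _ := by rw [hs2]
      rw [h4, ← two_mul]
      exact le_add_self
    refine (ENNReal.mul_le_mul_iff_right (a := 2 ^ (n + 1)) (by simp)
      (ENNReal.pow_ne_top ENNReal.ofNat_ne_top)).1 (h2.trans ?_)
    simpa only [ENNReal.coe_add, ENNReal.coe_mul, ENNReal.coe_pow, ENNReal.coe_ofNat,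
      ENNReal.coe_one] using ENNReal.coe_le_coe.2 h3

/-- The surviving fraction decreases in n, and the mean of cell mass times its infimum is at most K
2^(-n/2) for every n. -/
theorem IsCompoundPoisson.ae_tendsto_remainingDemand (hmu : IsCompoundPoisson P α γ mu)
    (hint : HasUnitIntensity P mu) (hmom : weightMoment γ 2 < ∞) :
    ∀ᵐ ω ∂P, ∀ k : Fin d → ℤ, mu ω (dyadicBox 0 k) ≠ 0 →
      Tendsto (remainingDemand (mu ω) k) atTop (𝓝 0) := by
  obtain ⟨K, hK⟩ := hmu.lintegral_mass_mul_remainingDemand_le hint hmom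
  refine ae_all_iff.2 fun k => ?_
  have hm : Measurable fun ω =>
      mu ω (dyadicBox 0 k) * ⨅ n, (remainingDemand (mu ω) k n : ℝ≥0∞) :=
    (mu.measurable_coe (measurableSet_dyadicBox 0 k)).mul
      (Measurable.iInf fun n => (measurable_remainingDemand k n).coe_nnreal_ennreal)
  have hρ : (((NNReal.sqrt 2)⁻¹ : ℝ≥0) : ℝ≥0∞) < 1 := by
    rw [← ENNReal.coe_one, ENNReal.coe_lt_coe]
    refine inv_lt_one_of_one_lt₀ ?_
    rw [← NNReal.sqrt_one]
    exact NNReal.sqrt_lt_sqrt.2 one_lt_two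
  have h0 : ∫⁻ ω, mu ω (dyadicBox 0 k) * ⨅ n, (remainingDemand (mu ω) k n : ℝ≥0∞) ∂P = 0 := by
    have h1 := ENNReal.Tendsto.const_mul (a := (K : ℝ≥0∞))
      (ENNReal.tendsto_pow_atTop_nhds_zero_of_lt_one hρ) (Or.inr ENNReal.coe_ne_top)
    rw [mul_zero] at h1
    refine le_antisymm (ge_of_tendsto' h1 fun n => ?_) zero_le
    refine le_trans (lintegral_mono fun ω => ?_) (hK n k)
    exact mul_le_mul_right (iInf_le _ n) _
  filter_upwards [(lintegral_eq_zero_iff hm).1 h0] with ω hω hne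
  have h2 := (mul_eq_zero.1 hω).resolve_left hne
  have h3 := tendsto_atTop_iInf (f := fun n => (remainingDemand (mu ω) k n : ℝ≥0∞))
    (antitone_nat_of_succ_le fun n => ENNReal.coe_le_coe.2 (survival_succ_le n))
  rw [h2, ← ENNReal.coe_zero] at h3
  exact ENNReal.tendsto_coe.1 h3

/-- Mass matched at level n travels at most the diameter of a box of that level, and its fraction is
at most what has survived until then. -/
theorem optimalMeanCost_lt_top_of_concave {G : Type*} [Group G]
    [MulAction G (EuclideanSpace ℝ (Fin d))]
    (hG : IsAdmissibleAction G (EuclideanSpace ℝ (Fin d)))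
    (hmu : IsCompoundPoisson P α γ mu) (hint : HasUnitIntensity P mu)
    (hmom : weightMoment γ 2 < ∞) {ϑ : ℝ≥0 → ℝ≥0} {ϑhat : ℝ → ℝ} (hϑ : IsScaleFunction ϑ)
    (hconc : ConcaveOn ℝ (Set.Ici 1) ϑhat) (hle : ∀ r : ℝ≥0, 1 ≤ r → (ϑ r : ℝ) ≤ ϑhat r)
    (hfin : IntegrableOn (fun r : ℝ => ϑhat r / r ^ (1 + (d : ℝ) / 2)) (Set.Ioi 1)) :
    optimalMeanCost P G ϑ (Kernel.const Ω volume) mu < ∞ := by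
  obtain ⟨K, hK⟩ := hmu.lintegral_mass_mul_remainingDemand_le hint hmom
  have hlim := hmu.ae_tendsto_remainingDemand hint hmom
  have hpos : ∀ r, 1 ≤ r → 0 ≤ ϑhat r := fun r hr =>
    (NNReal.coe_nonneg _).trans (hle ⟨r, zero_le_one.trans hr⟩ hr)
  obtain ⟨z, X, hz, hX, -, -, -, hrep⟩ := id hmu
  have hFm : Measurable fun m : ℕ → ℝ≥0∞ => ∑' n, (ϑ (boxDiameter d n) : ℝ≥0∞) *
      (survival (boxDemand fun n => (m n).toNNReal) (boxSupply fun n => (m n).toNNReal) n : ℝ≥0) :=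
    Measurable.tsum fun n => (measurable_survival_toNNReal n).coe_nnreal_ennreal.const_mul _
  refine optimalMeanCost_lt_top_of_density (z := z) (X := X)
    (f := fun k ω x => ∑' n, levelDensity (mu ω) n k (unitCell x))
    (F := fun k ω => ∑' n, (ϑ (boxDiameter d n) : ℝ≥0∞) * (remainingDemand (mu ω) k n : ℝ≥0∞))
    (C := ∑' n, (ϑ (boxDiameter d n) : ℝ≥0∞) * (K * (((NNReal.sqrt 2)⁻¹ : ℝ≥0) : ℝ≥0∞) ^ n))
    hG hz.measurable hX hrep (fun k => Measurable.tsum fun n => measurable_levelDensity n k) ?_ ?_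
    hϑ.continuous.measurable (fun k => Measurable.tsum fun n =>
      (measurable_remainingDemand k n).coe_nnreal_ennreal.const_mul _) ?_ ?_ ?_
  · filter_upwards [hint.ae_dyadicBox_lt_top, hlim] with ω h1 h2 k h0
    exact lintegral_tsum_levelDensity h1 h0 (h2 k h0)
  · filter_upwards [hint.ae_dyadicBox_lt_top] with ω h1 x
    exact tsum_measure_mul_tsum_levelDensity_le h1 _
  · filter_upwards [hint.ae_dyadicBox_lt_top] with ω h1 k h0 y hy
    have hm : ∀ n, Measurable fun x => levelDensity (mu ω) n k (unitCell x) := fun n =>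
      (measurable_levelDensity n k).of_uncurry_left
    have hn := hϑ.continuous.measurable
    simp only [← ENNReal.tsum_mul_right]
    have hmn : ∀ n, AEMeasurable (fun x => levelDensity (mu ω) n k (unitCell x) *
        (ϑ (nndist x y) : ℝ≥0∞)) volume := fun n => by
      have := hm n
      fun_prop
    rw [lintegral_tsum hmn]
    refine ENNReal.tsum_le_tsum fun n => ?_
    calc ∫⁻ x, levelDensity (mu ω) n k (unitCell x) * ϑ (nndist x y)
        ≤ ∫⁻ x, levelDensity (mu ω) n k (unitCell x) * ϑ (boxDiameter d n) := by
          refine lintegral_mono fun x => ?_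
          by_cases hx : x ∈ dyadicBox n k
          · refine mul_le_mul_right (ENNReal.coe_le_coe.2 (hϑ.strictMono.monotone ?_)) _
            rw [← NNReal.coe_le_coe, coe_nndist, boxDiameter]
            push_cast
            exact dist_le_of_mem_dyadicBox hx (dyadicBox_mono k (Nat.zero_le n) hy)
          · rw [levelDensity, if_neg (by exact hx), zero_mul, zero_mul]
      _ ≤ (ϑ (boxDiameter d n) : ℝ≥0∞) * (remainingDemand (mu ω) k n : ℝ≥0∞) := by
          rw [lintegral_mul_const' _ _ ENNReal.coe_ne_top, lintegral_levelDensity h1, mul_comm]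
          refine mul_le_mul_right (ENNReal.coe_le_coe.2 ?_) _
          exact mul_le_of_le_one_right' (div_le_one_of_le₀ (le_max_right _ _) zero_le)
  · have h1 := tsum_ofReal_boxDiameter_lt_top hconc hpos hfin
    calc _ ≤ ∑' n, (K : ℝ≥0∞) * (ENNReal.ofReal (ϑhat (boxDiameter d n)) *
          (((NNReal.sqrt 2)⁻¹ : ℝ≥0) : ℝ≥0∞) ^ n) := by
          refine ENNReal.tsum_le_tsum fun n => ?_
          rw [mul_left_comm]
          gcongr
          rw [← ENNReal.ofReal_coe_nnreal]
          exact ENNReal.ofReal_le_ofReal (hle _ (one_lt_boxDiameter n).le)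
      _ < ∞ := by
          rw [ENNReal.tsum_mul_left]
          exact ENNReal.mul_lt_top ENNReal.coe_lt_top h1
  · intro k B hB hBk
    have h1 := hmu.lintegral_mass_mul_boxMasses hB hBk hFm
    refine (le_of_eq h1).trans ?_
    rw [mul_comm]
    gcongr
    simp only [← ENNReal.tsum_mul_left]
    have hmn : ∀ n, AEMeasurable (fun ω => mu ω (dyadicBox 0 k) * ((ϑ (boxDiameter d n) : ℝ≥0∞) *
        (survival (boxDemand fun n => (mu ω (dyadicBox n k)).toNNReal)
          (boxSupply fun n => (mu ω (dyadicBox n k)).toNNReal) n : ℝ≥0))) P := fun n =>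
      ((mu.measurable_coe (measurableSet_dyadicBox 0 k)).mul
        ((measurable_remainingDemand k n).coe_nnreal_ennreal.const_mul _)).aemeasurable
    rw [lintegral_tsum hmn]
    refine ENNReal.tsum_le_tsum fun n => ?_
    calc _ = ∫⁻ ω, (ϑ (boxDiameter d n) : ℝ≥0∞) *
          (mu ω (dyadicBox 0 k) * (remainingDemand (mu ω) k n : ℝ≥0∞)) ∂P :=
          lintegral_congr fun ω => mul_left_comm _ _ _
      _ ≤ _ := by
          rw [lintegral_const_mul' _ _ ENNReal.coe_ne_top]
          exact mul_le_mul_right (hK n k) _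

end ConcaveCost

theorem mainTheorem10 {Ω : Type*} [MeasurableSpace Ω] (P : Measure Ω) [IsProbabilityMeasure P]
    (d : ℕ) (hd : 1 ≤ d)
    (G : Type*) [Group G] [MulAction G (EuclideanSpace ℝ (Fin d))]
    (hG : IsAdmissibleAction G (EuclideanSpace ℝ (Fin d)))
    (α : ℝ≥0) (γ : Measure ℝ≥0) [IsProbabilityMeasure γ]
    (mu : Kernel Ω (EuclideanSpace ℝ (Fin d)))
    (hmu : IsCompoundPoisson P α γ mu) (hint : HasUnitIntensity P mu) :
    (∀ (ϑ : ℝ≥0 → ℝ≥0) (p : ℝ), IsScaleFunction ϑ → 1 < p → weightMoment γ p = ∞ →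
      (∀ r : ℝ≥0, r ^ ((p - 1) * (d : ℝ)) ≤ ϑ r) →
      optimalMeanCost P G ϑ (Kernel.const Ω volume) mu = ∞) ∧
    (d ≤ 2 → weightMoment γ 2 < ∞ →
      ∀ (ϑ : ℝ≥0 → ℝ≥0) (ϑhat : ℝ → ℝ), IsScaleFunction ϑ →
        ConcaveOn ℝ (Set.Ici 1) ϑhat → (∀ r : ℝ≥0, 1 ≤ r → (ϑ r : ℝ) ≤ ϑhat r) →
        IntegrableOn (fun r : ℝ => ϑhat r / r ^ (1 + (d : ℝ) / 2)) (Set.Ioi 1) →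
        optimalMeanCost P G ϑ (Kernel.const Ω volume) mu < ∞) ∧
    (3 ≤ d → ∀ p₀ p : ℝ, IsLUB {q : ℝ | weightMoment γ q < ∞} p₀ → 2 < p₀ →
      0 < p → p < p₀ - 1 →
      optimalMeanCost P G (fun r => r ^ p) (Kernel.const Ω volume) mu < ∞) ∧
    (3 ≤ d → (∀ q : ℝ, 0 < q → weightMoment γ q < ∞) → ∀ p : ℝ, 0 < p →
      optimalMeanCost P G (fun r => r ^ p) (Kernel.const Ω volume) mu < ∞) := by
  have : NeZero d := ⟨by omega⟩
  refine ⟨fun ϑ p hϑ hp hmom hle => optimalMeanCost_eq_top_of_moment_eq_top P hG hmu hint hϑ hp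
      hmom hle,
    fun _ hmom ϑ ϑhat hϑ hconc hle hfin =>
      optimalMeanCost_lt_top_of_concave hG hmu hint hmom hϑ hconc hle hfin,
    fun hd3 p₀ p hp₀ h2 hp hpp₀ => ?_, fun hd3 hmom p hp => ?_⟩
  -- The supremum provides a finite moment of some order beyond both 2 and `p + 1`.
  · obtain ⟨q, hq, hlt⟩ := (lt_isLUB_iff hp₀).1 (max_lt h2 (by linarith : p + 1 < p₀))
    exact optimalMeanCost_rpow_lt_top hG hd3 hmu hint hp ((le_max_left _ _).trans_lt hlt)
      ((le_max_right _ _).trans hlt.le) hq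
  · exact optimalMeanCost_rpow_lt_top hG hd3 hmu hint hp (q := p + 3) (by linarith) (by linarith)
      (hmom _ (by linarith))
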